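/- Let $n,q\in\mathbb N$ with $n\ge 1$, $q\ge 2$, and let $p=(p_1,\dots,p_{q-1})\in\mathbb N_0^{q-1}$ be not identically zero, $|p|_1:=\sum_i p_i$. Let $Q\in\mathbb R[X_1,\dots,X_n]$ be a polynomial of total degree $d$ ($d:=0$ if $Q=0$). Let $\Theta\in M_n(\mathbb R)$ be such that $T:=\frac1{2\pi}\Theta$ is Diophantine, i.e. there are $u\in\mathbb Z^n$ and $\delta,c>0$ with $$|v\cdot {}^tT u-m|\ge c\,|v|^{-\delta}\qquad\text{for all } v\in\mathbb Z^n\setminus\{0\},\ m\in\mathbb Z .$$ Let $\tilde a:(\mathbb Z^n)^{2q}\to\mathbb C$ be a Schwartz sequence, i.e. $(1+|l_1|^2+\dots+|l_{2q}|^2)^r|\tilde a_l|^2$ is bounded in $l=(l_1,\dots,l_{2q})$ for every $r\in\mathbb N_0$. Here $|\cdot|$ is the Euclidean norm on $\mathbb R^n$. For $1\le i\le q-1$ put $\tilde l_i:=l_1+\dots+l_i+l_{q+1}+\dots+l_{q+i}$, and let $$f(s):=\sum_{l\in(\mathbb Z^n)^{2q}}\tilde a_l\sum_{k\in\mathbb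 Z^n\setminus\{0\}}\ \prod_{i=1}^{q-1}|k+\tilde l_i|^{p_i}\,|k|^{-s}\,Q(k)\,e^{i k\cdot\Theta\sum_{j=1}^q l_j}.$$ Let $X=(X_1,\dots,X_n)$ and $Y=(Y_1,\dots,Y_{2q})$, $Y_j=(Y_{j,1},\dots,Y_{j,n})$, be variables and $\tilde Y_i:=Y_1+\dots+Y_i+Y_{q+1}+\dots+Y_{q+i}$. Let $\mathcal I:=\prod_{i:\,p_i\ne0}\mathbb N_0^{p_i}$, and for $\alpha=(\alpha_{i,j})\in\mathcal I$ (where $p_i\ne 0$, $1\le j\le p_i$) put $|\alpha|_1:=\sum_{i,j}\alpha_{i,j}$, $\binom{1/2}{\alpha}:=\prod_{i,j}\binom{1/2}{\alpha_{i,j}}$ and $$P_\alpha(X,Y):=\prod_{i,j}\bigl(2\langle X,\tilde Y_i\rangle+|\tilde Y_i|^2\bigr)^{\alpha_{i,j}},$$ where $\langle X,\tilde Y_i\rangle$ and $|\tilde Y_i|^2$ denote the polynomials $\sum_t X_t\tilde Y_{i,t}$ and $\sum_t\tilde Y_{i,t}^2$. For $\beta\in\mathbb N_0^{(2q+1)n}$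 let $d_\beta:=\beta_1+\dots+\beta_n$, $|\beta|_1:=\sum_i\beta_i$, $X^\beta:=X_1^{\beta_1}\cdots X_n^{\beta_n}$, $Y^\beta:=Y_{1,1}^{\beta_{n+1}}\cdots Y_{2q,n}^{\beta_{(2q+1)n}}$. Let $L(\alpha)$ be the set of all $\beta$ with $|\beta|_1-d_\beta\le 2|\alpha|_1$ and $d_\beta\le|\alpha|_1+d$, define $c_{\alpha,\beta}\in\mathbb R$ by $$\tbinom{1/2}{\alpha}P_\alpha(X,Y)\,Q(X)=\sum_{\beta\in L(\alpha)}c_{\alpha,\beta}X^\beta Y^\beta ,$$ and put $M_{\alpha,\beta}(Y):=c_{\alpha,\beta}Y^\beta$. For $m\in\mathbb N_0$ let $$I(m):=\{(\alpha,\beta)\in\mathcal I\times\mathbb N_0^{(2q+1)n}:\ \beta\in L(\alpha),\ m=2|\alpha|_1-d_\beta+d\},$$ $$C(f,m):=\sum_{l:\ l_1+\dots+l_q=0}\tilde a_l\sum_{(\alpha,\beta)\in I(m)}M_{\alpha,\beta}(l)\int_{S^{n-1}}u^\beta\,dS(u),$$ where $u^\beta:=u_1^{\beta_1}\cdots u_n^{\beta_n}$,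 $dS$ is the surface measure of the unit sphere $S^{n-1}$, and empty sums are $0$. Then the double series defining $f$ converges absolutely for $\operatorname{Re}s>n+d+|p|_1$, each $I(m)$ is finite, the series defining $C(f,m)$ converge, and: (i) $f$ has a meromorphic continuation to $\mathbb C$, whose only possible poles are at the points $s=n+d+|p|_1-m$, $m\in\mathbb N_0$, and these are at most simple; (ii) for every $m\in\mathbb N_0$, the point $s=n+d+|p|_1-m$ is a pole of $f$ if and only if $C(f,m)\ne0$, and in that case it is a simple pole with residue $\operatorname{Res}_{s=n+d+|p|_1-m}f(s)=C(f,m)$. -/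

import Mathlib

open MeasureTheory Topology

noncomputable section

namespace TorusZeta

/-- The Euclidean norm of an integer vector. -/
def eucl {n : ℕ} (k : Fin n → ℤ) : ℝ := Real.sqrt (∑ i, (k i : ℝ) ^ 2)

/-- A vector `a` of `ℝⁿ` is Diophantine: for some `δ > 0` and `c > 0`,
`|q · a - m| ≥ c |q| ^ (-δ)` for all nonzero integer vectors `q` and all integers `m`. -/
def IsDiophantineVec {n : ℕ} (a : Fin n → ℝ) : Prop :=
  ∃ δ : ℝ, 0 < δ ∧ ∃ c : ℝ, 0 < c ∧ ∀ q : Fin n → ℤ, q ≠ 0 → ∀ m : ℤ,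
    c * eucl q ^ (-δ) ≤ |(∑ i, (q i : ℝ) * a i) - (m : ℝ)|

/-- A real matrix is Diophantine if its transpose maps some integer vector to a Diophantine
vector. -/
def IsDiophantineMatrix {n : ℕ} (T : Matrix (Fin n) (Fin n) ℝ) : Prop :=
  ∃ u : Fin n → ℤ, IsDiophantineVec (T.transpose.mulVec (fun i => (u i : ℝ)))

/-- The index set `((ℤⁿ)^q)²`, identified with `(ℤⁿ)^(2q)`: the vector `l_j` with `1 ≤ j ≤ q` is
`l (Sum.inl (j - 1))` and the vector `l_(q+j)` is `l (Sum.inr (j - 1))`. -/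
abbrev Idx (n q : ℕ) : Type := Fin q ⊕ Fin q → Fin n → ℤ

/-- Schwartz (rapidly decreasing) sequences: for every `r`, the quantity
`(1 + |l_1|² + ⋯ + |l_2q|²) ^ r |a_l|²` is bounded. -/
def IsSchwartz {n q : ℕ} (a : Idx n q → ℂ) : Prop :=
  ∀ r : ℕ, ∃ C : ℝ, ∀ l : Idx n q, (1 + ∑ j, eucl (l j) ^ 2) ^ r * ‖a l‖ ^ 2 ≤ C

/-- The partial sums `y_1 + ⋯ + y_i + y_(q+1) + ⋯ + y_(q+i)`, `1 ≤ i ≤ q - 1` (with `i` counted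
from `0` in `Fin (q - 1)`), used both for integer vectors and for vectors of variables. -/
def tilde {q : ℕ} {M : Type*} [AddCommMonoid M] (y : Fin q ⊕ Fin q → M) (i : Fin (q - 1)) : M :=
  ∑ j : Fin q with j.val ≤ i.val, (y (Sum.inl j) + y (Sum.inr j))

/-- The sum `l_1 + ⋯ + l_q`. -/
def firstSum {n q : ℕ} (l : Idx n q) : Fin n → ℤ := ∑ j : Fin q, l (Sum.inl j)

/-- The summand
`∏ i, |k + l̃_i| ^ p_i * |k| ^ (-s) * Q(k) * exp (i k · Θ (l_1 + ⋯ + l_q))`, for `k ≠ 0`. -/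
def zetaTerm {n q : ℕ} (p : Fin (q - 1) → ℕ) (Q : MvPolynomial (Fin n) ℝ)
    (Θ : Matrix (Fin n) (Fin n) ℝ) (l : Idx n q) (k : Fin n → ℤ) (s : ℂ) : ℂ :=
  ((∏ i, eucl (k + tilde l i) ^ p i : ℝ) : ℂ) * (eucl k : ℂ) ^ (-s)
    * ((MvPolynomial.eval (fun i => (k i : ℝ)) Q : ℝ) : ℂ)
    * Complex.exp (Complex.I *
        ((∑ i, (k i : ℝ) * Θ.mulVec (fun j => (firstSum l j : ℝ)) i : ℝ) : ℂ))

/-- The function `f(s) = ∑ l, a_l ∑' k, …`, as a (double) series. -/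
def zetaSeries {n q : ℕ} (a : Idx n q → ℂ) (p : Fin (q - 1) → ℕ) (Q : MvPolynomial (Fin n) ℝ)
    (Θ : Matrix (Fin n) (Fin n) ℝ) (s : ℂ) : ℂ :=
  ∑' l : Idx n q, a l * ∑' k : {k : Fin n → ℤ // k ≠ 0}, zetaTerm p Q Θ l k.1 s

/-! The polynomials `P_α` and the constants `C(f, m)`. -/

/-- The variables `X_1, …, X_n` and `Y_(j,1), …, Y_(j,n)`, `1 ≤ j ≤ 2q`. -/
abbrev Vars (n q : ℕ) : Type := Fin n ⊕ ((Fin q ⊕ Fin q) × Fin n)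

/-- Multi-indices `α = (α_i)` with `α_i ∈ ℕ₀ ^ p_i`. (An index `i` with `p_i = 0` contributes a
one-point factor, so this is the product over the `i` with `p_i ≠ 0`.) -/
abbrev MultiIdx {q : ℕ} (p : Fin (q - 1) → ℕ) : Type := (i : Fin (q - 1)) → Fin (p i) → ℕ

/-- `|α|₁`. -/
def MultiIdx.size {q : ℕ} {p : Fin (q - 1) → ℕ} (α : MultiIdx p) : ℕ := ∑ i, ∑ j, α i j

/-- The generalized binomial coefficient `(1/2 choose α)`. -/
def MultiIdx.binom {q : ℕ} {p : Fin (q - 1) → ℕ} (α : MultiIdx p) : ℝ :=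
  ∏ i, ∏ j, Ring.choose (1 / 2 : ℝ) (α i j)

/-- The vector of variables `X = (X_1, …, X_n)`. -/
def varX (n q : ℕ) : Fin n → MvPolynomial (Vars n q) ℝ := fun t => MvPolynomial.X (Sum.inl t)

/-- The vectors of variables `Y_j = (Y_(j,1), …, Y_(j,n))`. -/
def varY (n q : ℕ) : Fin q ⊕ Fin q → Fin n → MvPolynomial (Vars n q) ℝ :=
  fun j t => MvPolynomial.X (Sum.inr (j, t))

/-- `P_α(X, Y) = ∏ i, ∏ j, (2 ⟨X, Ỹ_i⟩ + |Ỹ_i|²) ^ α_(i,j)`. -/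
def polyP (n : ℕ) {q : ℕ} {p : Fin (q - 1) → ℕ} (α : MultiIdx p) : MvPolynomial (Vars n q) ℝ :=
  ∏ i, ∏ j, (2 * (∑ t, varX n q t * tilde (varY n q) i t)
    + ∑ t, tilde (varY n q) i t ^ 2) ^ α i j

/-- `d_β`, the degree in `X` of the monomial with exponent `β`. -/
def degX {n q : ℕ} (β : Vars n q →₀ ℕ) : ℕ := ∑ t : Fin n, β (Sum.inl t)

/-- `|β|₁ - d_β`, the degree in `Y` of the monomial with exponent `β`. -/
def degY {n q : ℕ} (β : Vars n q →₀ ℕ) : ℕ :=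
  ∑ t : (Fin q ⊕ Fin q) × Fin n, β (Sum.inr t)

/-- The set `L(α)` of exponents. -/
def setL {n q : ℕ} {p : Fin (q - 1) → ℕ} (Q : MvPolynomial (Fin n) ℝ) (α : MultiIdx p) :
    Set (Vars n q →₀ ℕ) :=
  {β | degY β ≤ 2 * α.size ∧ degX β ≤ α.size + Q.totalDegree}

/-- `c_(α,β)`, the coefficient of the monomial with exponent `β` in
`(1/2 choose α) P_α(X, Y) Q(X)`. -/
def coeffC {n q : ℕ} {p : Fin (q - 1) → ℕ} (Q : MvPolynomial (Fin n) ℝ) (α : MultiIdx p)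
    (β : Vars n q →₀ ℕ) : ℝ :=
  MvPolynomial.coeff β
    (MvPolynomial.C α.binom * polyP n α * MvPolynomial.rename Sum.inl Q)

/-- `M_(α,β)(l) = c_(α,β) l ^ β`, where `l` is substituted for `Y`. -/
def coeffM {n q : ℕ} {p : Fin (q - 1) → ℕ} (Q : MvPolynomial (Fin n) ℝ) (α : MultiIdx p)
    (β : Vars n q →₀ ℕ) (l : Idx n q) : ℝ :=
  coeffC Q α β * ∏ t : (Fin q ⊕ Fin q) × Fin n, (l t.1 t.2 : ℝ) ^ β (Sum.inr t)

/-- The integral of `u ^ β = u_1 ^ β_1 ⋯ u_n ^ β_n` over the unit sphere of `ℝⁿ` with its surface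
measure. -/
def sphereIntegral {n q : ℕ} (β : Vars n q →₀ ℕ) : ℝ :=
  ∫ u : Metric.sphere (0 : EuclideanSpace ℝ (Fin n)) 1,
    ∏ t : Fin n, (u : EuclideanSpace ℝ (Fin n)) t ^ β (Sum.inl t)
    ∂(volume : Measure (EuclideanSpace ℝ (Fin n))).toSphere

/-- The set `I(m)` of pairs `(α, β)` with `β ∈ L(α)` and `m = 2 |α|₁ - d_β + d`, where
`d = deg Q`. -/
def setI {n q : ℕ} (p : Fin (q - 1) → ℕ) (Q : MvPolynomial (Fin n) ℝ) (m : ℕ) :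
    Set (MultiIdx p × (Vars n q →₀ ℕ)) :=
  {x | x.2 ∈ setL Q x.1 ∧ (m : ℤ) = 2 * (x.1.size : ℤ) - (degX x.2 : ℤ) + (Q.totalDegree : ℤ)}

/-- The summand of `C(f, m)` at `l`. -/
def constTerm {n q : ℕ} (a : Idx n q → ℂ) (p : Fin (q - 1) → ℕ) (Q : MvPolynomial (Fin n) ℝ)
    (m : ℕ) (l : Idx n q) : ℂ :=
  a l * ((∑ᶠ x ∈ setI (n := n) p Q m, coeffM Q x.1 x.2 l * sphereIntegral x.2 : ℝ) : ℂ)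

/-- `C(f, m)`, a sum over the `l` with `l_1 + ⋯ + l_q = 0`. -/
def constC {n q : ℕ} (a : Idx n q → ℂ) (p : Fin (q - 1) → ℕ) (Q : MvPolynomial (Fin n) ℝ)
    (m : ℕ) : ℂ :=
  ∑' l : {l : Idx n q // firstSum l = 0}, constTerm a p Q m l.1

/-- `F` has residue `c` at `z₀`: near `z₀`, `F` is the sum of a finite principal part
`b_0 / (z - z₀) + b_1 / (z - z₀)² + ⋯ + b_N / (z - z₀) ^ (N + 1)` with `b_0 = c` and of a function
that is analytic at `z₀`. -/
def HasResidueAt (F : ℂ → ℂ) (z₀ c : ℂ) : Prop :=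
  ∃ (N : ℕ) (b : ℕ → ℂ) (g : ℂ → ℂ), b 0 = c ∧ AnalyticAt ℂ g z₀ ∧
    ∀ᶠ z in 𝓝[≠] z₀, F z = (∑ j ∈ Finset.range (N + 1), b j / (z - z₀) ^ (j + 1)) + g z

/-- The point `n + d + |p|₁ - m`, where `d = deg Q`. -/
def polePoint {n q : ℕ} (p : Fin (q - 1) → ℕ) (Q : MvPolynomial (Fin n) ℝ) (m : ℕ) : ℂ :=
  (n : ℂ) + (Q.totalDegree : ℂ) + ((∑ i, p i : ℕ) : ℂ) - (m : ℂ)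

end TorusZeta

end

/-!
The product of norms is expanded in powers of `|k|`. Since `|k + l̃|² = |k|² (1 + t)` with
`t = (2 k · l̃ + |l̃|²) / |k|² ≥ -1`, Taylor's formula for `√(1 + t)` writes
`∏ |k + l̃_i| ^ p_i * Q(k)` as a finite sum of terms `c l ^ β k ^ β |k| ^ (|p|₁ - 2 |α|₁)` and a
remainder that is smaller by a factor `|k| ^ (-R)`, up to a power of `l` that the weights `a_l`
absorb (`exists_mainPart_bound`, `eval_fullPoly`). Hence, up to a function holomorphic on a given
half-plane, `f` is a finite sum of functions
`∑_l b_l ∑_k k ^ β |k| ^ (-z) exp (i k · Θ (l_1 + ⋯ + l_q))` with rapidly decreasing `b` and `z` a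
translate of `s`. These are treated in `exists_continuation_weighted`.

* If `l_1 + ⋯ + l_q ≠ 0`, then the Diophantine condition provides `u ∈ ℤⁿ`, independent of `l`,
  such that the character `k ↦ exp (i k · θ)` with `θ = Θ (l_1 + ⋯ + l_q)` has a value `ζ ≠ 1` at
  `u`, where `|1 - ζ|⁻¹` grows at most polynomially in `l` (`exists_phase_bound`). Summation by
  parts in the direction `u` costs a factor `(1 - ζ)⁻¹` and replaces `g(k) = φ(k) |k| ^ (-z)` by
  `g(k) - g(k - u)`, which has smaller order. Iterating, these sums extend to entire functions
  (`exists_continuation_nonresonant`, `exists_entire_nonresonant`).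
* If `l_1 + ⋯ + l_q = 0`, then the inner sum is `Z(z) = ∑ k ^ β |k| ^ (-z)`. By homogeneity, the sum
  over the multiples of an integer `r` is `r ^ (|β| - z) Z(z)`; detecting these multiples by the
  characters of `(ℤ / r)ⁿ` shows that `(1 - r ^ (n + |β| - z)) Z(z)` is a combination of
  nonresonant sums, hence entire. The factors for `r = 2` and `r = 3` have only the zero
  `z = n + |β|` in common, and it is simple, so `Z` has at most a simple pole there
  (`exists_continuation_resonant`). Its residue is the limit of `(s - n - |β|) Z(s)` along real `s`,
  where `Z(s)` may be replaced by an integral over `ℝⁿ`; polar coordinates yield the integral of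
  `u ^ β` over the sphere (`tendsto_residue_monom`).

The term with index `(α, β)` thus contributes to the pole at `n + d + |p|₁ - m` for
`m = 2 |α|₁ - d_β + d`. As `d_β ≤ |α|₁ + d`, each `m` belongs to finitely many indices, and
the terms outside of a large box of indices `α` do not matter for a given half-plane. This gives a
continuation to every half-plane (`exists_continuation_half_plane`); by the identity theorem the
continuations are compatible (`exists_glued`).
-/

noncomputable section

namespace TorusZeta

/-! ### Norms of integer vectors -/

lemma eucl_eq_norm {n : ℕ} (k : Fin n → ℤ) :
    eucl k = ‖(WithLp.toLp 2 (fun i => (k i : ℝ)) : EuclideanSpace ℝ (Fin n))‖ := by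
  simp [eucl, EuclideanSpace.norm_eq]

lemma eucl_nonneg {n : ℕ} (k : Fin n → ℤ) : 0 ≤ eucl k := Real.sqrt_nonneg _

lemma eucl_sq {n : ℕ} (k : Fin n → ℤ) : eucl k ^ 2 = ∑ i, (k i : ℝ) ^ 2 :=
  Real.sq_sqrt (Finset.sum_nonneg fun _ _ => sq_nonneg _)

@[simp] lemma eucl_zero {n : ℕ} : eucl (0 : Fin n → ℤ) = 0 := by simp [eucl]

lemma one_le_eucl {n : ℕ} {k : Fin n → ℤ} (hk : k ≠ 0) : 1 ≤ eucl k := by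
  obtain ⟨i, hi⟩ := Function.ne_iff.mp hk
  have hi' : k i ≠ 0 := by simpa using hi
  have h1 : (1 : ℝ) ≤ (k i : ℝ) ^ 2 := by
    have : (1 : ℤ) ≤ (k i) ^ 2 := by
      have := sq_pos_of_ne_zero hi'
      omega
    exact_mod_cast this
  rw [eucl, Real.one_le_sqrt]
  exact h1.trans (Finset.single_le_sum (f := fun i => (k i : ℝ) ^ 2)
    (fun _ _ => sq_nonneg _) (Finset.mem_univ i))

lemma eucl_pos {n : ℕ} {k : Fin n → ℤ} (hk : k ≠ 0) : 0 < eucl k :=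
  one_pos.trans_le (one_le_eucl hk)

lemma eucl_add_le {n : ℕ} (k l : Fin n → ℤ) : eucl (k + l) ≤ eucl k + eucl l := by
  simp only [eucl_eq_norm]
  refine le_trans (le_of_eq ?_) (norm_add_le _ _)
  congr 1
  ext i
  simp

lemma eucl_sum_le {n : ℕ} {ι : Type*} (s : Finset ι) (f : ι → Fin n → ℤ) :
    eucl (∑ i ∈ s, f i) ≤ ∑ i ∈ s, eucl (f i) := by
  classical
  induction s using Finset.induction_on with
  | empty => simp
  | insert a s ha ih =>
    rw [Finset.sum_insert ha, Finset.sum_insert ha]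
    exact (eucl_add_le _ _).trans (by gcongr)

lemma abs_coord_le_eucl {n : ℕ} (k : Fin n → ℤ) (i : Fin n) : |(k i : ℝ)| ≤ eucl k := by
  rw [eucl]
  refine Real.abs_le_sqrt ?_
  exact Finset.single_le_sum (f := fun i => (k i : ℝ) ^ 2)
    (fun _ _ => sq_nonneg _) (Finset.mem_univ i)

lemma eucl_smul {n : ℕ} (c : ℕ) (k : Fin n → ℤ) : eucl (fun i => (c : ℤ) * k i) = c * eucl k := by
  simp only [eucl]
  push_cast
  simp_rw [mul_pow]
  rw [← Finset.mul_sum, Real.sqrt_mul (sq_nonneg _), Real.sqrt_sq (Nat.cast_nonneg _)]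

lemma eucl_add_sq {n : ℕ} (k v : Fin n → ℤ) :
    eucl (k + v) ^ 2 = eucl k ^ 2 + (2 * ∑ i, (k i : ℝ) * v i + ∑ i, (v i : ℝ) ^ 2) := by
  simp only [eucl_sq, Pi.add_apply, Int.cast_add, Finset.mul_sum, ← Finset.sum_add_distrib]
  exact Finset.sum_congr rfl fun i _ => by ring

lemma abs_dot_le {n : ℕ} (k v : Fin n → ℤ) :
    |∑ i, (k i : ℝ) * v i| ≤ eucl k * eucl v := by
  refine Real.abs_le_sqrt ?_ |>.trans (le_of_eq ?_) (b := Real.sqrt ((∑ i, (k i : ℝ) ^ 2) *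
    ∑ i, (v i : ℝ) ^ 2))
  · exact Finset.sum_mul_sq_le_sq_mul_sq _ _ _
  · rw [Real.sqrt_mul (Finset.sum_nonneg fun _ _ => sq_nonneg _)]
    rfl

/-- `max 1 |k|`, a version of the Euclidean norm that is bounded below. -/
def jap {n : ℕ} (k : Fin n → ℤ) : ℝ := max 1 (eucl k)

lemma one_le_jap {n : ℕ} (k : Fin n → ℤ) : 1 ≤ jap k := le_max_left _ _

lemma jap_pos {n : ℕ} (k : Fin n → ℤ) : 0 < jap k := one_pos.trans_le (one_le_jap k)

lemma eucl_le_jap {n : ℕ} (k : Fin n → ℤ) : eucl k ≤ jap k := le_max_right _ _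

lemma jap_eq {n : ℕ} {k : Fin n → ℤ} (hk : k ≠ 0) : jap k = eucl k :=
  max_eq_right (one_le_eucl hk)

lemma jap_add_le {n : ℕ} (k l : Fin n → ℤ) : jap (k + l) ≤ 2 * jap l * jap k := by
  have h1 := one_le_jap k
  have h2 := one_le_jap l
  have h3 := eucl_le_jap k
  have h4 := eucl_le_jap l
  refine max_le (by nlinarith) ((eucl_add_le k l).trans (by nlinarith))

/-- Convergence of `∑ ‖v‖ ^ (-r)` over the nonzero vectors of `ℤ ^ ι` for `r > card ι`. -/
lemma summable_int_norm_rpow {ι : Type*} [Fintype ι] {r : ℝ} (hr : (Fintype.card ι : ℝ) < r) :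
    Summable fun k : ι → ℤ => ‖(fun i => (k i : ℝ) : ι → ℝ)‖ ^ (-r) := by
  let b := Pi.basisFun ℝ ι
  let Λ := Submodule.span ℤ (Set.range b)
  have hfr : Module.finrank ℤ Λ = Fintype.card ι := by
    rw [ZLattice.rank ℝ Λ, Module.finrank_fintype_fun_eq_card]
  have hs := ZLattice.summable_norm_rpow Λ (-r) (by rw [hfr]; linarith)
  have hmem : ∀ k : ι → ℤ, (fun i => (k i : ℝ) : ι → ℝ) ∈ Λ := by
    intro k
    rw [(Module.Basis.mem_span_iff_repr_mem ℤ b _)]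
    intro i
    exact ⟨k i, by simp [b]⟩
  have hinj : Function.Injective fun k : ι → ℤ => (⟨_, hmem k⟩ : Λ) := by
    intro k l h
    have h' := congrArg Subtype.val h
    ext i
    have h'' := congrFun h' i
    simpa using h''
  exact (hs.comp_injective hinj).congr fun k => rfl

lemma summable_jap_rpow {n : ℕ} {r : ℝ} (hr : (n : ℝ) < r) :
    Summable fun k : Fin n → ℤ => jap k ^ (-r) := by
  have h := summable_int_norm_rpow (ι := Fin n) (r := r) (by simpa using hr)
  refine (h.add (summable_of_hasFiniteSupport
    (f := fun k : Fin n → ℤ => if k = 0 then (1 : ℝ) else 0)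
    (Set.Finite.subset (Set.finite_singleton 0) ?_))).of_nonneg_of_le
    (fun k => (Real.rpow_nonneg (jap_pos k).le _)) ?_
  · intro k hk
    by_contra h
    simp_all
  · intro k
    have hr0 : 0 ≤ r := (Nat.cast_nonneg n).trans hr.le
    split_ifs with hk
    · refine le_add_of_nonneg_of_le (Real.rpow_nonneg (norm_nonneg _) _) ?_
      exact Real.rpow_le_one_of_one_le_of_nonpos (one_le_jap k) (by linarith)
    · rw [add_zero]
      refine Real.rpow_le_rpow_of_nonpos ?_ ?_ (by linarith)
      · rw [norm_pos_iff]
        intro h0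
        apply hk
        ext i
        simpa using congrFun h0 i
      · rw [pi_norm_le_iff_of_nonneg (jap_pos k).le]
        intro i
        exact (abs_coord_le_eucl k i).trans (eucl_le_jap k)

/-! ### Polynomial functions on the integer lattice -/

/-- `IsPolyFun D φ` says that `φ : ℤⁿ → ℂ` is given by a polynomial of degree at most `D`. -/
inductive IsPolyFun {n : ℕ} : ℕ → ((Fin n → ℤ) → ℂ) → Prop
  | const (c : ℂ) : IsPolyFun 0 fun _ => c
  | succ {D : ℕ} {φ : (Fin n → ℤ) → ℂ} : IsPolyFun D φ → IsPolyFun (D + 1) φ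
  | add {D : ℕ} {φ ψ : (Fin n → ℤ) → ℂ} : IsPolyFun D φ → IsPolyFun D ψ →
      IsPolyFun D fun k => φ k + ψ k
  | coord_mul {D : ℕ} {φ : (Fin n → ℤ) → ℂ} (i : Fin n) : IsPolyFun D φ →
      IsPolyFun (D + 1) fun k => (k i : ℂ) * φ k

namespace IsPolyFun

variable {n : ℕ} {D E : ℕ} {φ ψ : (Fin n → ℤ) → ℂ}

lemma mono (h : IsPolyFun D φ) (hDE : D ≤ E) : IsPolyFun E φ := by
  induction hDE with
  | refl => exact h
  | step _ ih => exact ih.succ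

lemma const' (c : ℂ) : IsPolyFun (n := n) D fun _ => c := (IsPolyFun.const c).mono (Nat.zero_le _)

lemma const_mul (c : ℂ) (h : IsPolyFun D φ) : IsPolyFun D fun k => c * φ k := by
  induction h with
  | const c' => exact .const _
  | succ _ ih => exact ih.succ
  | add _ _ ih₁ ih₂ => simpa only [mul_add] using ih₁.add ih₂
  | coord_mul i _ ih => simpa only [mul_left_comm] using ih.coord_mul i

lemma mul (h : IsPolyFun D φ) (h' : IsPolyFun E ψ) : IsPolyFun (D + E) fun k => φ k * ψ k := by
  induction h with
  | const c => simpa using h'.const_mul c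
  | succ _ ih => exact ih.mono (by omega)
  | add _ _ ih₁ ih₂ => simpa only [add_mul] using ih₁.add ih₂
  | coord_mul i _ ih => simpa only [mul_assoc] using (ih.coord_mul i).mono (by omega)

lemma pow (h : IsPolyFun D φ) (a : ℕ) : IsPolyFun (D * a) fun k => φ k ^ a := by
  induction a with
  | zero => simpa using IsPolyFun.const (n := n) 1
  | succ a ih => simpa only [pow_succ] using (ih.mul h).mono (by ring_nf; rfl)

lemma sum {ι : Type*} (s : Finset ι) {f : ι → (Fin n → ℤ) → ℂ} (h : ∀ i ∈ s, IsPolyFun D (f i)) :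
    IsPolyFun D fun k => ∑ i ∈ s, f i k := by
  classical
  induction s using Finset.induction_on with
  | empty => simpa using IsPolyFun.const' (n := n) 0
  | insert a s ha ih =>
    simp only [Finset.sum_insert ha]
    exact (h a (by simp)).add (ih fun i hi => h i (by simp [hi]))

lemma prod {ι : Type*} (s : Finset ι) {d : ι → ℕ} {f : ι → (Fin n → ℤ) → ℂ}
    (h : ∀ i ∈ s, IsPolyFun (d i) (f i)) : IsPolyFun (∑ i ∈ s, d i) fun k => ∏ i ∈ s, f i k := by
  classical
  induction s using Finset.induction_on with
  | empty => simpa using IsPolyFun.const (n := n) 1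
  | insert a s ha ih =>
    simp only [Finset.prod_insert ha, Finset.sum_insert ha]
    exact (h a (by simp)).mul (ih fun i hi => h i (by simp [hi]))

lemma coord (i : Fin n) : IsPolyFun 1 fun k => (k i : ℂ) := by
  simpa using (IsPolyFun.const (n := n) 1).coord_mul i

lemma shift (h : IsPolyFun D φ) (u : Fin n → ℤ) : IsPolyFun D fun k => φ (k - u) := by
  induction h with
  | const c => exact .const _
  | succ _ ih => exact ih.succ
  | add _ _ ih₁ ih₂ => exact ih₁.add ih₂
  | coord_mul i _ ih =>
    simpa only [Pi.sub_apply, Int.cast_sub, sub_mul, neg_mul, ← sub_eq_add_neg] using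
      (ih.coord_mul i).add (ih.const_mul (-(u i : ℂ))).succ

/-- A difference of a polynomial function has smaller degree. -/
lemma shift_sub (h : IsPolyFun D φ) (u : Fin n → ℤ) :
    IsPolyFun (D - 1) (fun k => φ (k - u) - φ k) ∧ (D = 0 → ∀ k, φ (k - u) - φ k = 0) := by
  induction h with
  | const c => exact ⟨by simpa using IsPolyFun.const' (n := n) 0, by simp⟩
  | @succ D φ _ ih => exact ⟨ih.1.mono (by omega), by simp⟩
  | @add D φ ψ _ _ ih₁ ih₂ =>
    refine ⟨by simpa only [add_sub_add_comm] using ih₁.1.add ih₂.1, fun hD k => ?_⟩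
    rw [add_sub_add_comm, ih₁.2 hD, ih₂.2 hD, add_zero]
  | @coord_mul D φ i h ih =>
    refine ⟨?_, by simp⟩
    have key : (fun k : Fin n → ℤ => (((k - u) i : ℤ) : ℂ) * φ (k - u) - (k i : ℂ) * φ k) =
        fun k => (k i : ℂ) * (φ (k - u) - φ k) + -(u i : ℂ) * φ (k - u) := by
      ext k
      simp only [Pi.sub_apply, Int.cast_sub]
      ring
    rw [key]
    rcases Nat.eq_zero_or_pos D with rfl | hD
    · simp only [ih.2 rfl, mul_zero, zero_add]
      exact (h.shift u).const_mul _
    · refine .add ?_ ((h.shift u).const_mul _)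
      simpa [Nat.sub_add_cancel hD] using ih.1.coord_mul i

lemma exists_bound (h : IsPolyFun D φ) : ∃ C : ℝ, 0 ≤ C ∧ ∀ k, ‖φ k‖ ≤ C * jap k ^ D := by
  induction h with
  | const c => exact ⟨‖c‖, norm_nonneg _, by simp⟩
  | @succ D φ _ ih =>
    obtain ⟨C, hC, h⟩ := ih
    refine ⟨C, hC, fun k => (h k).trans ?_⟩
    gcongr
    exacts [one_le_jap k, by omega]
  | @add D φ ψ _ _ ih₁ ih₂ =>
    obtain ⟨C, hC, h⟩ := ih₁
    obtain ⟨C', hC', h'⟩ := ih₂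
    refine ⟨C + C', by positivity, fun k => (norm_add_le _ _).trans ?_⟩
    rw [add_mul]
    exact add_le_add (h k) (h' k)
  | @coord_mul D φ i _ ih =>
    obtain ⟨C, hC, h⟩ := ih
    refine ⟨C, hC, fun k => ?_⟩
    have h1 : ‖(k i : ℂ)‖ ≤ jap k := by
      rw [Complex.norm_intCast]
      exact (abs_coord_le_eucl k i).trans (eucl_le_jap k)
    have hj := jap_pos k
    rw [norm_mul, pow_succ, ← mul_assoc, mul_comm]
    exact mul_le_mul (h k) h1 (norm_nonneg _) (by positivity)

end IsPolyFun

/-! ### The functions `φ(k) |k| ^ (-z)` -/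

/-- The function `φ(k) |k| ^ (-z)` of `k ∈ ℤⁿ`, extended by `0` at `k = 0`. -/
def homTerm {n : ℕ} (φ : (Fin n → ℤ) → ℂ) (z : ℂ) (k : Fin n → ℤ) : ℂ :=
  if k = 0 then 0 else φ k * (eucl k : ℂ) ^ (-z)

lemma homTerm_zero {n : ℕ} (φ : (Fin n → ℤ) → ℂ) (z : ℂ) : homTerm φ z 0 = 0 := if_pos rfl

lemma homTerm_of_ne {n : ℕ} (φ : (Fin n → ℤ) → ℂ) (z : ℂ) {k : Fin n → ℤ} (hk : k ≠ 0) :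
    homTerm φ z k = φ k * (eucl k : ℂ) ^ (-z) := if_neg hk

lemma norm_homTerm_le {n : ℕ} (φ : (Fin n → ℤ) → ℂ) (z : ℂ) (k : Fin n → ℤ) :
    ‖homTerm φ z k‖ ≤ ‖φ k‖ * jap k ^ (-z.re) := by
  by_cases hk : k = 0
  · rw [hk, homTerm_zero, norm_zero]
    exact mul_nonneg (norm_nonneg _) (Real.rpow_nonneg (jap_pos _).le _)
  · rw [homTerm_of_ne _ _ hk, norm_mul, Complex.norm_cpow_eq_rpow_re_of_pos (eucl_pos hk),
      jap_eq hk, Complex.neg_re]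

lemma differentiable_homTerm {n : ℕ} (φ : (Fin n → ℤ) → ℂ) (k : Fin n → ℤ) :
    Differentiable ℂ fun z => homTerm φ z k := by
  by_cases hk : k = 0
  · simp [hk, homTerm_zero]
  · simp only [homTerm_of_ne _ _ hk]
    have : (eucl k : ℂ) ≠ 0 := by exact_mod_cast (eucl_pos hk).ne'
    intro z
    exact ((differentiableAt_id.neg).const_cpow (Or.inl this)).const_mul _

lemma IsPolyFun.exists_homTerm_bound {n D : ℕ} {φ : (Fin n → ℤ) → ℂ} (h : IsPolyFun D φ) :
    ∃ C : ℝ, 0 ≤ C ∧ ∀ (σ : ℝ) (z : ℂ), σ ≤ z.re → ∀ k,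
      ‖homTerm φ z k‖ ≤ C * jap k ^ (-(σ - D)) := by
  obtain ⟨C, hC, hb⟩ := h.exists_bound
  refine ⟨C, hC, fun σ z hz k => (norm_homTerm_le φ z k).trans ?_⟩
  have hj := one_le_jap k
  have hj' := jap_pos k
  calc ‖φ k‖ * jap k ^ (-z.re) ≤ (C * jap k ^ D) * jap k ^ (-σ) := by
        gcongr
        · exact hb k
    _ = C * jap k ^ (-(σ - D)) := by
        rw [mul_assoc, ← Real.rpow_natCast, ← Real.rpow_add hj']
        congr 2
        ring

/-! ### Remainders of the binomial series -/

lemma succ_mul_choose_succ (w : ℂ) (a : ℕ) :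
    ((a : ℂ) + 1) * Ring.choose w (a + 1) = w * Ring.choose (w - 1) a := by
  have h := Ring.choose_smul_choose w (n := a + 1) (k := 1) (by omega)
  rw [Nat.choose_one_right, Ring.choose_one_right, nsmul_eq_mul, Nat.add_sub_cancel] at h
  exact_mod_cast h

lemma differentiable_choose (a : ℕ) : Differentiable ℂ fun w : ℂ => Ring.choose w a := by
  induction a with
  | zero => simp
  | succ a ih =>
    have h1 : ((a : ℂ) + 1) ≠ 0 := by exact_mod_cast Nat.succ_ne_zero a
    have : (fun w : ℂ => Ring.choose w (a + 1)) =
        fun w => ((a : ℂ) + 1)⁻¹ * (w * Ring.choose (w - 1) a) := by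
      ext w
      rw [← succ_mul_choose_succ, inv_mul_cancel_left₀ h1]
    rw [this]
    exact ((differentiable_id.mul (ih.comp (differentiable_id.sub_const 1))).const_mul _)

/-- The remainder of the binomial series, uniformly for bounded exponents. It is bounded by
induction on the order, as its derivative is a remainder of lower order for the exponent
`w - 1`. -/
lemma exists_binomial_remainder (R : ℕ) : ∀ B : ℝ, ∃ C : ℝ, 0 ≤ C ∧ ∀ w : ℂ, ‖w‖ ≤ B →
    ∀ t : ℝ, |t| ≤ 1 / 2 →
      ‖((1 + t : ℝ) : ℂ) ^ w - ∑ a ∈ Finset.range R, Ring.choose w a * (t : ℂ) ^ a‖ ≤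
        C * |t| ^ R := by
  induction R with
  | zero =>
    intro B
    refine ⟨2 ^ B, by positivity, fun w hw t ht => ?_⟩
    rw [abs_le] at ht
    have h1 : (0 : ℝ) < 1 + t := by linarith
    have hw' := (Complex.abs_re_le_norm w).trans hw
    rw [abs_le] at hw'
    simp only [Finset.range_zero, Finset.sum_empty, sub_zero, pow_zero, mul_one]
    rw [Complex.norm_cpow_eq_rpow_re_of_pos h1]
    rcases le_total 0 w.re with h | h
    · calc (1 + t) ^ w.re ≤ 2 ^ w.re := Real.rpow_le_rpow h1.le (by linarith) h
        _ ≤ 2 ^ B := Real.rpow_le_rpow_of_exponent_le (by norm_num) hw'.2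
    · calc (1 + t) ^ w.re ≤ (1 / 2) ^ w.re :=
            Real.rpow_le_rpow_of_nonpos (by norm_num) (by linarith) h
        _ = 2 ^ (-w.re) := by
            rw [one_div, Real.inv_rpow (by norm_num), Real.rpow_neg (by norm_num)]
        _ ≤ 2 ^ B := Real.rpow_le_rpow_of_exponent_le (by norm_num) (by linarith)
  | succ R ih =>
    intro B
    obtain ⟨C, hC, h⟩ := ih (B + 1)
    refine ⟨|B| * C, by positivity, fun w hw t ht => ?_⟩
    set F : ℝ → ℂ := fun t =>
      ((1 + t : ℝ) : ℂ) ^ w - ∑ a ∈ Finset.range (R + 1), Ring.choose w a * (t : ℂ) ^ a with hF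
    set F' : ℝ → ℂ := fun t =>
      w * (((1 + t : ℝ) : ℂ) ^ (w - 1) -
        ∑ a ∈ Finset.range R, Ring.choose (w - 1) a * (t : ℂ) ^ a) with hF'
    have hder : ∀ x : ℝ, |x| ≤ 1 / 2 → HasDerivAt F (F' x) x := by
      intro x hx
      rw [abs_le] at hx
      have h1 : HasDerivAt (fun t : ℝ => ((1 + t : ℝ) : ℂ)) 1 x := by
        have := ((hasDerivAt_id x).const_add 1).ofReal_comp
        simpa using this
      have hs : ((1 + x : ℝ) : ℂ) ∈ Complex.slitPlane :=
        Complex.ofReal_mem_slitPlane.2 (by linarith)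
      have h2 : HasDerivAt (fun t : ℝ => ((1 + t : ℝ) : ℂ) ^ w)
          (w * ((1 + x : ℝ) : ℂ) ^ (w - 1) * 1) x :=
        HasDerivAt.comp (𝕜 := ℝ) (h₂ := fun y : ℂ => y ^ w) x
          (((hasDerivAt_id (((1 + x : ℝ) : ℂ))).cpow_const hs).congr_deriv (by simp)) h1
      have h3 : HasDerivAt (fun t : ℝ => ∑ a ∈ Finset.range (R + 1),
          Ring.choose w a * (t : ℂ) ^ a)
          (∑ a ∈ Finset.range (R + 1), Ring.choose w a * (a * (x : ℂ) ^ (a - 1))) x := by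
        refine HasDerivAt.fun_sum fun a _ => ?_
        have h4 : HasDerivAt (fun t : ℝ => (t : ℂ)) 1 x := by
          simpa using (hasDerivAt_id x).ofReal_comp
        simpa using (h4.pow a).const_mul (Ring.choose w a)
      refine (h2.sub h3).congr_deriv ?_
      rw [Finset.sum_range_succ', hF']
      simp only [mul_one, mul_sub, Finset.mul_sum, Nat.cast_zero, zero_mul, mul_zero, add_zero,
        Nat.add_sub_cancel]
      congr 1
      refine Finset.sum_congr rfl fun a _ => ?_
      rw [← mul_assoc, ← mul_assoc, ← succ_mul_choose_succ]
      push_cast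
      ring
    have hF0 : F 0 = 0 := by
      simp [hF, Finset.sum_range_succ']
    have hbd : ∀ x ∈ Set.uIcc 0 t, ‖F' x‖ ≤ |B| * (C * |t| ^ R) := by
      intro x hx
      have hxt : |x| ≤ |t| := by
        rw [Set.mem_uIcc] at hx
        rcases hx with hx | hx
        · rw [abs_of_nonneg hx.1, abs_of_nonneg (hx.1.trans hx.2)]
          exact hx.2
        · rw [abs_of_nonpos hx.2, abs_of_nonpos (hx.1.trans hx.2)]
          linarith
      rw [hF', norm_mul]
      refine mul_le_mul (hw.trans (le_abs_self B)) ?_ (norm_nonneg _) (abs_nonneg _)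
      refine (h (w - 1) ?_ x (hxt.trans ht)).trans (by gcongr)
      exact (norm_sub_le _ _).trans (by simpa using hw)
    have hmv := Convex.norm_image_sub_le_of_norm_hasDerivWithin_le (f := F) (f' := F')
      (s := Set.uIcc 0 t) (x := 0) (y := t) (C := |B| * (C * |t| ^ R)) ?_ hbd
      (convex_uIcc 0 t) Set.left_mem_uIcc Set.right_mem_uIcc
    · rw [hF0, sub_zero] at hmv
      refine hmv.trans (le_of_eq ?_)
      rw [sub_zero, Real.norm_eq_abs, pow_succ]
      ring
    · intro x hx
      refine (hder x ?_).hasDerivWithinAt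
      rw [Set.mem_uIcc] at hx
      rw [abs_le] at ht ⊢
      rcases hx with hx | hx <;> constructor <;> linarith [hx.1, hx.2, ht.1, ht.2]

/-! ### Oscillating lattice sums -/

/-- The character `k ↦ exp (i k · θ)` of `ℤⁿ`. -/
def phase {n : ℕ} (θ : Fin n → ℝ) (k : Fin n → ℤ) : ℂ :=
  Complex.exp (Complex.I * ((∑ i, (k i : ℝ) * θ i : ℝ) : ℂ))

lemma norm_phase {n : ℕ} (θ : Fin n → ℝ) (k : Fin n → ℤ) : ‖phase θ k‖ = 1 := by
  rw [phase, mul_comm, Complex.norm_exp_ofReal_mul_I]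

lemma phase_add {n : ℕ} (θ : Fin n → ℝ) (k l : Fin n → ℤ) :
    phase θ (k + l) = phase θ k * phase θ l := by
  rw [phase, phase, phase, ← Complex.exp_add, ← mul_add, ← Complex.ofReal_add,
    ← Finset.sum_add_distrib]
  simp only [Pi.add_apply, Int.cast_add, add_mul]

/-- The sum `∑ b_i g(k) exp (i k · θ_i)` over all `i` and all `k ∈ ℤⁿ`. -/
def phaseSum {n : ℕ} {ι : Type*} (b : ι → ℂ) (θ : ι → Fin n → ℝ) (g : (Fin n → ℤ) → ℂ) : ℂ :=
  ∑' x : ι × (Fin n → ℤ), b x.1 * (g x.2 * phase (θ x.1) x.2)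

section phaseSum

variable {n : ℕ} {ι : Type*} {b : ι → ℂ} {θ : ι → Fin n → ℝ}

lemma summable_phaseSum (hb : Summable fun i => ‖b i‖) {g : (Fin n → ℤ) → ℂ}
    {r : (Fin n → ℤ) → ℝ} (hr : Summable r) (hg : ∀ k, ‖g k‖ ≤ r k) :
    Summable fun x : ι × (Fin n → ℤ) => b x.1 * (g x.2 * phase (θ x.1) x.2) := by
  have h := hb.mul_of_nonneg hr (fun _ => norm_nonneg _) (fun k => (norm_nonneg _).trans (hg k))
  refine .of_norm_bounded h fun x => ?_
  rw [norm_mul, norm_mul, norm_phase, mul_one]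
  exact mul_le_mul_of_nonneg_left (hg _) (norm_nonneg _)

lemma differentiableOn_phaseSum (hb : Summable fun i => ‖b i‖) {U : Set ℂ} (hU : IsOpen U)
    {g : ℂ → (Fin n → ℤ) → ℂ} (hd : ∀ k, Differentiable ℂ fun z => g z k)
    {r : (Fin n → ℤ) → ℝ} (hr : Summable r) (hg : ∀ k, ∀ z ∈ U, ‖g z k‖ ≤ |r k|) :
    DifferentiableOn ℂ (fun z => phaseSum b θ (g z)) U := by
  have h := hb.mul_of_nonneg hr.abs (fun _ => norm_nonneg _) (fun k => abs_nonneg _)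
  refine Complex.differentiableOn_tsum_of_summable_norm h (fun x => ?_) hU fun x z hz => ?_
  · exact (((hd x.2).mul_const _).const_mul _).differentiableOn
  · rw [norm_mul, norm_mul, norm_phase, mul_one]
    exact mul_le_mul_of_nonneg_left (hg _ _ hz) (norm_nonneg _)

lemma phaseSum_add (hb : Summable fun i => ‖b i‖) {g h : (Fin n → ℤ) → ℂ}
    (hg : Summable fun k => ‖g k‖) (hh : Summable fun k => ‖h k‖) :
    phaseSum b θ (fun k => g k + h k) = phaseSum b θ g + phaseSum b θ h := by
  rw [phaseSum, phaseSum, phaseSum, ← Summable.tsum_add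
    (summable_phaseSum hb hg fun _ => le_rfl) (summable_phaseSum hb hh fun _ => le_rfl)]
  simp only [add_mul, mul_add]

lemma phaseSum_const_mul (c : ℂ) (g : (Fin n → ℤ) → ℂ) :
    phaseSum b θ (fun k => c * g k) = c * phaseSum b θ g := by
  rw [phaseSum, phaseSum, ← tsum_mul_left]
  exact tsum_congr fun x => by ring

lemma phaseSum_sum (hb : Summable fun i => ‖b i‖) {κ : Type*} (s : Finset κ)
    {g : κ → (Fin n → ℤ) → ℂ} (hg : ∀ j ∈ s, Summable fun k => ‖g j k‖) :
    phaseSum b θ (fun k => ∑ j ∈ s, g j k) = ∑ j ∈ s, phaseSum b θ (g j) := by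
  simp only [phaseSum]
  rw [← Summable.tsum_finsetSum fun j hj => summable_phaseSum hb (hg j hj) fun _ => le_rfl]
  simp only [Finset.sum_mul, Finset.mul_sum]

/-- Summation by parts: shifting the summation variable by `u` multiplies the characters by the
constants `phase (θ i) u`. -/
lemma phaseSum_eq_sub_shift (u : Fin n → ℤ) (hθ : ∀ i, phase (θ i) u ≠ 1)
    (hb : Summable fun i => ‖b i‖ * ‖1 - phase (θ i) u‖⁻¹)
    {g : (Fin n → ℤ) → ℂ} (hg : Summable fun k => ‖g k‖) :
    phaseSum b θ g =
      phaseSum (fun i => b i * (1 - phase (θ i) u)⁻¹) θ (fun k => g k - g (k - u)) := by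
  have hb' : Summable fun i => ‖b i * (1 - phase (θ i) u)⁻¹‖ := by
    simpa only [norm_mul, norm_inv] using hb
  have hg' : Summable fun k => ‖g (k - u)‖ := (Equiv.subRight u).summable_iff.mpr hg
  have e : phaseSum (fun i => b i * (1 - phase (θ i) u)⁻¹) θ (fun k => g (k - u)) =
      ∑' x : ι × (Fin n → ℤ), b x.1 * (1 - phase (θ x.1) u)⁻¹ *
        (g x.2 * (phase (θ x.1) x.2 * phase (θ x.1) u)) := by
    rw [phaseSum, ← ((Equiv.refl ι).prodCongr (Equiv.addRight u)).tsum_eq]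
    simp [phase_add]
  have h1 := summable_phaseSum (θ := θ) hb' hg fun _ => le_rfl
  have h2 : Summable fun x : ι × (Fin n → ℤ) => b x.1 * (1 - phase (θ x.1) u)⁻¹ *
        (g x.2 * (phase (θ x.1) x.2 * phase (θ x.1) u)) := by
    refine .of_norm_bounded h1.norm fun x => ?_
    simp only [norm_mul, norm_phase, mul_one, le_refl]
  have h3 : phaseSum (fun i => b i * (1 - phase (θ i) u)⁻¹) θ (fun k => g k - g (k - u)) =
      phaseSum (fun i => b i * (1 - phase (θ i) u)⁻¹) θ g -
      phaseSum (fun i => b i * (1 - phase (θ i) u)⁻¹) θ (fun k => g (k - u)) := by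
    have := phaseSum_add (θ := θ) hb' hg (h := fun k => (-1) * g (k - u)) (by simpa using hg')
    rw [phaseSum_const_mul] at this
    simpa [sub_eq_add_neg] using this
  rw [h3, e, phaseSum, phaseSum, ← Summable.tsum_sub h1 h2]
  refine tsum_congr fun x => ?_
  have hne : 1 - phase (θ x.1) u ≠ 0 := sub_ne_zero.mpr (hθ x.1).symm
  field_simp

end phaseSum

/-! ### Expansion of a shifted term -/

lemma ofReal_sq_cpow {a : ℝ} (ha : 0 < a) (w : ℂ) :
    ((a ^ 2 : ℝ) : ℂ) ^ w = (a : ℂ) ^ (2 * w) := by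
  have h : (a : ℂ) ≠ 0 := by exact_mod_cast ha.ne'
  rw [pow_two, Complex.ofReal_mul, Complex.mul_cpow_ofReal_nonneg ha.le ha.le,
    ← Complex.cpow_add _ _ h, two_mul]

/-- The function `|u|² - 2 k · u` of `k`, which is `|k - u|² - |k|²`. -/
def shiftPoly {n : ℕ} (u k : Fin n → ℤ) : ℝ :=
  ∑ i, (u i : ℝ) ^ 2 - 2 * ∑ i, (k i : ℝ) * u i

lemma isPolyFun_shiftPoly {n : ℕ} (u : Fin n → ℤ) :
    IsPolyFun 1 fun k : Fin n → ℤ => (shiftPoly u k : ℂ) := by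
  have h := (IsPolyFun.const' (n := n) (D := 1) (∑ i, (u i : ℂ) ^ 2)).add
    (IsPolyFun.sum Finset.univ fun i _ => (IsPolyFun.coord (n := n) i).const_mul (-2 * (u i : ℂ)))
  convert h using 2 with k
  simp only [shiftPoly]
  push_cast
  rw [sub_eq_add_neg, Finset.mul_sum, ← Finset.sum_neg_distrib]
  congr 1
  exact Finset.sum_congr rfl fun i _ => by ring

lemma eucl_sub_sq {n : ℕ} (k u : Fin n → ℤ) :
    eucl (k - u) ^ 2 = eucl k ^ 2 + shiftPoly u k := by
  rw [sub_eq_add_neg, eucl_add_sq, shiftPoly]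
  simp
  ring

lemma abs_shiftPoly_le {n : ℕ} (u k : Fin n → ℤ) :
    |shiftPoly u k| ≤ 3 * jap u ^ 2 * jap k := by
  have h1 := abs_dot_le k u
  have hu := one_le_jap u
  have hk := one_le_jap k
  have h2 : eucl k * eucl u ≤ jap k * jap u :=
    mul_le_mul (eucl_le_jap k) (eucl_le_jap u) (eucl_nonneg u) (jap_pos k).le
  have h3 : eucl u ^ 2 ≤ jap u ^ 2 := pow_le_pow_left₀ (eucl_nonneg u) (eucl_le_jap u) 2
  have h4 := eucl_sq u
  rw [abs_le] at h1
  have h5 : jap k * jap u ≤ jap k * jap u ^ 2 := by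
    refine mul_le_mul_of_nonneg_left ?_ (jap_pos k).le
    nlinarith
  have h6 : jap u ^ 2 ≤ jap k * jap u ^ 2 := le_mul_of_one_le_left (sq_nonneg _) hk
  rw [shiftPoly, ← h4, abs_le]
  constructor <;> nlinarith [sq_nonneg (eucl u)]

/-- The remainder of the expansion of `φ(k - u) |k - u| ^ (-z)` in powers of
`(|u|² - 2 k · u) / |k|²`. -/
def shiftRem {n : ℕ} (φ : (Fin n → ℤ) → ℂ) (u : Fin n → ℤ) (R : ℕ) (z : ℂ) (k : Fin n → ℤ) : ℂ :=
  homTerm φ z (k - u) - ∑ a ∈ Finset.range R, Ring.choose (-z / 2) a *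
    homTerm (fun k => φ (k - u) * (shiftPoly u k : ℂ) ^ a) (z + 2 * a) k

lemma differentiable_shiftRem {n : ℕ} (φ : (Fin n → ℤ) → ℂ) (u : Fin n → ℤ) (R : ℕ)
    (k : Fin n → ℤ) : Differentiable ℂ fun z => shiftRem φ u R z k := by
  refine (differentiable_homTerm φ _).sub ?_
  refine Differentiable.fun_sum fun a _ => ?_
  refine ((differentiable_choose a).comp (g := fun w : ℂ => Ring.choose w a) ?_).mul ?_
  · fun_prop
  · exact (differentiable_homTerm (fun k => φ (k - u) * (shiftPoly u k : ℂ) ^ a) k).comp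
      (differentiable_id.add_const (2 * (a : ℂ)))

lemma shiftRem_eq {n : ℕ} (φ : (Fin n → ℤ) → ℂ) (u : Fin n → ℤ) (R : ℕ) (z : ℂ)
    {k : Fin n → ℤ} (hk : k ≠ 0) (hku : k - u ≠ 0) :
    shiftRem φ u R z k = φ (k - u) * (eucl k : ℂ) ^ (-z) *
      (((1 + shiftPoly u k / eucl k ^ 2 : ℝ) : ℂ) ^ (-z / 2) -
        ∑ a ∈ Finset.range R, Ring.choose (-z / 2) a *
          ((shiftPoly u k / eucl k ^ 2 : ℝ) : ℂ) ^ a) := by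
  have hk0 := eucl_pos hk
  have hk0' : (eucl k : ℂ) ≠ 0 := by exact_mod_cast hk0.ne'
  have h1 : (eucl (k - u) : ℂ) ^ (-z) =
      (eucl k : ℂ) ^ (-z) * ((1 + shiftPoly u k / eucl k ^ 2 : ℝ) : ℂ) ^ (-z / 2) := by
    have e1 : eucl (k - u) ^ 2 = eucl k ^ 2 * (1 + shiftPoly u k / eucl k ^ 2) := by
      rw [eucl_sub_sq]
      field_simp
    have e2 : 0 ≤ 1 + shiftPoly u k / eucl k ^ 2 := by
      have := sq_nonneg (eucl (k - u))
      rw [e1] at this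
      exact nonneg_of_mul_nonneg_right this (by positivity)
    have e3 : -z = 2 * (-z / 2) := by ring
    conv_lhs => rw [e3, ← ofReal_sq_cpow (eucl_pos hku), e1, Complex.ofReal_mul,
      Complex.mul_cpow_ofReal_nonneg (sq_nonneg _) e2, ofReal_sq_cpow hk0, ← e3]
  rw [shiftRem, homTerm_of_ne _ _ hku, h1, mul_sub, Finset.mul_sum, mul_assoc]
  congr 1
  refine Finset.sum_congr rfl fun a _ => ?_
  rw [homTerm_of_ne _ _ hk, neg_add, Complex.cpow_add _ _ hk0', Complex.cpow_neg _ (2 * (a : ℂ))]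
  have : (eucl k : ℂ) ^ (2 * (a : ℂ)) = ((eucl k : ℂ) ^ 2) ^ a := by
    rw [← pow_mul, ← Complex.cpow_natCast]
    push_cast
    rfl
  rw [this]
  push_cast
  rw [div_pow]
  ring

/-- The remainder has order lower by `R`, uniformly for bounded `z` and large `k`. -/
lemma exists_shiftRem_bound {n D : ℕ} {φ : (Fin n → ℤ) → ℂ} (h : IsPolyFun D φ)
    (u : Fin n → ℤ) (R : ℕ) (σ B : ℝ) :
    ∃ C : ℝ, ∀ z : ℂ, σ ≤ z.re → ‖z‖ ≤ B → ∀ k, 6 * jap u ^ 2 < jap k →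
      ‖shiftRem φ u R z k‖ ≤ C * jap k ^ (-(σ - D + R)) := by
  obtain ⟨C₁, hC₁, h₁⟩ := (h.shift u).exists_bound
  obtain ⟨C₂, hC₂, h₂⟩ := exists_binomial_remainder R B
  refine ⟨C₁ * C₂ * (3 * jap u ^ 2) ^ R, fun z hz hzB k hk => ?_⟩
  have hu := one_le_jap u
  have hk1 : 1 < jap k := by nlinarith
  have hk0 : k ≠ 0 := by
    rintro rfl
    simp [jap] at hk1
  have hj : jap k = eucl k := jap_eq hk0
  have hjp := jap_pos k
  have ht : |shiftPoly u k / eucl k ^ 2| ≤ 3 * jap u ^ 2 * (jap k)⁻¹ := by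
    rw [abs_div, ← hj, abs_of_pos (by positivity : 0 < jap k ^ 2), div_le_iff₀ (by positivity)]
    refine (abs_shiftPoly_le u k).trans (le_of_eq ?_)
    field_simp
  have ht2 : |shiftPoly u k / eucl k ^ 2| ≤ 1 / 2 := by
    refine ht.trans ?_
    rw [← div_eq_mul_inv, div_le_iff₀ hjp]
    linarith
  have hku : k - u ≠ 0 := by
    intro h0
    have := eucl_sub_sq k u
    rw [h0, eucl_zero] at this
    rw [abs_le] at ht2
    have h3 : shiftPoly u k / eucl k ^ 2 = -1 := by
      rw [div_eq_iff (by rw [← hj]; positivity)]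
      linarith
    linarith [ht2.1]
  rw [shiftRem_eq φ u R z hk0 hku, norm_mul, norm_mul,
    Complex.norm_cpow_eq_rpow_re_of_pos (eucl_pos hk0), ← hj, Complex.neg_re]
  have hb := h₂ (-z / 2) (by
    rw [norm_div, norm_neg]
    have := norm_nonneg z
    norm_num
    linarith) _ ht2
  rw [hj] at ht ⊢
  rw [hj] at hjp
  calc _ ≤ (C₁ * eucl k ^ D) * eucl k ^ (-σ) * (C₂ * (3 * jap u ^ 2 * (eucl k)⁻¹) ^ R) := by
        have h1 := h₁ k
        rw [hj] at h1
        have := eucl_nonneg k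
        refine mul_le_mul (mul_le_mul h1 ?_ (by positivity) (by positivity)) (hb.trans ?_)
          (norm_nonneg _) (by positivity)
        · exact Real.rpow_le_rpow_of_exponent_le (by linarith) (by linarith)
        · gcongr
    _ = _ := by
        rw [mul_pow, inv_pow, neg_add, neg_sub, sub_eq_add_neg, Real.rpow_add (by linarith),
          Real.rpow_add (by linarith), Real.rpow_neg (by linarith) (R : ℝ), Real.rpow_natCast,
          Real.rpow_natCast]
        ring

lemma finite_jap_le {n : ℕ} (K : ℝ) : {k : Fin n → ℤ | jap k ≤ K}.Finite := by
  refine (Set.Finite.pi' fun _ : Fin n => Set.finite_Icc (-⌊K⌋) ⌊K⌋).subset fun k hk i => ?_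
  have h := ((abs_coord_le_eucl k i).trans (eucl_le_jap k)).trans hk
  rw [← Int.cast_abs, ← Int.le_floor, abs_le] at h
  exact h

/-- A bound for large `k` of a family of continuous functions on a bounded set can be extended to
all `k`. -/
lemma exists_summable_bound {n : ℕ} {U : Set ℂ} {B : ℝ} (hU : ∀ z ∈ U, ‖z‖ ≤ B)
    {g : ℂ → (Fin n → ℤ) → ℂ} (hc : ∀ k, Continuous fun z => g z k) {r : (Fin n → ℤ) → ℝ}
    (hr : Summable r) {K : ℝ} (h : ∀ k, K < jap k → ∀ z ∈ U, ‖g z k‖ ≤ r k) :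
    ∃ r' : (Fin n → ℤ) → ℝ, Summable r' ∧ ∀ k, ∀ z ∈ U, ‖g z k‖ ≤ |r' k| := by
  classical
  have hM : ∀ k, ∃ M : ℝ, ∀ z ∈ U, ‖g z k‖ ≤ M := fun k => by
    obtain ⟨M, hM⟩ := (isCompact_closedBall (0 : ℂ) B).exists_bound_of_continuousOn
      (hc k).continuousOn
    exact ⟨M, fun z hz => hM z (by simpa using hU z hz)⟩
  choose M hM using hM
  refine ⟨fun k => if jap k ≤ K then M k else r k, ?_, fun k z hz => ?_⟩
  · refine (hr.congr_cofinite ?_)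
    filter_upwards [(finite_jap_le (n := n) K).compl_mem_cofinite] with k hk
    exact (if_neg hk).symm
  · refine le_trans ?_ (le_abs_self _)
    beta_reduce
    split_ifs with hk
    · exact hM k z hz
    · exact h k (not_le.mp hk) z hz

/-! ### Continuation of nonresonant sums -/

lemma summable_norm_homTerm {n D : ℕ} {φ : (Fin n → ℤ) → ℂ} (h : IsPolyFun D φ) {z : ℂ}
    (hz : (n : ℝ) + D < z.re) : Summable fun k => ‖homTerm φ z k‖ := by
  obtain ⟨C, hC, hb⟩ := h.exists_homTerm_bound
  exact .of_nonneg_of_le (fun _ => norm_nonneg _) (hb z.re z le_rfl)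
    ((summable_jap_rpow (by linarith)).mul_left C)

lemma isOpen_re_gt (σ : ℝ) : IsOpen {z : ℂ | σ < z.re} := isOpen_lt continuous_const
  Complex.continuous_re

lemma differentiableOn_phaseSum_homTerm {n D : ℕ} {φ : (Fin n → ℤ) → ℂ} (h : IsPolyFun D φ)
    {ι : Type*} {b : ι → ℂ} {θ : ι → Fin n → ℝ} (hb : Summable fun i => ‖b i‖) :
    DifferentiableOn ℂ (fun z => phaseSum b θ (homTerm φ z)) {z | (n : ℝ) + D < z.re} := by
  intro z hz
  obtain ⟨σ, hσ₁, hσ₂⟩ := exists_between (show (n : ℝ) + D < z.re from hz)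
  obtain ⟨C, hC, hbd⟩ := h.exists_homTerm_bound
  refine ((differentiableOn_phaseSum hb (isOpen_re_gt σ) (differentiable_homTerm φ)
    ((summable_jap_rpow (n := n) (r := σ - D) (by linarith)).mul_left C) ?_).differentiableAt
    ((isOpen_re_gt σ).mem_nhds hσ₂)).differentiableWithinAt
  intro k w hw
  exact (hbd σ w (le_of_lt hw) k).trans (le_abs_self _)

lemma differentiableOn_phaseSum_shiftRem {n D : ℕ} {φ : (Fin n → ℤ) → ℂ} (h : IsPolyFun D φ)
    (u : Fin n → ℤ) (R : ℕ) {ι : Type*} {b : ι → ℂ} {θ : ι → Fin n → ℝ}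
    (hb : Summable fun i => ‖b i‖) :
    DifferentiableOn ℂ (fun z => phaseSum b θ (shiftRem φ u R z))
      {z | (n : ℝ) + D - R < z.re} := by
  intro z hz
  obtain ⟨σ, hσ₁, hσ₂⟩ := exists_between (show (n : ℝ) + D - R < z.re from hz)
  obtain ⟨C, hbd⟩ := exists_shiftRem_bound h u R σ (‖z‖ + 1)
  set U : Set ℂ := {w | σ < w.re} ∩ Metric.ball 0 (‖z‖ + 1)
  have hU : IsOpen U := (isOpen_re_gt σ).inter Metric.isOpen_ball
  have hUB : ∀ w ∈ U, ‖w‖ ≤ ‖z‖ + 1 := fun w hw => by simpa using (Metric.mem_ball.mp hw.2).le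
  obtain ⟨r, hr, hr'⟩ := exists_summable_bound hUB
    (fun k => (differentiable_shiftRem φ u R k).continuous)
    ((summable_jap_rpow (n := n) (r := σ - D + R) (by linarith)).mul_left C)
    (fun k hk w hw => hbd w (le_of_lt hw.1) (hUB w hw) k hk)
  exact ((differentiableOn_phaseSum hb hU (differentiable_shiftRem φ u R) hr
    hr').differentiableAt (hU.mem_nhds ⟨hσ₂, by simp⟩)).differentiableWithinAt

/-- Nonresonant sums continue holomorphically to every half-plane. Each summation by parts
replaces the summand by a difference, whose expansion consists of terms of lower order, at the
expense of a factor `(1 - phase (θ i) u)⁻¹`, which the weights `b i` absorb. -/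
theorem exists_continuation_nonresonant {n : ℕ} {ι : Type*} (u : Fin n → ℤ)
    (θ : ι → Fin n → ℝ) (hθ : ∀ i, phase (θ i) u ≠ 1) (M : ℕ) :
    ∀ (D : ℕ) (φ : (Fin n → ℤ) → ℂ), IsPolyFun D φ → ∀ b : ι → ℂ,
      (∀ N : ℕ, Summable fun i => ‖b i‖ * ‖1 - phase (θ i) u‖⁻¹ ^ N) →
      ∃ G : ℂ → ℂ, DifferentiableOn ℂ G {z | (n : ℝ) + D - M < z.re} ∧
        ∀ z : ℂ, (n : ℝ) + D < z.re → phaseSum b θ (homTerm φ z) = G z := by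
  induction M with
  | zero =>
    intro D φ hφ b hb
    refine ⟨_, ?_, fun _ _ => rfl⟩
    simpa using differentiableOn_phaseSum_homTerm hφ (by simpa using hb 0)
  | succ M ih =>
    intro D φ hφ b hb
    set b' : ι → ℂ := fun i => b i * (1 - phase (θ i) u)⁻¹ with hb'def
    have hb' : ∀ N : ℕ, Summable fun i => ‖b' i‖ * ‖1 - phase (θ i) u‖⁻¹ ^ N := fun N => by
      refine (hb (N + 1)).congr fun i => ?_
      rw [hb'def, norm_mul, norm_inv, pow_succ]
      ring
    have hb'0 : Summable fun i => ‖b' i‖ := by simpa using hb' 0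
    have hφa : ∀ a : ℕ, IsPolyFun (D + a) fun k => φ (k - u) * (shiftPoly u k : ℂ) ^ a :=
      fun a => by simpa using (hφ.shift u).mul ((isPolyFun_shiftPoly u).pow a)
    have hΔ := hφ.shift_sub u
    -- The terms of the expansion, of orders lower by `1`, `2`, ….
    have h0 : ∃ G : ℂ → ℂ, DifferentiableOn ℂ G {z | (n : ℝ) + D - (M + 1 : ℕ) < z.re} ∧
        ∀ z : ℂ, (n : ℝ) + D < z.re →
          phaseSum b' θ (homTerm (fun k => φ (k - u) - φ k) z) = G z := by
      rcases Nat.eq_zero_or_pos D with hD | hD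
      · refine ⟨fun _ => 0, differentiableOn_const _, fun z _ => ?_⟩
        have : homTerm (fun k => φ (k - u) - φ k) z = fun _ => 0 := by
          ext k
          simp [homTerm, hΔ.2 hD]
        simp [this, phaseSum]
      · obtain ⟨G, hG, hG'⟩ := ih _ _ hΔ.1 b' hb'
        have hcast : ((D - 1 : ℕ) : ℝ) = D - 1 := by
          rw [Nat.cast_sub hD, Nat.cast_one]
        refine ⟨G, hG.mono fun z hz => ?_, fun z hz => hG' z ?_⟩
        · simp only [Set.mem_ofPred_eq, Nat.cast_add, Nat.cast_one, hcast] at hz ⊢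
          linarith
        · rw [hcast]
          linarith
    have hj : ∀ j : ℕ, ∃ G : ℂ → ℂ,
        DifferentiableOn ℂ G {z | (n : ℝ) + D - (M + 1 : ℕ) < z.re} ∧
        ∀ z : ℂ, (n : ℝ) + D < z.re →
          phaseSum b' θ (homTerm (fun k => φ (k - u) * (shiftPoly u k : ℂ) ^ (j + 1))
            (z + 2 * (j + 1 : ℕ))) = G z := by
      intro j
      obtain ⟨G, hG, hG'⟩ := ih _ _ (hφa (j + 1)) b' hb'
      have hj0 : (0 : ℝ) ≤ j := Nat.cast_nonneg j
      have hre : ∀ z : ℂ, (z + 2 * ((j + 1 : ℕ) : ℂ)).re = z.re + 2 * (j + 1) := fun z => by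
        simp
      refine ⟨fun z => G (z + 2 * (j + 1 : ℕ)), ?_, fun z hz => hG' _ ?_⟩
      · refine hG.comp (by fun_prop) fun z hz => ?_
        simp only [Set.mem_ofPred_eq, hre] at hz ⊢
        push_cast at hz ⊢
        linarith
      · rw [hre]
        push_cast
        linarith
    obtain ⟨G₀, hG₀, hG₀'⟩ := h0
    choose Gj hGj hGj' using hj
    refine ⟨fun z => -(G₀ z + ∑ j ∈ Finset.range M, Ring.choose (-z / 2) (j + 1) * Gj j z +
      phaseSum b' θ (shiftRem φ u (M + 1) z)), ?_, fun z hz => ?_⟩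
    · refine ((hG₀.add (DifferentiableOn.fun_sum fun j _ => ?_)).add
        (differentiableOn_phaseSum_shiftRem hφ u (M + 1) hb'0)).neg
      refine DifferentiableOn.mul ?_ (hGj j)
      refine ((differentiable_choose (j + 1)).comp
        (g := fun w : ℂ => Ring.choose w (j + 1)) ?_).differentiableOn
      fun_prop
    · have hs := summable_norm_homTerm hφ hz
      have hs' : Summable fun k => ‖homTerm φ z (k - u)‖ :=
        ((Equiv.subRight u).summable_iff (f := fun k => ‖homTerm φ z k‖)).mpr hs
      have hsa : ∀ a : ℕ, Summable fun k =>
          ‖homTerm (fun k => φ (k - u) * (shiftPoly u k : ℂ) ^ a) (z + 2 * a) k‖ := fun a => by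
        refine summable_norm_homTerm (hφa a) ?_
        have : (0 : ℝ) ≤ a := Nat.cast_nonneg a
        simp
        linarith
      have hs0 : Summable fun k => ‖homTerm (fun k => φ (k - u) - φ k) z k‖ := by
        refine summable_norm_homTerm (D := D) (hΔ.1.mono (Nat.sub_le _ _)) hz
      have hsR : Summable fun k => ‖shiftRem φ u (M + 1) z k‖ := by
        have hS : Summable fun k => ∑ a ∈ Finset.range (M + 1), ‖Ring.choose (-z / 2) a‖ *
            ‖homTerm (fun k => φ (k - u) * (shiftPoly u k : ℂ) ^ a) (z + 2 * a) k‖ :=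
          summable_sum fun a _ => (hsa a).mul_left _
        refine .of_nonneg_of_le (fun _ => norm_nonneg _) (fun k => ?_) (hs'.add hS)
        refine (norm_sub_le _ _).trans (add_le_add le_rfl ((norm_sum_le _ _).trans ?_))
        simp only [norm_mul, le_refl]
      rw [phaseSum_eq_sub_shift u hθ (by simpa using hb 1) hs]
      have key : (fun k => homTerm φ z k - homTerm φ z (k - u)) = fun k =>
          (-1) * ((homTerm (fun k => φ (k - u) - φ k) z k +
            ∑ j ∈ Finset.range M, Ring.choose (-z / 2) (j + 1) *
              homTerm (fun k => φ (k - u) * (shiftPoly u k : ℂ) ^ (j + 1))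
                (z + 2 * (j + 1 : ℕ)) k) + shiftRem φ u (M + 1) z k) := by
        ext k
        rw [shiftRem, Finset.sum_range_succ']
        simp only [homTerm, Ring.choose_zero_right, pow_zero, mul_one, Nat.cast_zero, mul_zero,
          add_zero]
        split_ifs <;> ring
      have hsS : Summable fun k => ‖∑ j ∈ Finset.range M, Ring.choose (-z / 2) (j + 1) *
              homTerm (fun k => φ (k - u) * (shiftPoly u k : ℂ) ^ (j + 1))
                (z + 2 * (j + 1 : ℕ)) k‖ := by
        refine .of_nonneg_of_le (fun _ => norm_nonneg _) (fun k => norm_sum_le _ _)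
          (summable_sum fun a _ => ?_)
        simpa only [norm_mul] using (hsa (a + 1)).mul_left _
      have hs1 : Summable fun k => ‖homTerm (fun k => φ (k - u) - φ k) z k +
            ∑ j ∈ Finset.range M, Ring.choose (-z / 2) (j + 1) *
              homTerm (fun k => φ (k - u) * (shiftPoly u k : ℂ) ^ (j + 1))
                (z + 2 * (j + 1 : ℕ)) k‖ :=
        .of_nonneg_of_le (fun _ => norm_nonneg _) (fun k => norm_add_le _ _) (hs0.add hsS)
      rw [key, phaseSum_const_mul, phaseSum_add hb'0 hs1 hsR, phaseSum_add hb'0 hs0 hsS,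
        phaseSum_sum hb'0 _ fun a _ => by simpa only [norm_mul] using (hsa (a + 1)).mul_left _,
        hG₀' z hz]
      simp only [phaseSum_const_mul, neg_one_mul]
      congr 3
      exact Finset.sum_congr rfl fun j _ => by rw [hGj' j z hz]

/-! ### Gluing continuations to half-planes -/

/-- The identity theorem on a half-plane. -/
lemma eqOn_half_plane {σ τ : ℝ} {f g : ℂ → ℂ} (hf : DifferentiableOn ℂ f {s | σ < s.re})
    (hg : DifferentiableOn ℂ g {s | σ < s.re}) (h : ∀ s : ℂ, τ < s.re → f s = g s) :
    ∀ s : ℂ, σ < s.re → f s = g s := by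
  have hconv : IsPreconnected {s : ℂ | σ < s.re} := (convex_halfSpace_re_gt σ).isPreconnected
  have h0 : (((max σ τ + 1 : ℝ) : ℂ)) ∈ {s : ℂ | σ < s.re} := by
    simpa using (le_max_left σ τ).trans_lt (lt_add_one _)
  have h1 : (((max σ τ + 1 : ℝ) : ℂ)) ∈ {s : ℂ | τ < s.re} := by
    simpa using (le_max_right σ τ).trans_lt (lt_add_one _)
  refine (hf.analyticOnNhd (isOpen_re_gt σ)).eqOn_of_preconnected_of_eventuallyEq
    (hg.analyticOnNhd (isOpen_re_gt σ)) hconv h0 ?_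
  filter_upwards [(isOpen_re_gt τ).mem_nhds h1] with s hs using h s hs

/-- If `f` continues to every half-plane `re s > A - N` with simple poles at `A, A - 1, …`, then
the continuations glue to one function. -/
theorem exists_glued (A : ℝ) (c : ℕ → ℂ) (f : ℂ → ℂ)
    (h : ∀ N : ℕ, ∃ G : ℂ → ℂ, DifferentiableOn ℂ G {s | A - N < s.re} ∧
      ∀ s : ℂ, A < s.re → f s = ∑ m ∈ Finset.range N, c m / (s - (A - m)) + G s) :
    ∃ F : ℂ → ℂ, (∀ s : ℂ, A < s.re → F s = f s) ∧
      ∀ N : ℕ, ∃ G : ℂ → ℂ, DifferentiableOn ℂ G {s | A - N < s.re} ∧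
        ∀ s : ℂ, A - N < s.re → F s = ∑ m ∈ Finset.range N, c m / (s - (A - m)) + G s := by
  choose G hG hG' using h
  set T : ℕ → ℂ → ℂ := fun N s => ∑ m ∈ Finset.range N, c m / (s - (A - m)) + G N s with hT
  have hstep : ∀ (N : ℕ) (s : ℂ), A - N < s.re → T N s = T (N + 1) s := by
    intro N s hs
    have hpole : DifferentiableOn ℂ (fun s : ℂ => c N / (s - (A - N)) + G (N + 1) s)
        {s | A - N < s.re} := by
      refine .add (fun z hz => ?_) ((hG (N + 1)).mono fun z hz => ?_)
      · refine ((differentiableAt_const _).div (by fun_prop) fun h0 => ?_).differentiableWithinAt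
        have := congrArg Complex.re h0
        simp only [Complex.sub_re, Complex.ofReal_re, Complex.natCast_re, Complex.zero_re] at this
        have : A - N < z.re := hz
        linarith
      · have : A - N < z.re := hz
        simp only [Set.mem_ofPred_eq, Nat.cast_add, Nat.cast_one]
        linarith
    have := eqOn_half_plane (τ := A) (hG N) hpole (fun s hs => by
      have h1 := hG' N s hs
      rw [hG' (N + 1) s hs, Finset.sum_range_succ, add_assoc] at h1
      exact (add_left_cancel h1).symm) s hs
    simp only [hT]
    rw [Finset.sum_range_succ, this, add_assoc]
  have hmono : ∀ (N j : ℕ) (s : ℂ), A - N < s.re → T N s = T (N + j) s := by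
    intro N j s hs
    induction j with
    | zero => rfl
    | succ j ih =>
      rw [ih, ← add_assoc]
      refine hstep _ _ (lt_of_le_of_lt ?_ hs)
      push_cast
      linarith [(Nat.cast_nonneg j : (0 : ℝ) ≤ j)]
  set ν : ℂ → ℕ := fun s => ⌊A - s.re⌋₊ + 1
  have hν : ∀ s : ℂ, A - ν s < s.re := fun s => by
    have := Nat.lt_floor_add_one (A - s.re)
    simp only [ν]
    push_cast
    linarith
  have hF : ∀ (N : ℕ) (s : ℂ), A - N < s.re → T (ν s) s = T N s := fun N s hs => by
    rw [hmono _ N s (hν s), hmono _ (ν s) s hs, add_comm]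
  refine ⟨fun s => T (ν s) s, fun s hs => ?_, fun N => ⟨G N, hG N, fun s hs => hF N s hs⟩⟩
  beta_reduce
  rw [hF 0 s (by simpa using hs), hG' 0 s hs]

lemma exists_entire_of_half_planes (A : ℝ) (f : ℂ → ℂ)
    (h : ∀ N : ℕ, ∃ G : ℂ → ℂ, DifferentiableOn ℂ G {s | A - N < s.re} ∧
      ∀ s : ℂ, A < s.re → f s = G s) :
    ∃ F : ℂ → ℂ, Differentiable ℂ F ∧ ∀ s : ℂ, A < s.re → f s = F s := by
  obtain ⟨F, hF, hF'⟩ := exists_glued A 0 f (by simpa using h)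
  refine ⟨F, fun s => ?_, fun s hs => (hF s hs).symm⟩
  obtain ⟨N, hN⟩ := exists_nat_gt (A - s.re)
  obtain ⟨G, hG, hFG⟩ := hF' N
  have hmem : {s : ℂ | A - N < s.re} ∈ 𝓝 s :=
    (isOpen_re_gt _).mem_nhds (by simp only [Set.mem_ofPred_eq]; linarith)
  refine (hG.differentiableAt hmem).congr_of_eventuallyEq ?_
  filter_upwards [hmem] with z hz
  simpa using hFG z hz

theorem exists_entire_nonresonant {n : ℕ} {ι : Type*} (u : Fin n → ℤ)
    (θ : ι → Fin n → ℝ) (hθ : ∀ i, phase (θ i) u ≠ 1) {D : ℕ} {φ : (Fin n → ℤ) → ℂ}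
    (hφ : IsPolyFun D φ) (b : ι → ℂ)
    (hb : ∀ N : ℕ, Summable fun i => ‖b i‖ * ‖1 - phase (θ i) u‖⁻¹ ^ N) :
    ∃ G : ℂ → ℂ, Differentiable ℂ G ∧
      ∀ z : ℂ, (n : ℝ) + D < z.re → phaseSum b θ (homTerm φ z) = G z :=
  exists_entire_of_half_planes _ _ fun N => exists_continuation_nonresonant u θ hθ N D φ hφ b hb

/-! ### The resonant sums -/

lemma phaseSum_unit {n : ℕ} (θ : Fin n → ℝ) (g : (Fin n → ℤ) → ℂ) :
    phaseSum (fun _ : Unit => 1) (fun _ => θ) g = ∑' k, g k * phase θ k := by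
  rw [phaseSum, ← (Equiv.punitProd (Fin n → ℤ)).symm.tsum_eq]
  simp

lemma phase_eq_prod {n : ℕ} (θ : Fin n → ℝ) (k : Fin n → ℤ) :
    phase θ k = ∏ i, Complex.exp (Complex.I * ((k i : ℝ) * θ i : ℝ)) := by
  rw [phase, ← Complex.exp_sum, ← Finset.mul_sum, Complex.ofReal_sum]

lemma sum_exp_eq_ite (q : ℕ) (hq : q ≠ 0) (k : ℤ) :
    ∑ c : Fin q, Complex.exp (Complex.I * ((k : ℝ) * (2 * Real.pi * c / q) : ℝ)) =
      if (q : ℤ) ∣ k then (q : ℂ) else 0 := by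
  have hprim := Complex.isPrimitiveRoot_exp q hq
  set ζ := Complex.exp (2 * Real.pi * Complex.I / q)
  have hζ : ∀ c : ℕ, Complex.exp (Complex.I * ((k : ℝ) * (2 * Real.pi * c / q) : ℝ)) =
      (ζ ^ k) ^ c := fun c => by
    rw [← Complex.exp_int_mul, ← Complex.exp_nat_mul]
    congr 1
    push_cast
    ring
  simp only [hζ]
  rw [Fin.sum_univ_eq_sum_range (fun c => (ζ ^ k) ^ c)]
  split_ifs with h
  · rw [(hprim.zpow_eq_one_iff_dvd k).mpr h]
    simp
  · have h1 : ζ ^ k ≠ 1 := fun h1 => h ((hprim.zpow_eq_one_iff_dvd k).mp h1)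
    have h2 : (ζ ^ k) ^ q = 1 := by
      rw [← zpow_natCast, ← zpow_mul, mul_comm, zpow_mul, zpow_natCast, hprim.pow_eq_one,
        one_zpow]
    rw [geom_sum_eq h1, h2, sub_self, zero_div]

lemma sum_phase_eq_ite {n : ℕ} (q : ℕ) (hq : q ≠ 0) (k : Fin n → ℤ) :
    ∑ c : Fin n → Fin q, phase (fun i => 2 * Real.pi * c i / q) k =
      if ∀ i, (q : ℤ) ∣ k i then (q : ℂ) ^ n else 0 := by
  simp only [phase_eq_prod]
  have h := Finset.prod_univ_sum (fun _ : Fin n => (Finset.univ : Finset (Fin q)))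
    (fun i c => Complex.exp (Complex.I * ((k i : ℝ) * (2 * Real.pi * c / q) : ℝ)))
  rw [Fintype.piFinset_univ] at h
  rw [← h]
  simp only [sum_exp_eq_ite q hq]
  split_ifs with h0
  · simp [h0]
  · push Not at h0
    obtain ⟨i, hi⟩ := h0
    exact Finset.prod_eq_zero (Finset.mem_univ i) (if_neg hi)

/-- For `φ` homogeneous of degree `D`, the sum over the multiples of `q` is a multiple of the full
sum. Detecting these multiples by the characters of `(ℤ / q)ⁿ`, the factor `1 - q ^ (n + D - z)`
turns the resonant sum into a combination of nonresonant ones. -/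
lemma exists_entire_mul_resonant {n D : ℕ} {φ : (Fin n → ℤ) → ℂ} (hφ : IsPolyFun D φ)
    (hhom : ∀ (q : ℕ) (k : Fin n → ℤ), φ (fun i => (q : ℤ) * k i) = (q : ℂ) ^ D * φ k)
    (q : ℕ) (hq : q ≠ 0) :
    ∃ E : ℂ → ℂ, Differentiable ℂ E ∧ ∀ z : ℂ, (n : ℝ) + D < z.re →
      (1 - (q : ℂ) ^ ((n : ℂ) + D - z)) * ∑' k, homTerm φ z k = E z := by
  classical
  have : NeZero q := ⟨hq⟩
  have hq' : (q : ℂ) ≠ 0 := by exact_mod_cast hq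
  have hqr : (q : ℝ) ≠ 0 := by exact_mod_cast hq
  set θ : (Fin n → Fin q) → Fin n → ℝ := fun c i => 2 * Real.pi * c i / q with hθ
  have hE : ∀ c : Fin n → Fin q, ∃ E : ℂ → ℂ, Differentiable ℂ E ∧ (c ≠ 0 →
      ∀ z : ℂ, (n : ℝ) + D < z.re → ∑' k, homTerm φ z k * phase (θ c) k = E z) := by
    intro c
    by_cases hc : c = 0
    · exact ⟨fun _ => 0, differentiable_const _, fun h => absurd hc h⟩
    obtain ⟨i, hi⟩ := Function.ne_iff.mp hc
    have hph : phase (θ c) (Pi.single i 1) ≠ 1 := by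
      intro h
      have hsum : ∑ j, ((Pi.single i 1 : Fin n → ℤ) j : ℝ) * θ c j = θ c i := by
        rw [Finset.sum_eq_single i]
        · simp
        · intro j _ hj
          simp [hj]
        · simp
      rw [phase, hsum, Complex.exp_eq_one_iff] at h
      obtain ⟨m, hm⟩ := h
      have hm' : (2 * Real.pi * (c i : ℕ) / q : ℝ) = m * (2 * Real.pi) := by
        have := congrArg Complex.im hm
        simpa [hθ] using this
      have h3 : ((c i : ℕ) : ℝ) = m * q := by
        have hpi := Real.pi_ne_zero
        field_simp at hm'
        linarith
      have h4 : ((c i : ℕ) : ℤ) = m * q := by exact_mod_cast h3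
      have h5 : (q : ℕ) ∣ (c i : ℕ) := by
        rw [← Int.natCast_dvd_natCast]
        exact ⟨m, by rw [h4, mul_comm]⟩
      have h6 := Nat.eq_zero_of_dvd_of_lt h5 (c i).2
      exact hi (Fin.ext (by simpa using h6))
    obtain ⟨E, hE, hE'⟩ := exists_entire_nonresonant (Pi.single i 1) (fun _ : Unit => θ c)
      (fun _ => hph) hφ (fun _ => 1) (fun N => Summable.of_finite)
    exact ⟨E, hE, fun _ z hz => by rw [← phaseSum_unit, hE' z hz]⟩
  choose E hEd hE' using hE
  refine ⟨fun z => -∑ c ∈ Finset.univ.erase (0 : Fin n → Fin q), E c z,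
    (Differentiable.fun_sum fun c _ => hEd c).neg, fun z hz => ?_⟩
  have hs := (summable_norm_homTerm hφ hz)
  have hsp : ∀ c, Summable fun k => homTerm φ z k * phase (θ c) k := fun c =>
    .of_norm (by simpa only [norm_mul, norm_phase, mul_one] using hs)
  have h1 : ∑ c, ∑' k, homTerm φ z k * phase (θ c) k =
      (q : ℂ) ^ ((n : ℂ) + D - z) * ∑' k, homTerm φ z k := by
    rw [← Summable.tsum_finsetSum fun c _ => hsp c]
    simp only [← Finset.mul_sum, hθ, sum_phase_eq_ite q hq, mul_ite, mul_zero]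
    rw [← tsum_mul_left]
    have hinj : Function.Injective fun k : Fin n → ℤ => fun i => (q : ℤ) * k i := by
      intro k l h
      ext i
      exact mul_left_cancel₀ (by exact_mod_cast hq) (congrFun h i)
    rw [← hinj.tsum_eq]
    · refine tsum_congr fun k => ?_
      simp only [dvd_mul_right, implies_true, if_true]
      by_cases hk : k = 0
      · subst hk
        have : (fun i : Fin n => (q : ℤ) * (0 : Fin n → ℤ) i) = 0 := by ext; simp
        rw [this, homTerm_zero]
        simp
      · have hk' : (fun i : Fin n => (q : ℤ) * k i) ≠ 0 := fun h =>
          hk (hinj (h.trans (by ext; simp)))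
        rw [homTerm_of_ne _ _ hk, homTerm_of_ne _ _ hk', hhom, eucl_smul, Complex.ofReal_mul,
          Complex.mul_cpow_ofReal_nonneg (Nat.cast_nonneg q) (eucl_nonneg k), sub_eq_add_neg,
          Complex.cpow_add _ _ hq', Complex.cpow_add _ _ hq', Complex.cpow_natCast,
          Complex.cpow_natCast, Complex.ofReal_natCast]
        ring
    · intro k hk
      rw [Function.mem_support] at hk
      by_cases hd : ∀ i, (q : ℤ) ∣ k i
      · choose l hl using hd
        exact ⟨l, by ext i; exact (hl i).symm⟩
      · simp [hd] at hk
  rw [← Finset.add_sum_erase _ _ (Finset.mem_univ (0 : Fin n → Fin q))] at h1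
  have h2 : ∑' k, homTerm φ z k * phase (θ 0) k = ∑' k, homTerm φ z k := by
    refine tsum_congr fun k => ?_
    simp [phase, hθ]
  have h3 : ∑ c ∈ Finset.univ.erase (0 : Fin n → Fin q), ∑' k, homTerm φ z k * phase (θ c) k =
      ∑ c ∈ Finset.univ.erase (0 : Fin n → Fin q), E c z :=
    Finset.sum_congr rfl fun c hc => hE' c (Finset.ne_of_mem_erase hc) z hz
  rw [h2, h3] at h1
  rw [sub_mul, one_mul, ← h1]
  ring

/-- Division by an entire function with simple zeros. -/
lemma exists_entire_quotient {N L : ℂ → ℂ} (hN : Differentiable ℂ N) (hL : Differentiable ℂ L)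
    (h : ∀ z, L z = 0 → N z = 0 ∧ deriv L z ≠ 0) :
    ∃ G : ℂ → ℂ, Differentiable ℂ G ∧ ∀ z, N z = L z * G z := by
  classical
  refine ⟨fun z => if L z = 0 then deriv N z / deriv L z else N z / L z, fun z₀ => ?_,
    fun z => ?_⟩
  · by_cases h0 : L z₀ = 0
    · obtain ⟨hN0, hL0⟩ := h z₀ h0
      have hdN : DifferentiableAt ℂ (dslope N z₀) z₀ :=
        ((Complex.differentiableOn_dslope Filter.univ_mem).mpr hN.differentiableOn).differentiableAt
          Filter.univ_mem
      have hdL : DifferentiableAt ℂ (dslope L z₀) z₀ :=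
        ((Complex.differentiableOn_dslope Filter.univ_mem).mpr hL.differentiableOn).differentiableAt
          Filter.univ_mem
      have hne : dslope L z₀ z₀ ≠ 0 := by rwa [dslope_same]
      refine (hdN.div hdL hne).congr_of_eventuallyEq ?_
      filter_upwards [hdL.continuousAt.eventually_ne hne] with z hz
      by_cases hzz : z = z₀
      · subst hzz
        simp [h0]
      · have hz0 : z - z₀ ≠ 0 := sub_ne_zero.mpr hzz
        have hLz : L z = (z - z₀) * dslope L z₀ z := by
          rw [← smul_eq_mul, sub_smul_dslope, h0, sub_zero]
        have hNz : N z = (z - z₀) * dslope N z₀ z := by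
          rw [← smul_eq_mul, sub_smul_dslope, hN0, sub_zero]
        have : L z ≠ 0 := by
          rw [hLz]
          exact mul_ne_zero hz0 hz
        simp only [this, if_false, Pi.div_apply]
        rw [hLz, hNz, mul_div_mul_left _ _ hz0]
    · refine ((hN z₀).div (hL z₀) h0).congr_of_eventuallyEq ?_
      filter_upwards [(hL z₀).continuousAt.eventually_ne h0] with z hz
      simp [hz]
  · beta_reduce
    split_ifs with h0
    · rw [h0, zero_mul, (h z h0).1]
    · field_simp

/-- The numbers `w` with `2 ^ w = 1` and `3 ^ w = 1`: only `w = 0`, as `log 2 / log 3` is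
irrational. -/
lemma eq_zero_of_two_three_cpow {w : ℂ} (h2 : (2 : ℂ) ^ w = 1) (h3 : (3 : ℂ) ^ w = 1) :
    w = 0 := by
  rw [Complex.cpow_def_of_ne_zero (by norm_num), Complex.exp_eq_one_iff] at h2 h3
  obtain ⟨a, ha⟩ := h2
  obtain ⟨b, hb⟩ := h3
  have e2 : Complex.log 2 = (Real.log 2 : ℝ) := by
    rw [Complex.ofReal_log (by norm_num)]
    norm_num
  have e3 : Complex.log 3 = (Real.log 3 : ℝ) := by
    rw [Complex.ofReal_log (by norm_num)]
    norm_num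
  have hl2 : 0 < Real.log 2 := Real.log_pos (by norm_num)
  have hl3 : 0 < Real.log 3 := Real.log_pos (by norm_num)
  rw [e2] at ha
  rw [e3] at hb
  have hpi : (2 * Real.pi * Complex.I : ℂ) ≠ 0 := Complex.two_pi_I_ne_zero
  have hab : (a : ℝ) * Real.log 3 = b * Real.log 2 := by
    have h : ((a : ℂ) * (Real.log 3 : ℝ)) * (2 * Real.pi * Complex.I) =
        (b * (Real.log 2 : ℝ)) * (2 * Real.pi * Complex.I) := by
      linear_combination (-(Real.log 3 : ℝ) : ℂ) * ha + (Real.log 2 : ℝ) * hb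
    have := mul_right_cancel₀ hpi h
    exact_mod_cast this
  have hnat : (a.natAbs : ℝ) * Real.log 3 = b.natAbs * Real.log 2 := by
    have := congrArg abs hab
    rw [abs_mul, abs_mul, abs_of_pos hl2, abs_of_pos hl3] at this
    simpa [Nat.cast_natAbs] using this
  rw [← Real.log_pow, ← Real.log_pow] at hnat
  have hpow := Real.log_injOn_pos (Set.mem_Ioi.mpr (by positivity))
    (Set.mem_Ioi.mpr (by positivity)) hnat
  have hpow' : 3 ^ a.natAbs = 2 ^ b.natAbs := by exact_mod_cast hpow
  have ha0 : a.natAbs = 0 := by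
    by_contra h0
    have h1 : 3 ∣ 2 ^ b.natAbs := hpow' ▸ dvd_pow_self 3 h0
    have := Nat.prime_three.dvd_of_dvd_pow h1
    omega
  rw [Int.natAbs_eq_zero] at ha0
  rw [ha0, Int.cast_zero, zero_mul] at ha
  exact (mul_eq_zero.mp ha).resolve_left (by exact_mod_cast hl2.ne')

/-- A sum `∑ φ(k) |k| ^ (-z)` with `φ` homogeneous of degree `D` continues to the plane with a
single simple pole at `n + D`; its residue is determined by the behaviour on the real axis. The
factors `1 - q ^ (n + D - z)` for `q = 2` and `q = 3` have no other common zero. -/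
theorem exists_continuation_resonant {n D : ℕ} {φ : (Fin n → ℤ) → ℂ} (hφ : IsPolyFun D φ)
    (hhom : ∀ (q : ℕ) (k : Fin n → ℤ), φ (fun i => (q : ℤ) * k i) = (q : ℂ) ^ D * φ k)
    {κ : ℂ} (hκ : Filter.Tendsto (fun s : ℝ => ((s : ℂ) - (n + D)) * ∑' k, homTerm φ s k)
      (𝓝[>] ((n : ℝ) + D)) (𝓝 κ)) :
    ∃ G : ℂ → ℂ, Differentiable ℂ G ∧ ∀ z : ℂ, (n : ℝ) + D < z.re →
      ∑' k, homTerm φ z k = κ / (z - (n + D)) + G z := by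
  obtain ⟨E₂, hE₂, hE₂'⟩ := exists_entire_mul_resonant hφ hhom 2 (by norm_num)
  obtain ⟨E₃, hE₃, hE₃'⟩ := exists_entire_mul_resonant hφ hhom 3 (by norm_num)
  push_cast at hE₂' hE₃'
  set w : ℂ := (n : ℂ) + D with hw
  have hwre : w.re = (n : ℝ) + D := by simp [hw]
  set L : ℂ → ℂ → ℂ := fun q z => 1 - q ^ (w - z) with hLdef
  have hLder : ∀ q : ℂ, q ≠ 0 → ∀ z, HasDerivAt (L q) (q ^ (w - z) * Complex.log q) z := by
    intro q hq z
    have h1 : HasDerivAt (fun z : ℂ => w - z) (-1) z := (hasDerivAt_id z).const_sub w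
    refine ((h1.const_cpow (Or.inl hq)).const_sub 1).congr_deriv ?_
    ring
  have hLd : ∀ q : ℂ, q ≠ 0 → Differentiable ℂ (L q) := fun q hq z =>
    (hLder q hq z).differentiableAt
  have hlog2 : Complex.log 2 ≠ 0 := by
    rw [show (2 : ℂ) = ((2 : ℝ) : ℂ) by norm_num, ← Complex.ofReal_log (by norm_num)]
    exact_mod_cast (Real.log_pos (by norm_num)).ne'
  have hcross : ∀ z, E₂ z * L 3 z = E₃ z * L 2 z := by
    intro z
    refine eqOn_half_plane (σ := z.re - 1) (τ := (n : ℝ) + D)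
      (hE₂.mul (hLd 3 (by norm_num))).differentiableOn
      (hE₃.mul (hLd 2 (by norm_num))).differentiableOn (fun s hs => ?_) z (by linarith)
    simp only [Pi.mul_apply]
    rw [← hE₂' s hs, ← hE₃' s hs]
    ring
  have hL2w : L 2 w = 0 := by simp [hLdef]
  set κ' : ℂ := E₂ w / Complex.log 2
  have hds : Differentiable ℂ (dslope (L 2) w) := fun z =>
    ((Complex.differentiableOn_dslope Filter.univ_mem).mpr
      (hLd 2 (by norm_num)).differentiableOn).differentiableAt Filter.univ_mem
  obtain ⟨G, hG, hG'⟩ := exists_entire_quotient (N := fun z => E₂ z - κ' * dslope (L 2) w z)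
    (L := L 2) (hE₂.sub (hds.const_mul _)) (hLd 2 (by norm_num)) (by
      intro z hz
      have hz1 : (2 : ℂ) ^ (w - z) = 1 := (sub_eq_zero.mp hz).symm
      refine ⟨?_, ?_⟩
      · by_cases hzw : z = w
        · rw [hzw, dslope_same, (hLder 2 (by norm_num) w).deriv, sub_self, Complex.cpow_zero,
            one_mul]
          simp only [κ']
          field_simp
          ring
        · have h3 : L 3 z ≠ 0 := fun h3 => hzw
            (sub_eq_zero.mp (eq_zero_of_two_three_cpow hz1 (sub_eq_zero.mp h3).symm)).symm
          have h4 := hcross z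
          rw [hz, mul_zero] at h4
          rw [(mul_eq_zero.mp h4).resolve_right h3, dslope_of_ne _ hzw, slope_def_field, hz, hL2w]
          simp
      · rw [(hLder 2 (by norm_num) z).deriv, hz1, one_mul]
        exact hlog2)
  have hmain : ∀ z : ℂ, (n : ℝ) + D < z.re → ∑' k, homTerm φ z k = κ' / (z - w) + G z := by
    intro z hz
    have hzw : z ≠ w := by
      rintro rfl
      rw [hwre] at hz
      exact lt_irrefl _ hz
    have hL2 : L 2 z ≠ 0 := by
      intro h0
      have h1 : (2 : ℂ) ^ (w - z) = 1 := (sub_eq_zero.mp h0).symm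
      have h2 := congrArg norm h1
      rw [show (2 : ℂ) = ((2 : ℝ) : ℂ) by norm_num,
        Complex.norm_cpow_eq_rpow_re_of_pos (by norm_num), norm_one, Complex.sub_re, hwre] at h2
      have h3 : (2 : ℝ) ^ ((n : ℝ) + D - z.re) < 1 :=
        Real.rpow_lt_one_of_one_lt_of_neg (by norm_num) (by linarith)
      linarith
    have h1 := hG' z
    rw [← hE₂' z hz, dslope_of_ne _ hzw, slope_def_field, hL2w, sub_zero] at h1
    refine mul_left_cancel₀ hL2 ?_
    rw [mul_add, ← h1]
    simp only [hLdef]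
    ring
  -- The two descriptions of the residue agree.
  have hlim : Filter.Tendsto (fun s : ℝ => ((s : ℂ) - w) * ∑' k, homTerm φ s k)
      (𝓝[>] ((n : ℝ) + D)) (𝓝 κ') := by
    have hc : Filter.Tendsto (fun s : ℝ => κ' + ((s : ℂ) - w) * G s)
        (𝓝[>] ((n : ℝ) + D)) (𝓝 (κ' + ((((n : ℝ) + D : ℝ) : ℂ) - w) * G (((n : ℝ) + D : ℝ)))) := by
      have hc' : Continuous fun s : ℝ => κ' + ((s : ℂ) - w) * G s :=
        continuous_const.add ((Complex.continuous_ofReal.sub continuous_const).mul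
          (hG.continuous.comp Complex.continuous_ofReal))
      exact (hc'.tendsto _).mono_left nhdsWithin_le_nhds
    have e : (((n : ℝ) + D : ℝ) : ℂ) - w = 0 := by simp [hw]
    rw [e, zero_mul, add_zero] at hc
    refine hc.congr' ?_
    filter_upwards [self_mem_nhdsWithin] with s hs
    have hs' : (n : ℝ) + D < s := hs
    have hsw : (s : ℂ) - w ≠ 0 := by
      intro h0
      have := congrArg Complex.re h0
      rw [Complex.sub_re, hwre] at this
      simp at this
      linarith
    rw [hmain s (by simpa using hs')]
    field_simp
  rw [tendsto_nhds_unique hκ hlim]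
  exact ⟨G, hG, hmain⟩

/-! ### Comparison of lattice sums with integrals -/

lemma norm_prod_sub_prod_le {𝕜 ι : Type*} [NormedField 𝕜] (s : Finset ι) (S T : ι → 𝕜)
    {B : ℝ} (hB : 1 ≤ B) (hS : ∀ i ∈ s, ‖S i‖ ≤ B) (hT : ∀ i ∈ s, ‖T i‖ ≤ B) :
    ‖∏ i ∈ s, S i - ∏ i ∈ s, T i‖ ≤ B ^ s.card * ∑ i ∈ s, ‖S i - T i‖ := by
  classical
  induction s using Finset.induction_on with
  | empty => simp
  | insert a s ha ih =>
    rw [Finset.prod_insert ha, Finset.prod_insert ha, Finset.sum_insert ha,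
      Finset.card_insert_of_notMem ha]
    have h1 := ih (fun i hi => hS i (by simp [hi])) (fun i hi => hT i (by simp [hi]))
    have h2 : ‖∏ i ∈ s, S i‖ ≤ B ^ s.card := by
      rw [norm_prod]
      exact (Finset.prod_le_prod (fun _ _ => norm_nonneg _)
        fun i hi => hS i (by simp [hi])).trans (by simp)
    have h3 := hT a (by simp)
    have h4 : B ^ s.card ≤ B ^ (s.card + 1) := pow_le_pow_right₀ hB (Nat.le_succ _)
    have e : S a * ∏ i ∈ s, S i - T a * ∏ i ∈ s, T i =
        (S a - T a) * ∏ i ∈ s, S i + T a * (∏ i ∈ s, S i - ∏ i ∈ s, T i) := by ring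
    rw [e]
    refine (norm_add_le _ _).trans ?_
    rw [norm_mul, norm_mul, mul_add]
    refine add_le_add ?_ ?_
    · rw [mul_comm]
      exact mul_le_mul_of_nonneg_right (h2.trans h4) (norm_nonneg _)
    · calc ‖T a‖ * ‖∏ i ∈ s, S i - ∏ i ∈ s, T i‖
          ≤ B * (B ^ s.card * ∑ i ∈ s, ‖S i - T i‖) := by gcongr
        _ = _ := by ring

/-- Integration in polar coordinates. -/
lemma integral_polar {E : Type*} [NormedAddCommGroup E] [NormedSpace ℝ E] [MeasurableSpace E]
    [BorelSpace E] [FiniteDimensional ℝ E] [Nontrivial E] (μ : Measure E) [μ.IsAddHaarMeasure]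
    (Φ : E → ℝ) (f : ℝ → ℝ) :
    ∫ x, Φ (‖x‖⁻¹ • x) * f ‖x‖ ∂μ = (∫ u : Metric.sphere (0 : E) 1, Φ u ∂μ.toSphere) *
      ∫ r in Set.Ioi (0 : ℝ), r ^ (Module.finrank ℝ E - 1) * f r :=
  calc
    ∫ x, Φ (‖x‖⁻¹ • x) * f ‖x‖ ∂μ
        = ∫ x : ({(0)}ᶜ : Set E), Φ (‖x.1‖⁻¹ • x.1) * f ‖x.1‖ ∂(μ.comap (↑)) := by
      rw [integral_subtype_comap (measurableSet_singleton _).compl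
        fun x => Φ (‖x‖⁻¹ • x) * f ‖x‖, restrict_compl_singleton]
    _ = ∫ x : Metric.sphere (0 : E) 1 × Set.Ioi (0 : ℝ), Φ x.1 * f x.2
          ∂μ.toSphere.prod (.volumeIoiPow (Module.finrank ℝ E - 1)) := by
      simpa using μ.measurePreserving_homeomorphUnitSphereProd.integral_comp
        (Homeomorph.measurableEmbedding _)
        (fun x : Metric.sphere (0 : E) 1 × Set.Ioi (0 : ℝ) => Φ x.1 * f x.2)
    _ = (∫ u : Metric.sphere (0 : E) 1, Φ u ∂μ.toSphere) *
          ∫ x : Set.Ioi (0 : ℝ), f x ∂.volumeIoiPow (Module.finrank ℝ E - 1) :=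
      integral_prod_mul (fun u : Metric.sphere (0 : E) 1 => Φ u)
        (fun x : Set.Ioi (0 : ℝ) => f x)
    _ = _ := by
      simp only [Measure.volumeIoiPow, ENNReal.ofReal]
      rw [integral_withDensity_eq_integral_smul,
        integral_subtype_comap measurableSet_Ioi
          fun a => Real.toNNReal (a ^ (Module.finrank ℝ E - 1)) • f a,
        setIntegral_congr_fun measurableSet_Ioi fun x hx => ?_]
      · rw [NNReal.smul_def, Real.coe_toNNReal _ (pow_nonneg hx.out.le _), smul_eq_mul]
      · exact (measurable_subtype_coe.pow_const _).real_toNNReal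

/-- The integral `∫₀^∞ r ^ (w - 1) max(1, r) ^ (-s) dr`. -/
lemma integral_rpow_mul_max {w s : ℝ} (hw : 0 < w) (hs : w < s) :
    ∫ r in Set.Ioi (0 : ℝ), r ^ (w - 1) * max 1 r ^ (-s) = 1 / w + 1 / (s - w) := by
  have h1 : ∀ r ∈ Set.Ioc (0 : ℝ) 1, r ^ (w - 1) * max 1 r ^ (-s) = r ^ (w - 1) := fun r hr => by
    rw [max_eq_left hr.2, Real.one_rpow, mul_one]
  have h2 : ∀ r ∈ Set.Ioi (1 : ℝ), r ^ (w - 1) * max 1 r ^ (-s) = r ^ (w - 1 - s) := fun r hr => by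
    have hr' : (1 : ℝ) < r := hr
    rw [max_eq_right hr'.le, ← Real.rpow_add (by linarith), sub_eq_add_neg (w - 1)]
  have i1 : IntegrableOn (fun r : ℝ => r ^ (w - 1)) (Set.Ioc 0 1) := by
    rw [← intervalIntegrable_iff_integrableOn_Ioc_of_le zero_le_one]
    exact intervalIntegral.intervalIntegrable_rpow' (by linarith)
  have i2 : IntegrableOn (fun r : ℝ => r ^ (w - 1 - s)) (Set.Ioi 1) :=
    integrableOn_Ioi_rpow_of_lt (by linarith) one_pos
  rw [← Set.Ioc_union_Ioi_eq_Ioi (zero_le_one' ℝ),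
    setIntegral_union (Set.Ioc_disjoint_Ioi le_rfl) measurableSet_Ioi
      (i1.congr_fun (fun r hr => (h1 r hr).symm) measurableSet_Ioc)
      (i2.congr_fun (fun r hr => (h2 r hr).symm) measurableSet_Ioi),
    setIntegral_congr_fun measurableSet_Ioc h1, setIntegral_congr_fun measurableSet_Ioi h2,
    integral_Ioi_rpow_of_lt (by linarith) one_pos,
    ← intervalIntegral.integral_of_le zero_le_one, integral_rpow (Or.inl (by linarith)),
    Real.one_rpow, Real.one_rpow, sub_add_cancel, Real.zero_rpow hw.ne', sub_zero]
  congr 1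
  have e : w - 1 - s + 1 = -(s - w) := by ring
  rw [e, neg_div_neg_eq]

section Monomials

variable {n : ℕ} (β : Fin n → ℕ)

/-- The function `x ^ β max(1, |x|) ^ (-s)` on Euclidean space. -/
def truncTerm (s : ℝ) (x : EuclideanSpace ℝ (Fin n)) : ℝ :=
  (∏ t, x t ^ β t) * max 1 ‖x‖ ^ (-s)

lemma continuous_truncTerm (s : ℝ) : Continuous (truncTerm β s) := by
  unfold truncTerm
  refine .mul (by fun_prop) ?_
  refine Continuous.rpow_const (by fun_prop) fun x => Or.inl ?_
  exact (one_pos.trans_le (le_max_left _ _)).ne'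

lemma truncTerm_eq (s : ℝ) (x : EuclideanSpace ℝ (Fin n)) :
    truncTerm β s x = (∏ t, (x t / max 1 ‖x‖) ^ β t) * max 1 ‖x‖ ^ (-(s - ∑ t, (β t : ℝ))) := by
  have hm : 0 < max 1 ‖x‖ := one_pos.trans_le (le_max_left _ _)
  simp only [truncTerm, div_pow, Finset.prod_div_distrib]
  rw [neg_sub, sub_eq_add_neg, Real.rpow_add hm, Finset.prod_pow_eq_pow_sum,
    ← Nat.cast_sum, Real.rpow_natCast]
  field_simp

lemma abs_coord_div_le (x : EuclideanSpace ℝ (Fin n)) (t : Fin n) : |x t / max 1 ‖x‖| ≤ 1 := by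
  have hm : 0 < max 1 ‖x‖ := one_pos.trans_le (le_max_left _ _)
  rw [abs_div, abs_of_pos hm, div_le_one hm]
  exact (PiLp.norm_apply_le x t).trans (le_max_right _ _)

lemma abs_prod_coord_div_le (x : EuclideanSpace ℝ (Fin n)) :
    |∏ t, (x t / max 1 ‖x‖) ^ β t| ≤ 1 := by
  rw [Finset.abs_prod]
  refine Finset.prod_le_one (fun _ _ => abs_nonneg _) fun t _ => ?_
  rw [abs_pow]
  exact pow_le_one₀ (abs_nonneg _) (abs_coord_div_le x t)

lemma abs_truncTerm_le (s : ℝ) (x : EuclideanSpace ℝ (Fin n)) :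
    |truncTerm β s x| ≤ max 1 ‖x‖ ^ (-(s - ∑ t, (β t : ℝ))) := by
  have hm : 0 < max 1 ‖x‖ := one_pos.trans_le (le_max_left _ _)
  rw [truncTerm_eq, abs_mul, abs_of_pos (Real.rpow_pos_of_pos hm _)]
  exact mul_le_of_le_one_left (Real.rpow_pos_of_pos hm _).le (abs_prod_coord_div_le β x)

lemma integrable_truncTerm {s : ℝ} (hs : (n : ℝ) + ∑ t, (β t : ℝ) < s) :
    Integrable (truncTerm β s) := by
  set σ := s - ∑ t, (β t : ℝ)
  have hσ : (n : ℝ) < σ := by simp only [σ]; linarith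
  have hσ0 : 0 ≤ σ := (Nat.cast_nonneg n).trans hσ.le
  have h := (integrable_one_add_norm (E := EuclideanSpace ℝ (Fin n)) (μ := volume) (r := σ)
    (by simpa using hσ)).const_mul (2 ^ σ)
  refine h.mono' (continuous_truncTerm β s).aestronglyMeasurable (.of_forall fun x => ?_)
  have h1 : (1 + ‖x‖) / 2 ≤ max 1 ‖x‖ := by
    have := le_max_left 1 ‖x‖
    have := le_max_right 1 ‖x‖
    linarith
  have h2 : 0 < 1 + ‖x‖ := by positivity
  calc ‖truncTerm β s x‖ ≤ max 1 ‖x‖ ^ (-σ) := abs_truncTerm_le β s x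
    _ ≤ ((1 + ‖x‖) / 2) ^ (-σ) := Real.rpow_le_rpow_of_nonpos (by positivity) h1 (by linarith)
    _ = 2 ^ σ * (1 + ‖x‖) ^ (-σ) := by
      rw [Real.div_rpow h2.le (by norm_num), Real.rpow_neg (by norm_num : (0 : ℝ) ≤ 2),
        div_inv_eq_mul, mul_comm]

lemma integral_truncTerm (hn : 1 ≤ n) {s : ℝ} (hs : (n : ℝ) + ∑ t, (β t : ℝ) < s) :
    ∫ x, truncTerm β s x =
      (∫ u : Metric.sphere (0 : EuclideanSpace ℝ (Fin n)) 1,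
        ∏ t, (u : EuclideanSpace ℝ (Fin n)) t ^ β t
        ∂(volume : Measure (EuclideanSpace ℝ (Fin n))).toSphere) *
      (1 / ((n : ℝ) + ∑ t, (β t : ℝ)) + 1 / (s - ((n : ℝ) + ∑ t, (β t : ℝ)))) := by
  have : Nonempty (Fin n) := ⟨⟨0, hn⟩⟩
  have : Nontrivial (EuclideanSpace ℝ (Fin n)) := by
    refine Module.nontrivial_of_finrank_pos (R := ℝ) ?_
    rw [finrank_euclideanSpace_fin]
    exact hn
  have hw : 0 < (n : ℝ) + ∑ t, (β t : ℝ) := by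
    have : (0 : ℝ) < n := by exact_mod_cast hn
    positivity
  rw [← integral_rpow_mul_max hw hs]
  have h := integral_polar (volume : Measure (EuclideanSpace ℝ (Fin n))) (fun x => ∏ t, x t ^ β t)
    (fun r => r ^ (∑ t, β t) * max 1 r ^ (-s))
  rw [finrank_euclideanSpace_fin] at h
  have e1 : ∀ x : EuclideanSpace ℝ (Fin n), (∏ t, (‖x‖⁻¹ • x) t ^ β t) *
      (‖x‖ ^ (∑ t, β t) * max 1 ‖x‖ ^ (-s)) = truncTerm β s x := by
    intro x
    simp only [PiLp.smul_apply, smul_eq_mul, mul_pow, Finset.prod_mul_distrib]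
    rw [Finset.prod_pow_eq_pow_sum, truncTerm]
    by_cases hx : x = 0
    · subst hx
      by_cases hb : ∑ t, β t = 0
      · simp [hb]
      · have : ∏ t, (0 : EuclideanSpace ℝ (Fin n)) t ^ β t = 0 := by
          simp only [PiLp.zero_apply]
          rw [Finset.prod_pow_eq_pow_sum, zero_pow hb]
        rw [this]
        simp
    · have hx' : ‖x‖ ^ (∑ t, β t) ≠ 0 := pow_ne_zero _ (norm_ne_zero_iff.mpr hx)
      rw [inv_pow]
      field_simp
  simp only [e1] at h
  rw [h]
  congr 1
  refine setIntegral_congr_fun measurableSet_Ioi fun r hr => ?_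
  have hr' : (0 : ℝ) < r := hr
  rw [← mul_assoc, ← pow_add, ← Real.rpow_natCast]
  congr 2
  push_cast [Nat.cast_sub hn]
  ring

/-- A Lipschitz bound for the truncated terms, uniform for bounded exponents. -/
lemma exists_truncTerm_sub_bound :
    ∃ C : ℝ, ∀ s : ℝ, (n : ℝ) + ∑ t, (β t : ℝ) < s → s ≤ (n : ℝ) + ∑ t, (β t : ℝ) + 1 →
      ∀ x y : EuclideanSpace ℝ (Fin n), ‖x - y‖ ≤ n →
        |truncTerm β s x - truncTerm β s y| ≤ C * max 1 ‖y‖ ^ (-((n : ℝ) + 1)) := by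
  set D : ℝ := ∑ t, (β t : ℝ)
  set ν : ℝ := (n : ℝ)
  have hν : 0 ≤ ν := Nat.cast_nonneg n
  have hD : 0 ≤ D := Finset.sum_nonneg fun _ _ => Nat.cast_nonneg _
  refine ⟨D * (2 * ν) * (1 + ν) ^ (ν + 1) + (ν + 1) * (1 + ν) ^ (ν + 2) * ν,
    fun s hs1 hs2 x y hxy => ?_⟩
  set σ := s - D with hσ
  have hσ1 : ν < σ := by linarith
  have hσ2 : σ ≤ ν + 1 := by linarith
  set a := max 1 ‖x‖ with ha
  set b := max 1 ‖y‖ with hb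
  have ha1 : 1 ≤ a := le_max_left _ _
  have hb1 : 1 ≤ b := le_max_left _ _
  have ha0 : 0 < a := by linarith
  have hb0 : 0 < b := by linarith
  have hab : |a - b| ≤ ν :=
    (abs_max_sub_max_le_abs _ _ _ |>.trans_eq' (by rw [ha, hb, max_comm 1, max_comm 1])).trans
      ((abs_norm_sub_norm_le x y).trans hxy)
  have hab' := abs_le.mp hab
  set c := b / (1 + ν) with hc
  have hc0 : 0 < c := by positivity
  have hca : c ≤ a := by
    rw [hc, div_le_iff₀ (by positivity)]
    nlinarith
  have hcb : c ≤ b := by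
    rw [hc]
    exact div_le_self hb0.le (by linarith)
  have hbν : b ^ (-σ - 1) ≤ b ^ (-(ν + 1)) :=
    Real.rpow_le_rpow_of_exponent_le hb1 (by linarith)
  have hcpow : ∀ e : ℝ, c ^ (-e) = (1 + ν) ^ e * b ^ (-e) := fun e => by
    rw [hc, Real.div_rpow hb0.le (by positivity), Real.rpow_neg (by positivity : 0 ≤ 1 + ν),
      div_inv_eq_mul, mul_comm]
  have haσ : a ^ (-σ) ≤ (1 + ν) ^ (ν + 1) * b ^ (-σ) := by
    calc a ^ (-σ) ≤ c ^ (-σ) := Real.rpow_le_rpow_of_nonpos hc0 hca (by linarith)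
      _ = (1 + ν) ^ σ * b ^ (-σ) := hcpow σ
      _ ≤ _ := by
        refine mul_le_mul_of_nonneg_right ?_ (Real.rpow_nonneg hb0.le _)
        exact Real.rpow_le_rpow_of_exponent_le (by linarith) hσ2
  -- The second factors differ little, by the mean value theorem.
  have hsecond : |a ^ (-σ) - b ^ (-σ)| ≤ (ν + 1) * (1 + ν) ^ (ν + 2) * ν * b ^ (-(ν + 1)) := by
    have hmv := Convex.norm_image_sub_le_of_norm_hasDerivWithin_le (f := fun r : ℝ => r ^ (-σ))
      (f' := fun r => -σ * r ^ (-σ - 1)) (s := Set.Ici c) (x := b) (y := a)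
      (C := (ν + 1) * ((1 + ν) ^ (ν + 2) * b ^ (-(ν + 1))))
      (fun r hr => (Real.hasDerivAt_rpow_const (Or.inl (hc0.trans_le hr).ne')).hasDerivWithinAt)
      (fun r hr => ?_) (convex_Ici c) hcb hca
    · refine hmv.trans ?_
      rw [Real.norm_eq_abs]
      calc _ ≤ (ν + 1) * ((1 + ν) ^ (ν + 2) * b ^ (-(ν + 1))) * ν := by gcongr
        _ = _ := by ring
    · have hr0 : 0 < r := hc0.trans_le hr
      rw [norm_mul, norm_neg, Real.norm_of_nonneg (by linarith : 0 ≤ σ),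
        Real.norm_of_nonneg (Real.rpow_nonneg hr0.le _)]
      refine mul_le_mul hσ2 ?_ (Real.rpow_nonneg hr0.le _) (by linarith)
      calc r ^ (-σ - 1) ≤ c ^ (-σ - 1) := Real.rpow_le_rpow_of_nonpos hc0 hr (by linarith)
        _ = (1 + ν) ^ (σ + 1) * b ^ (-σ - 1) := by
          rw [show -σ - 1 = -(σ + 1) by ring, hcpow]
        _ ≤ _ := by
          refine mul_le_mul ?_ hbν (Real.rpow_nonneg hb0.le _) (by positivity)
          exact Real.rpow_le_rpow_of_exponent_le (by linarith) (by linarith)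
  have hcoord : ∀ t, |x t / a - y t / b| ≤ 2 * ν / b := by
    intro t
    have e : x t / a - y t / b = (x t - y t) / b + (x t / a) * ((b - a) / b) := by
      field_simp
      ring
    have h1 : |x t - y t| ≤ ν := by
      have := PiLp.norm_apply_le (x - y) t
      exact this.trans hxy
    rw [e]
    refine (abs_add_le _ _).trans ?_
    rw [abs_mul (x t / a), abs_div (x t - y t), abs_div (b - a), abs_of_pos hb0,
      abs_sub_comm b a]
    calc |x t - y t| / b + |x t / a| * (|a - b| / b) ≤ ν / b + 1 * (ν / b) := by
          gcongr
          exact abs_coord_div_le x t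
      _ = 2 * ν / b := by ring
  have hfirst : |∏ t, (x t / a) ^ β t - ∏ t, (y t / b) ^ β t| ≤ D * (2 * ν / b) := by
    have hle : ∀ z : EuclideanSpace ℝ (Fin n), ∀ t ∈ Finset.univ,
        ‖(z t / max 1 ‖z‖) ^ β t‖ ≤ 1 := fun z t _ => by
      rw [norm_pow]
      exact pow_le_one₀ (norm_nonneg _) (abs_coord_div_le z t)
    have h := norm_prod_sub_prod_le Finset.univ (fun t => (x t / a) ^ β t)
      (fun t => (y t / b) ^ β t) le_rfl (hle x) (hle y)
    rw [one_pow, one_mul] at h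
    refine h.trans ?_
    rw [Finset.sum_mul]
    refine Finset.sum_le_sum fun t _ => ?_
    have h' := norm_prod_sub_prod_le (Finset.range (β t)) (fun _ => x t / a) (fun _ => y t / b)
      le_rfl (fun _ _ => abs_coord_div_le x t) (fun _ _ => abs_coord_div_le y t)
    simp only [Finset.prod_const, Finset.card_range, one_pow, one_mul, Finset.sum_const,
      nsmul_eq_mul] at h'
    exact h'.trans (mul_le_mul_of_nonneg_left (hcoord t) (Nat.cast_nonneg _))
  have e : truncTerm β s x - truncTerm β s y =
      (∏ t, (x t / a) ^ β t - ∏ t, (y t / b) ^ β t) * a ^ (-σ) +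
        (∏ t, (y t / b) ^ β t) * (a ^ (-σ) - b ^ (-σ)) := by
    rw [truncTerm_eq, truncTerm_eq]
    ring
  rw [e, add_mul]
  refine (abs_add_le _ _).trans (add_le_add ?_ ?_)
  · rw [abs_mul, abs_of_pos (Real.rpow_pos_of_pos ha0 _)]
    calc _ ≤ D * (2 * ν / b) * ((1 + ν) ^ (ν + 1) * b ^ (-σ)) := by gcongr
      _ = D * (2 * ν) * (1 + ν) ^ (ν + 1) * b ^ (-σ - 1) := by
        rw [Real.rpow_sub_one hb0.ne']
        ring
      _ ≤ _ := by gcongr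
  · rw [abs_mul]
    exact (mul_le_of_le_one_left (abs_nonneg _) (abs_prod_coord_div_le β y)).trans hsecond

/-- An integer vector as a point of Euclidean space. -/
def toE (k : Fin n → ℤ) : EuclideanSpace ℝ (Fin n) := WithLp.toLp 2 fun i => (k i : ℝ)

/-- The unit cube with lowest vertex `k`. -/
def cube (k : Fin n → ℤ) : Set (EuclideanSpace ℝ (Fin n)) := {x | ∀ t, ⌊x t⌋ = k t}

lemma cube_eq_preimage (k : Fin n → ℤ) :
    cube k = (WithLp.ofLp : EuclideanSpace ℝ (Fin n) → Fin n → ℝ) ⁻¹'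
      (Set.univ.pi fun t => Set.Ico (k t : ℝ) (k t + 1)) := by
  ext x
  simp [cube, Set.mem_pi, Int.floor_eq_iff]

lemma measurableSet_cube (k : Fin n → ℤ) : MeasurableSet (cube k) := by
  rw [cube_eq_preimage]
  exact (PiLp.volume_preserving_ofLp (Fin n)).measurable
    (MeasurableSet.univ_pi fun _ => measurableSet_Ico)

lemma volume_cube (k : Fin n → ℤ) : volume (cube k) = 1 := by
  rw [cube_eq_preimage, (PiLp.volume_preserving_ofLp (Fin n)).measure_preimage
    (MeasurableSet.univ_pi fun _ => measurableSet_Ico).nullMeasurableSet, Real.volume_pi_Ico]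
  simp

lemma norm_sub_le_of_mem_cube {k : Fin n → ℤ} {x : EuclideanSpace ℝ (Fin n)} (hx : x ∈ cube k) :
    ‖x - toE k‖ ≤ n := by
  rw [EuclideanSpace.norm_eq]
  refine Real.sqrt_le_iff.mpr ⟨Nat.cast_nonneg n, ?_⟩
  have h : ∀ t, ‖(x - toE k) t‖ ^ 2 ≤ 1 := fun t => by
    have h0 : ⌊x t⌋ = k t := hx t
    rw [Int.floor_eq_iff] at h0
    rw [Real.norm_eq_abs, sq_abs]
    simp only [PiLp.sub_apply, toE]
    nlinarith [h0.1, h0.2]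
  calc ∑ t, ‖(x - toE k) t‖ ^ 2 ≤ ∑ _t : Fin n, (1 : ℝ) := Finset.sum_le_sum fun t _ => h t
    _ = n := by simp
    _ ≤ (n : ℝ) ^ 2 := by exact_mod_cast Nat.le_self_pow two_ne_zero n

lemma norm_toE (k : Fin n → ℤ) : ‖toE k‖ = eucl k := (eucl_eq_norm k).symm

/-- The monomial `k ^ β`. -/
def monom (k : Fin n → ℤ) : ℂ := ∏ t, (k t : ℂ) ^ β t

lemma isPolyFun_monom : IsPolyFun (∑ t, β t) (monom β) := by
  simpa [monom, funext_iff] using! IsPolyFun.prod (n := n) Finset.univ (d := β)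
    (f := fun t k => (k t : ℂ) ^ β t) fun t _ => by simpa using (IsPolyFun.coord t).pow (β t)

lemma monom_smul (q : ℕ) (k : Fin n → ℤ) :
    monom β (fun i => (q : ℤ) * k i) = (q : ℂ) ^ (∑ t, β t) * monom β k := by
  simp only [monom]
  push_cast
  simp only [mul_pow, Finset.prod_mul_distrib]
  rw [Finset.prod_pow_eq_pow_sum]

lemma homTerm_monom_eq (s : ℝ) {k : Fin n → ℤ} (hk : k ≠ 0) :
    homTerm (monom β) s k = (truncTerm β s (toE k) : ℝ) := by
  rw [homTerm_of_ne _ _ hk, truncTerm, norm_toE, max_eq_right (one_le_eucl hk), monom,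
    Complex.ofReal_mul, Complex.ofReal_cpow (eucl_nonneg k)]
  simp [toE]

/-- Near `s = n + |β|`, the sum over the lattice differs from the integral by a bounded amount. -/
lemma exists_sum_sub_integral_bound :
    ∃ C : ℝ, ∀ s : ℝ, (n : ℝ) + ∑ t, (β t : ℝ) < s → s ≤ (n : ℝ) + ∑ t, (β t : ℝ) + 1 →
      ‖∑' k, homTerm (monom β) s k - ((∫ x, truncTerm β s x : ℝ) : ℂ)‖ ≤ C := by
  obtain ⟨C, hC⟩ := exists_truncTerm_sub_bound β
  have hjs := (summable_jap_rpow (n := n) (r := (n : ℝ) + 1) (by linarith)).mul_left C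
  refine ⟨1 + ∑' k : Fin n → ℤ, C * jap k ^ (-((n : ℝ) + 1)), fun s hs1 hs2 => ?_⟩
  set F := truncTerm β s
  have hcov : ⋃ k : Fin n → ℤ, cube k = Set.univ :=
    Set.eq_univ_of_forall fun x => Set.mem_iUnion.mpr ⟨fun t => ⌊x t⌋, fun _ => rfl⟩
  have hdisj : Pairwise (Function.onFun Disjoint (cube (n := n))) := by
    intro k l hkl
    rw [Function.onFun, Set.disjoint_left]
    intro x hx hx'
    exact hkl (funext fun t => (hx t).symm.trans (hx' t))
  have hint := integrable_truncTerm β hs1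
  have hsum := hasSum_integral_iUnion (μ := volume) (f := F) measurableSet_cube hdisj
    (by rw [hcov]; exact hint.integrableOn)
  rw [hcov, setIntegral_univ] at hsum
  have hdiff : ∀ k : Fin n → ℤ,
      ‖(∫ x in cube k, F x) - F (toE k)‖ ≤ C * jap k ^ (-((n : ℝ) + 1)) := by
    intro k
    have h1 : (∫ x in cube k, F x) - F (toE k) = ∫ x in cube k, (F x - F (toE k)) := by
      rw [integral_sub hint.integrableOn (integrableOn_const (by simp [volume_cube]))]
      simp [Measure.real, volume_cube, F]
    rw [h1]
    have h2 := norm_setIntegral_le_of_norm_le_const (μ := volume) (s := cube k)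
      (f := fun x => F x - F (toE k)) (C := C * jap k ^ (-((n : ℝ) + 1)))
      (by simp [volume_cube]) (fun x hx => by
        have := hC s hs1 hs2 x (toE k) (norm_sub_le_of_mem_cube hx)
        rwa [norm_toE] at this)
    simpa [Measure.real, volume_cube] using h2
  have hds : Summable fun k : Fin n → ℤ => (∫ x in cube k, F x) - F (toE k) :=
    .of_norm_bounded hjs hdiff
  have hFs : Summable fun k : Fin n → ℤ => F (toE k) := by
    simpa using hsum.summable.sub hds
  have hb1 : ‖∑' k : Fin n → ℤ, ((∫ x in cube k, F x) - F (toE k))‖ ≤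
      ∑' k : Fin n → ℤ, C * jap k ^ (-((n : ℝ) + 1)) :=
    tsum_of_norm_bounded hjs.hasSum hdiff
  rw [hsum.summable.tsum_sub hFs, hsum.tsum_eq] at hb1
  have hsplit : ∑' k, homTerm (monom β) s k =
      ((∑' k : Fin n → ℤ, F (toE k) : ℝ) : ℂ) - (F (toE 0) : ℝ) := by
    rw [hFs.tsum_eq_add_tsum_ite 0, Complex.ofReal_add, add_sub_cancel_left,
      Complex.ofReal_tsum]
    refine tsum_congr fun k => ?_
    split_ifs with hk
    · rw [hk, homTerm_zero, Complex.ofReal_zero]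
    · exact homTerm_monom_eq β s hk
  have hF0 : |F (toE 0)| ≤ 1 := by
    refine (abs_truncTerm_le β s _).trans ?_
    rw [norm_toE, eucl_zero, max_eq_left zero_le_one, Real.one_rpow]
  rw [hsplit]
  have e : ((∑' k : Fin n → ℤ, F (toE k) : ℝ) : ℂ) - (F (toE 0) : ℝ) - ((∫ x, F x : ℝ) : ℂ) =
      ((-F (toE 0) + -((∫ x, F x) - ∑' k : Fin n → ℤ, F (toE k)) : ℝ) : ℂ) := by
    push_cast
    ring
  rw [e, Complex.norm_real]
  refine (norm_add_le _ _).trans ?_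
  rw [norm_neg, norm_neg]
  exact add_le_add hF0 hb1

/-- The residue of `∑ k ^ β |k| ^ (-s)` at `n + |β|` is the integral of `u ^ β` over the sphere. -/
theorem tendsto_residue_monom (hn : 1 ≤ n) :
    Filter.Tendsto (fun s : ℝ => ((s : ℂ) - (n + (∑ t, β t : ℕ))) * ∑' k, homTerm (monom β) s k)
      (𝓝[>] ((n : ℝ) + (∑ t, β t : ℕ)))
      (𝓝 ((∫ u : Metric.sphere (0 : EuclideanSpace ℝ (Fin n)) 1,
        ∏ t, (u : EuclideanSpace ℝ (Fin n)) t ^ β t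
        ∂(volume : Measure (EuclideanSpace ℝ (Fin n))).toSphere : ℝ) : ℂ)) := by
  obtain ⟨C, hC⟩ := exists_sum_sub_integral_bound β
  set κ : ℝ := ∫ u : Metric.sphere (0 : EuclideanSpace ℝ (Fin n)) 1,
        ∏ t, (u : EuclideanSpace ℝ (Fin n)) t ^ β t
        ∂(volume : Measure (EuclideanSpace ℝ (Fin n))).toSphere with hκ
  push_cast
  set w : ℝ := (n : ℝ) + ∑ t, (β t : ℝ) with hw
  have hwc : ((n : ℂ) + ∑ t, (β t : ℂ)) = (w : ℂ) := by simp [hw]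
  rw [hwc]
  have hlim0 : Filter.Tendsto (fun s : ℝ => s - w) (𝓝[>] w) (𝓝 0) := by
    have : Filter.Tendsto (fun s : ℝ => s - w) (𝓝 w) (𝓝 (w - w)) :=
      (continuous_id.sub continuous_const).tendsto w
    rw [sub_self] at this
    exact this.mono_left nhdsWithin_le_nhds
  have hnear : ∀ᶠ s : ℝ in 𝓝[>] w, w < s ∧ s ≤ w + 1 := by
    filter_upwards [Ioc_mem_nhdsGT (lt_add_one w)] with s hs using hs
  have h1 : Filter.Tendsto (fun s : ℝ => (((s - w) * ∫ x, truncTerm β s x : ℝ) : ℂ))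
      (𝓝[>] w) (𝓝 (κ : ℂ)) := by
    refine (Complex.continuous_ofReal.tendsto _).comp ?_
    have : Filter.Tendsto (fun s : ℝ => κ * ((s - w) * (1 / w) + 1)) (𝓝[>] w)
        (𝓝 (κ * (0 * (1 / w) + 1))) :=
      ((hlim0.mul_const _).add_const _).const_mul _
    rw [zero_mul, zero_add, mul_one] at this
    refine this.congr' ?_
    filter_upwards [hnear] with s hs
    rw [integral_truncTerm β hn hs.1, ← hκ, ← hw]
    have : s - w ≠ 0 := by linarith [hs.1]
    field_simp
  have h2 : Filter.Tendsto (fun s : ℝ => ((s : ℂ) - w) *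
      (∑' k, homTerm (monom β) s k - ((∫ x, truncTerm β s x : ℝ) : ℂ))) (𝓝[>] w) (𝓝 0) := by
    rw [tendsto_zero_iff_norm_tendsto_zero]
    have h3 : Filter.Tendsto (fun s : ℝ => |s - w| * C) (𝓝[>] w) (𝓝 0) := by
      simpa using (hlim0.abs).mul_const C
    refine squeeze_zero' (.of_forall fun _ => norm_nonneg _) ?_ h3
    filter_upwards [hnear] with s hs
    rw [norm_mul, ← Complex.ofReal_sub, Complex.norm_real, Real.norm_eq_abs]
    exact mul_le_mul_of_nonneg_left (hC s hs.1 hs.2) (abs_nonneg _)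
  have h := h1.add h2
  rw [add_zero] at h
  refine h.congr fun s => ?_
  push_cast
  ring

/-- The meromorphic continuation of `∑ k ^ β |k| ^ (-z)`. -/
theorem exists_continuation_monom (hn : 1 ≤ n) :
    ∃ G : ℂ → ℂ, Differentiable ℂ G ∧ ∀ z : ℂ, (n : ℝ) + (∑ t, β t : ℕ) < z.re →
      ∑' k, homTerm (monom β) z k =
        ((∫ u : Metric.sphere (0 : EuclideanSpace ℝ (Fin n)) 1,
          ∏ t, (u : EuclideanSpace ℝ (Fin n)) t ^ β t
          ∂(volume : Measure (EuclideanSpace ℝ (Fin n))).toSphere : ℝ) : ℂ) /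
            (z - (n + (∑ t, β t : ℕ))) + G z :=
  exists_continuation_resonant (isPolyFun_monom β) (monom_smul β) (tendsto_residue_monom β hn)

end Monomials

/-! ### Rapidly decreasing weights and the Diophantine condition -/

section Weights

variable {n q : ℕ}

/-- The size `1 + |l_1| + ⋯ + |l_2q|` of an index. -/
def big (l : Idx n q) : ℝ := 1 + ∑ j, eucl (l j)

lemma one_le_big (l : Idx n q) : 1 ≤ big l :=
  le_add_of_nonneg_right (Finset.sum_nonneg fun _ _ => eucl_nonneg _)

lemma big_pos (l : Idx n q) : 0 < big l := one_pos.trans_le (one_le_big l)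

lemma eucl_le_big (l : Idx n q) (j : Fin q ⊕ Fin q) : eucl (l j) ≤ big l := by
  have := Finset.single_le_sum (f := fun j => eucl (l j)) (fun _ _ => eucl_nonneg _)
    (Finset.mem_univ j)
  simp only [big]
  linarith

lemma abs_coord_le_big (l : Idx n q) (t : (Fin q ⊕ Fin q) × Fin n) : |(l t.1 t.2 : ℝ)| ≤ big l :=
  (abs_coord_le_eucl _ _).trans (eucl_le_big l t.1)

lemma eucl_firstSum_le (l : Idx n q) : eucl (firstSum l) ≤ big l := by
  refine (eucl_sum_le _ _).trans ?_
  rw [big, Fintype.sum_sum_type]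
  have : 0 ≤ ∑ j : Fin q, eucl (l (Sum.inr j)) := Finset.sum_nonneg fun _ _ => eucl_nonneg _
  linarith

/-- Weights whose product with every power of the size of the index is summable. -/
def RapidDecay (b : Idx n q → ℂ) : Prop := ∀ N : ℕ, Summable fun l => ‖b l‖ * big l ^ N

lemma RapidDecay.summable_norm {b : Idx n q → ℂ} (hb : RapidDecay b) :
    Summable fun l => ‖b l‖ := by simpa using hb 0

lemma summable_big_rpow : ∃ K : ℕ, Summable fun l : Idx n q => (big l ^ K)⁻¹ := by
  classical
  let ι := (Fin q ⊕ Fin q) × Fin n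
  obtain ⟨K, hK⟩ := exists_nat_gt (Fintype.card ι : ℝ)
  refine ⟨K, ?_⟩
  have h := summable_int_norm_rpow hK
  have h' := (h.comp_injective (Equiv.curry (Fin q ⊕ Fin q) (Fin n) ℤ).symm.injective)
  refine (h'.add (summable_of_hasFiniteSupport
    (f := fun l : Idx n q => if l = 0 then (1 : ℝ) else 0)
    (Set.Finite.subset (Set.finite_singleton 0) ?_))).of_nonneg_of_le
    (fun l => by have := big_pos l; positivity) fun l => ?_
  · intro l hl
    by_contra h
    simp_all
  · simp only [Function.comp_apply]
    split_ifs with hl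
    · refine le_add_of_nonneg_of_le (Real.rpow_nonneg (norm_nonneg _) _) ?_
      exact inv_le_one_of_one_le₀ (one_le_pow₀ (one_le_big l))
    · rw [add_zero, Real.rpow_neg (norm_nonneg _), Real.rpow_natCast]
      refine inv_anti₀ (pow_pos ?_ _) (pow_le_pow_left₀ (norm_nonneg _) ?_ _)
      · rw [norm_pos_iff]
        intro h0
        apply hl
        ext j t
        simpa using congrFun h0 (j, t)
      · rw [pi_norm_le_iff_of_nonneg (big_pos l).le]
        rintro ⟨j, t⟩
        exact abs_coord_le_big l (j, t)

lemma IsSchwartz.rapidDecay {a : Idx n q → ℂ} (ha : IsSchwartz a) : RapidDecay a := by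
  intro N
  obtain ⟨K, hK⟩ := summable_big_rpow (n := n) (q := q)
  obtain ⟨C, hC⟩ := ha (N + K)
  set c : ℝ := (Fintype.card (Fin q ⊕ Fin q) : ℝ) + 1
  have hc : 0 < c := by positivity
  have hC0 : 0 ≤ C := le_trans (by positivity) (hC 0)
  have hbig : ∀ l : Idx n q, big l ^ 2 ≤ c * (1 + ∑ j, eucl (l j) ^ 2) := by
    intro l
    have h1 := sq_sum_le_card_mul_sum_sq (s := (Finset.univ : Finset (Fin q ⊕ Fin q)))
      (f := fun j => eucl (l j))
    rw [Finset.card_univ] at h1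
    have h3 : 2 * ∑ j, eucl (l j) ≤
        (Fintype.card (Fin q ⊕ Fin q) : ℝ) + ∑ j, eucl (l j) ^ 2 := by
      have : ∑ j, 2 * eucl (l j) ≤ ∑ j : Fin q ⊕ Fin q, (1 + eucl (l j) ^ 2) :=
        Finset.sum_le_sum fun j _ => by nlinarith [sq_nonneg (eucl (l j) - 1)]
      rw [← Finset.mul_sum, Finset.sum_add_distrib] at this
      simpa using this
    simp only [big, c]
    nlinarith
  have hbd : ∀ l : Idx n q, ‖a l‖ * big l ^ (N + K) ≤ Real.sqrt (c ^ (N + K) * C) := by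
    intro l
    refine Real.le_sqrt_of_sq_le ?_
    calc (‖a l‖ * big l ^ (N + K)) ^ 2 = (big l ^ 2) ^ (N + K) * ‖a l‖ ^ 2 := by ring
      _ ≤ (c * (1 + ∑ j, eucl (l j) ^ 2)) ^ (N + K) * ‖a l‖ ^ 2 := by
        gcongr
        exact hbig l
      _ = c ^ (N + K) * ((1 + ∑ j, eucl (l j) ^ 2) ^ (N + K) * ‖a l‖ ^ 2) := by
        rw [mul_pow, mul_assoc]
      _ ≤ c ^ (N + K) * C := by
        gcongr
        exact hC l
  refine .of_nonneg_of_le (fun l => ?_) (fun l => ?_)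
    (hK.mul_left (Real.sqrt (c ^ (N + K) * C)))
  · have := big_pos l
    positivity
  · have hp := pow_pos (big_pos l) K
    rw [← div_eq_mul_inv, le_div_iff₀ hp, mul_assoc, ← pow_add]
    exact hbd l

lemma RapidDecay.mul_of_le {b : Idx n q → ℂ} (hb : RapidDecay b) {w : Idx n q → ℂ} {C : ℝ}
    {M : ℕ} (hw : ∀ l, ‖w l‖ ≤ C * big l ^ M) : RapidDecay fun l => b l * w l := by
  intro N
  refine .of_nonneg_of_le (fun l => ?_) (fun l => ?_) ((hb (N + M)).mul_left C)
  · have := big_pos l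
    positivity
  · have hp := pow_pos (big_pos l) N
    rw [norm_mul]
    calc ‖b l‖ * ‖w l‖ * big l ^ N ≤ ‖b l‖ * (C * big l ^ M) * big l ^ N := by
          gcongr
          exact hw l
      _ = C * (‖b l‖ * big l ^ (N + M)) := by ring

/-- The angle `Θ (l_1 + ⋯ + l_q)`. -/
def angle (Θ : Matrix (Fin n) (Fin n) ℝ) (l : Idx n q) : Fin n → ℝ :=
  Θ.mulVec fun j => (firstSum l j : ℝ)

lemma angle_of_firstSum_eq_zero (Θ : Matrix (Fin n) (Fin n) ℝ) {l : Idx n q}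
    (hl : firstSum l = 0) : angle Θ l = 0 := by
  ext i
  simp [angle, hl, Matrix.mulVec, dotProduct]

lemma phase_zero (k : Fin n → ℤ) : phase 0 k = 1 := by simp [phase]

/-- The distance to the nearest integer is at most a quarter of a chord of the circle, by the
concavity of the sine on `[0, π / 2]`. -/
lemma four_mul_abs_sub_round_le (x : ℝ) :
    4 * |x - round x| ≤ ‖1 - Complex.exp (Complex.I * ((2 * Real.pi * x : ℝ) : ℂ))‖ := by
  set y := x - round x with hy
  have hy2 : |y| ≤ 1 / 2 := abs_sub_round x
  have h1 : Complex.exp (Complex.I * ((2 * Real.pi * x : ℝ) : ℂ)) =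
      Complex.exp (Complex.I * ((2 * Real.pi * y : ℝ) : ℂ)) := by
    rw [Complex.exp_eq_exp_iff_exists_int]
    refine ⟨round x, ?_⟩
    rw [hy]
    push_cast
    ring
  rw [h1, norm_sub_rev, Complex.norm_exp_I_mul_ofReal_sub_one, norm_mul, Real.norm_eq_abs,
    Real.norm_eq_abs, abs_of_pos (by norm_num : (0 : ℝ) < 2)]
  have hpi := Real.pi_pos
  have h2 : |2 * Real.pi * y / 2| ≤ Real.pi / 2 := by
    rw [show 2 * Real.pi * y / 2 = Real.pi * y by ring, abs_mul, abs_of_pos hpi]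
    nlinarith
  have h3 := Real.mul_abs_le_abs_sin h2
  rw [show 2 * Real.pi * y / 2 = Real.pi * y by ring, abs_mul, abs_of_pos hpi] at h3
  rw [show 2 * Real.pi * y / 2 = Real.pi * y by ring]
  have h4 : 2 / Real.pi * (Real.pi * |y|) = 2 * |y| := by field_simp
  rw [h4] at h3
  linarith

/-- The Diophantine condition bounds the inverses of `1 - phase (angle Θ l) u` polynomially. -/
lemma exists_phase_bound {Θ : Matrix (Fin n) (Fin n) ℝ}
    (hΘ : IsDiophantineMatrix ((1 / (2 * Real.pi)) • Θ)) :
    ∃ (u : Fin n → ℤ) (C : ℝ) (M : ℕ), 0 ≤ C ∧ ∀ l : Idx n q, firstSum l ≠ 0 →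
      phase (angle Θ l) u ≠ 1 ∧ ‖1 - phase (angle Θ l) u‖⁻¹ ≤ C * big l ^ M := by
  obtain ⟨u, δ, hδ, c, hc, h⟩ := hΘ
  obtain ⟨M, hM⟩ := exists_nat_gt δ
  refine ⟨u, (4 * c)⁻¹, M, by positivity, fun l hl => ?_⟩
  set x : ℝ := ∑ i, (firstSum l i : ℝ) *
    (((1 / (2 * Real.pi)) • Θ).transpose.mulVec fun i => (u i : ℝ)) i with hx
  have hph : phase (angle Θ l) u = Complex.exp (Complex.I * ((2 * Real.pi * x : ℝ) : ℂ)) := by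
    rw [phase]
    congr 3
    have hpi := Real.pi_ne_zero
    simp only [hx, angle, Matrix.mulVec, dotProduct, Matrix.transpose_apply, Matrix.smul_apply,
      smul_eq_mul, Finset.mul_sum]
    rw [Finset.sum_comm]
    refine Finset.sum_congr rfl fun i _ => Finset.sum_congr rfl fun j _ => ?_
    field_simp
  have hv : 0 < eucl (firstSum l) := eucl_pos hl
  have hlow : 4 * c * eucl (firstSum l) ^ (-δ) ≤ ‖1 - phase (angle Θ l) u‖ := by
    rw [hph]
    refine le_trans ?_ (four_mul_abs_sub_round_le x)
    have := h (firstSum l) hl (round x)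
    linarith
  have hpos : 0 < 4 * c * eucl (firstSum l) ^ (-δ) := by positivity
  refine ⟨fun h1 => ?_, ?_⟩
  · rw [h1, sub_self, norm_zero] at hlow
    linarith
  · calc ‖1 - phase (angle Θ l) u‖⁻¹ ≤ (4 * c * eucl (firstSum l) ^ (-δ))⁻¹ :=
          inv_anti₀ hpos hlow
      _ = (4 * c)⁻¹ * eucl (firstSum l) ^ δ := by
          rw [mul_inv, Real.rpow_neg hv.le, inv_inv]
      _ ≤ (4 * c)⁻¹ * big l ^ M := by
          gcongr
          calc eucl (firstSum l) ^ δ ≤ big l ^ δ :=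
                Real.rpow_le_rpow hv.le (eucl_firstSum_le l) hδ.le
            _ ≤ big l ^ (M : ℝ) := Real.rpow_le_rpow_of_exponent_le (one_le_big l) hM.le
            _ = big l ^ M := Real.rpow_natCast _ _

lemma phaseSum_eq_tsum {ι : Type*} {b : ι → ℂ} {θ : ι → Fin n → ℝ}
    (hb : Summable fun i => ‖b i‖) {g : (Fin n → ℤ) → ℂ} (hg : Summable fun k => ‖g k‖) :
    phaseSum b θ g = ∑' i, b i * ∑' k, g k * phase (θ i) k := by
  rw [phaseSum, (summable_phaseSum hb hg fun _ => le_rfl).tsum_prod]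
  simp only [tsum_mul_left]

lemma phaseSum_split {ι : Type*} {b : ι → ℂ} {θ : ι → Fin n → ℝ}
    (hb : Summable fun i => ‖b i‖) {g : (Fin n → ℤ) → ℂ} (hg : Summable fun k => ‖g k‖)
    (s : Set ι) : phaseSum b θ g =
      phaseSum (fun i : s => b i) (fun i => θ i) g +
        phaseSum (fun i : (sᶜ : Set ι) => b i) (fun i => θ i) g := by
  have hsum : Summable fun i => b i * ∑' k, g k * phase (θ i) k := by
    have := (summable_phaseSum (θ := θ) hb hg fun _ => le_rfl).prod
    simpa only [tsum_mul_left] using this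
  have h1 := phaseSum_eq_tsum (b := fun i : s => b i) (θ := fun i => θ i) (hb.subtype s) hg
  have h2 := phaseSum_eq_tsum (b := fun i : (sᶜ : Set ι) => b i) (θ := fun i => θ i)
    (hb.subtype sᶜ) hg
  rw [phaseSum_eq_tsum hb hg, h1, h2]
  exact (hsum.tsum_subtype_add_tsum_subtype_compl s).symm

/-- The continuation of `∑ b_l k ^ β |k| ^ (-z) exp (i k · Θ (l_1 + ⋯ + l_q))`. Only the `l` with
`l_1 + ⋯ + l_q = 0` contribute to the pole. -/
theorem exists_continuation_weighted (hn : 1 ≤ n) {Θ : Matrix (Fin n) (Fin n) ℝ}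
    (hΘ : IsDiophantineMatrix ((1 / (2 * Real.pi)) • Θ)) {b : Idx n q → ℂ} (hb : RapidDecay b)
    (β : Fin n → ℕ) :
    ∃ G : ℂ → ℂ, Differentiable ℂ G ∧ ∀ z : ℂ, (n : ℝ) + (∑ t, β t : ℕ) < z.re →
      phaseSum b (angle Θ) (homTerm (monom β) z) =
        (∑' l : {l : Idx n q // firstSum l = 0}, b l.1) *
          ((∫ u : Metric.sphere (0 : EuclideanSpace ℝ (Fin n)) 1,
            ∏ t, (u : EuclideanSpace ℝ (Fin n)) t ^ β t
            ∂(volume : Measure (EuclideanSpace ℝ (Fin n))).toSphere : ℝ) : ℂ) /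
              (z - (n + (∑ t, β t : ℕ))) + G z := by
  obtain ⟨u, C, M, hC, hu⟩ := exists_phase_bound (q := q) hΘ
  set s : Set (Idx n q) := {l | firstSum l = 0}
  have hdec : ∀ N : ℕ, Summable fun i : (sᶜ : Set (Idx n q)) =>
      ‖b i‖ * ‖1 - phase (angle Θ (i : Idx n q)) u‖⁻¹ ^ N := by
    intro N
    refine .of_nonneg_of_le (fun i => by positivity) (fun i => ?_)
      (((hb (M * N)).mul_left (C ^ N)).subtype (sᶜ : Set (Idx n q)))
    simp only [Function.comp_apply]
    calc _ ≤ ‖b i‖ * (C * big (i : Idx n q) ^ M) ^ N := by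
          gcongr
          exact (hu i i.2).2
      _ = _ := by
          rw [mul_pow, ← pow_mul]
          ring
  obtain ⟨G₁, hG₁, hG₁'⟩ := exists_entire_nonresonant u
    (fun i : (sᶜ : Set (Idx n q)) => angle Θ (i : Idx n q)) (fun i => (hu i i.2).1)
    (isPolyFun_monom β) (fun i => b i) hdec
  obtain ⟨G₂, hG₂, hG₂'⟩ := exists_continuation_monom β hn
  refine ⟨fun z => (∑' l : s, b l) * G₂ z + G₁ z, (hG₂.const_mul _).add hG₁, fun z hz => ?_⟩
  have hs := summable_norm_homTerm (isPolyFun_monom β) hz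
  have hres := phaseSum_eq_tsum (b := fun i : s => b i) (θ := fun i => angle Θ (i : Idx n q))
    (hb.summable_norm.subtype s) hs
  rw [phaseSum_split hb.summable_norm hs s, hG₁' z hz, hres, ← add_assoc]
  congr 1
  have h0 : ∀ i : s, b i * ∑' k, homTerm (monom β) z k * phase (angle Θ (i : Idx n q)) k =
      b i * ∑' k, homTerm (monom β) z k := fun i => by
    rw [angle_of_firstSum_eq_zero Θ i.2]
    simp only [phase_zero, mul_one]
  simp only [h0]
  rw [tsum_mul_right, hG₂' z hz, mul_add, mul_div_assoc]
  rfl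

end Weights

/-! ### Expansion of the product of norms -/

/-- Taylor's formula for `√(1 + t)` on the whole domain `t ≥ -1`: for `|t| > 1 / 2` the powers of
`|t|` below the `R`-th are bounded by multiples of `|t| ^ R`. -/
lemma exists_sqrt_remainder {R : ℕ} (hR : 1 ≤ R) : ∃ C : ℝ, 0 ≤ C ∧ ∀ t : ℝ, -1 ≤ t →
    |Real.sqrt (1 + t) - ∑ a ∈ Finset.range R, Ring.choose (1 / 2 : ℝ) a * t ^ a| ≤
      C * |t| ^ R := by
  obtain ⟨C, hC, h⟩ := exists_binomial_remainder R 1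
  set c : ℝ := ∑ a ∈ Finset.range R, |Ring.choose (1 / 2 : ℝ) a|
  have hc : 0 ≤ c := Finset.sum_nonneg fun _ _ => abs_nonneg _
  refine ⟨C + (2 + c) * 2 ^ R, by positivity, fun t ht => ?_⟩
  rcases le_or_gt |t| (1 / 2) with ht2 | ht2
  · have h1 := h (1 / 2) (by norm_num) t ht2
    have e : ((1 + t : ℝ) : ℂ) ^ (1 / 2 : ℂ) -
        ∑ a ∈ Finset.range R, Ring.choose (1 / 2 : ℂ) a * (t : ℂ) ^ a =
        ((Real.sqrt (1 + t) - ∑ a ∈ Finset.range R, Ring.choose (1 / 2 : ℝ) a * t ^ a : ℝ) : ℂ) := by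
      rw [Real.sqrt_eq_rpow, Complex.ofReal_sub, Complex.ofReal_cpow (by linarith),
        Complex.ofReal_sum]
      simp only [Complex.ofReal_mul, Complex.ofReal_pow, Complex.ofReal_choose]
      norm_num
    rw [e, Complex.norm_real, Real.norm_eq_abs] at h1
    refine h1.trans (mul_le_mul_of_nonneg_right ?_ (by positivity))
    exact le_add_of_nonneg_right (by positivity)
  · have hpow : ∀ a ≤ R, |t| ^ a ≤ 2 ^ R * |t| ^ R := by
      intro a ha
      have h1 : (1 : ℝ) ≤ (2 * |t|) ^ (R - a) := one_le_pow₀ (by linarith)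
      calc |t| ^ a ≤ |t| ^ a * (2 * |t|) ^ (R - a) := le_mul_of_one_le_right (by positivity) h1
        _ = 2 ^ (R - a) * |t| ^ R := by
          rw [mul_pow, mul_left_comm, ← pow_add, Nat.add_sub_cancel' ha]
        _ ≤ 2 ^ R * |t| ^ R := by
          gcongr
          · norm_num
          · exact Nat.sub_le _ _
    have hs : Real.sqrt (1 + t) ≤ 1 + |t| := by
      refine Real.sqrt_le_iff.mpr ⟨by positivity, ?_⟩
      nlinarith [le_abs_self t, abs_nonneg t]
    have h0 := hpow 0 (Nat.zero_le _)
    have h1 := hpow 1 hR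
    rw [pow_zero] at h0
    rw [pow_one] at h1
    have hsum : |∑ a ∈ Finset.range R, Ring.choose (1 / 2 : ℝ) a * t ^ a| ≤
        c * (2 ^ R * |t| ^ R) := by
      refine (Finset.abs_sum_le_sum_abs _ _).trans ?_
      rw [Finset.sum_mul]
      refine Finset.sum_le_sum fun a ha => ?_
      rw [abs_mul, abs_pow]
      exact mul_le_mul_of_nonneg_left (hpow a (Finset.mem_range.mp ha).le) (abs_nonneg _)
    refine (abs_sub _ _).trans ?_
    rw [abs_of_nonneg (Real.sqrt_nonneg _)]
    have h2 : 0 ≤ C * |t| ^ R := by positivity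
    calc _ ≤ (1 + |t|) + c * (2 ^ R * |t| ^ R) := add_le_add hs hsum
      _ ≤ (C + (2 + c) * 2 ^ R) * |t| ^ R := by nlinarith

section Expansion

variable {n q : ℕ}

lemma tilde_apply {M : Type*} [AddCommMonoid M] (y : Fin q ⊕ Fin q → Fin n → M)
    (i : Fin (q - 1)) (t : Fin n) : tilde y i t = tilde (fun j => y j t) i := by
  simp [tilde, Finset.sum_apply]

lemma map_tilde {M M' F : Type*} [AddCommMonoid M] [AddCommMonoid M'] [FunLike F M M']
    [AddMonoidHomClass F M M'] (f : F) (y : Fin q ⊕ Fin q → M) (i : Fin (q - 1)) :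
    f (tilde y i) = tilde (fun j => f (y j)) i := by
  simp [tilde, map_sum, map_add]

lemma eucl_tilde_le (l : Idx n q) (i : Fin (q - 1)) : eucl (tilde l i) ≤ big l := by
  have h : ∑ j : Fin q with j.val ≤ i.val, (eucl (l (Sum.inl j)) + eucl (l (Sum.inr j))) ≤
      ∑ j : Fin q, (eucl (l (Sum.inl j)) + eucl (l (Sum.inr j))) :=
    Finset.sum_le_sum_of_subset_of_nonneg (Finset.subset_univ _) fun j _ _ =>
      add_nonneg (eucl_nonneg _) (eucl_nonneg _)
  have h2 := (eucl_sum_le _ _).trans ((Finset.sum_le_sum fun j _ => eucl_add_le _ _).trans h)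
  refine h2.trans ?_
  rw [Finset.sum_add_distrib, ← Fintype.sum_sum_type (fun j => eucl (l j)), big]
  linarith

/-- The number `|k + l̃_i|² - |k|² = 2 k · l̃_i + |l̃_i|²`. -/
def normIncr (l : Idx n q) (k : Fin n → ℤ) (i : Fin (q - 1)) : ℝ :=
  2 * ∑ t, (k t : ℝ) * tilde l i t + ∑ t, (tilde l i t : ℝ) ^ 2

lemma eucl_add_tilde_eq (l : Idx n q) {k : Fin n → ℤ} (hk : k ≠ 0) (i : Fin (q - 1)) :
    eucl (k + tilde l i) = eucl k * Real.sqrt (1 + normIncr l k i / eucl k ^ 2) := by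
  have hk0 := eucl_pos hk
  rw [← Real.sqrt_sq (eucl_nonneg (k + tilde l i)), eucl_add_sq, ← normIncr]
  have : eucl k ^ 2 + normIncr l k i = eucl k ^ 2 * (1 + normIncr l k i / eucl k ^ 2) := by
    field_simp
  rw [this, Real.sqrt_mul (sq_nonneg _), Real.sqrt_sq hk0.le]

lemma neg_one_le_normIncr_div (l : Idx n q) {k : Fin n → ℤ} (hk : k ≠ 0) (i : Fin (q - 1)) :
    -1 ≤ normIncr l k i / eucl k ^ 2 := by
  have hk0 := eucl_pos hk
  rw [le_div_iff₀ (by positivity)]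
  have := eucl_add_sq k (tilde l i)
  rw [← normIncr] at this
  nlinarith [sq_nonneg (eucl (k + tilde l i))]

lemma abs_normIncr_div_le (l : Idx n q) {k : Fin n → ℤ} (hk : k ≠ 0) (i : Fin (q - 1)) :
    |normIncr l k i / eucl k ^ 2| ≤ 3 * big l ^ 2 * (eucl k)⁻¹ := by
  have hk0 := eucl_pos hk
  have hk1 := one_le_eucl hk
  have hb := one_le_big l
  have ht := eucl_tilde_le l i
  have ht0 := eucl_nonneg (tilde l i)
  have h1 := abs_dot_le k (tilde l i)
  have h2 : |normIncr l k i| ≤ 2 * (eucl k * eucl (tilde l i)) + eucl (tilde l i) ^ 2 := by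
    rw [normIncr, ← eucl_sq]
    refine (abs_add_le _ _).trans ?_
    rw [abs_mul, abs_of_pos (by norm_num : (0 : ℝ) < 2),
      abs_of_nonneg (sq_nonneg (eucl (tilde l i)))]
    linarith
  rw [abs_div, abs_of_pos (by positivity : 0 < eucl k ^ 2), div_le_iff₀ (by positivity)]
  have h3 : 3 * big l ^ 2 * (eucl k)⁻¹ * eucl k ^ 2 = 3 * big l ^ 2 * eucl k := by field_simp
  rw [h3]
  have h4 : eucl k * eucl (tilde l i) ≤ eucl k * big l ^ 2 := by
    refine mul_le_mul_of_nonneg_left (ht.trans ?_) hk0.le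
    nlinarith
  have h5 : eucl (tilde l i) ^ 2 ≤ big l ^ 2 := pow_le_pow_left₀ ht0 ht 2
  have h6 : big l ^ 2 ≤ big l ^ 2 * eucl k := le_mul_of_one_le_right (sq_nonneg _) hk1
  linarith

variable (p : Fin (q - 1) → ℕ)

/-- The multi-indices with all entries below `R`. -/
def boxIdx (R : ℕ) : Finset (MultiIdx p) :=
  Fintype.piFinset fun _ => Fintype.piFinset fun _ => Finset.range R

variable {p}

lemma mem_boxIdx {R : ℕ} {α : MultiIdx p} : α ∈ boxIdx p R ↔ ∀ i j, α i j < R := by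
  simp [boxIdx]

lemma le_size (α : MultiIdx p) (i : Fin (q - 1)) (j : Fin (p i)) : α i j ≤ α.size :=
  (Finset.single_le_sum (f := fun j => α i j) (fun _ _ => Nat.zero_le _)
    (Finset.mem_univ j)).trans
    (Finset.single_le_sum (f := fun i => ∑ j, α i j) (fun _ _ => Nat.zero_le _)
      (Finset.mem_univ i))

/-- The value of `P_α` at `X = k`, `Y = l`. -/
def valP (α : MultiIdx p) (l : Idx n q) (k : Fin n → ℤ) : ℝ :=
  ∏ i, ∏ j, normIncr l k i ^ α i j

variable (p)

/-- The sum of the terms of the expansion of `∏ i, |k + l̃_i| ^ p_i` with index in the box of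
size `R`. -/
def mainPart (R : ℕ) (l : Idx n q) (k : Fin n → ℤ) : ℝ :=
  ∑ α ∈ boxIdx p R, α.binom * valP α l k * (eucl k ^ (∑ i, p i) / eucl k ^ (2 * α.size))

lemma mainPart_eq (R : ℕ) (l : Idx n q) (k : Fin n → ℤ) :
    mainPart p R l k = eucl k ^ (∑ i, p i) * ∏ i, ∏ _j : Fin (p i),
      ∑ a ∈ Finset.range R, Ring.choose (1 / 2 : ℝ) a * (normIncr l k i / eucl k ^ 2) ^ a := by
  simp only [Finset.prod_univ_sum]
  rw [mainPart, Finset.mul_sum, boxIdx]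
  refine Finset.sum_congr rfl fun α _ => ?_
  simp only [MultiIdx.binom, valP, Finset.prod_mul_distrib, div_pow, Finset.prod_div_distrib]
  have : ∏ i, ∏ j, (eucl k ^ 2) ^ α i j = eucl k ^ (2 * α.size) := by
    simp only [Finset.prod_pow_eq_pow_sum, ← pow_mul, MultiIdx.size, Finset.mul_sum]
  rw [this]
  ring

/-- The expansion approximates the product of norms up to a power `|k| ^ (-R)`. -/
lemma exists_mainPart_bound {R : ℕ} (hR : 1 ≤ R) : ∃ (C : ℝ) (M : ℕ), 0 ≤ C ∧
    ∀ (l : Idx n q) (k : Fin n → ℤ), k ≠ 0 →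
      |∏ i, eucl (k + tilde l i) ^ p i - mainPart p R l k| ≤
        C * big l ^ M * (eucl k ^ (∑ i, p i) * (eucl k ^ R)⁻¹) := by
  obtain ⟨C, hC, h⟩ := exists_sqrt_remainder hR
  set J : Finset (Σ i : Fin (q - 1), Fin (p i)) := Finset.univ
  set K : ℝ := 4 + C * 3 ^ R
  have hK : 4 ≤ K := le_add_of_nonneg_right (by positivity)
  refine ⟨K ^ J.card * (J.card * (C * 3 ^ R)), 2 * R * J.card + 2 * R, by positivity,
    fun l k hk => ?_⟩
  have hk0 := eucl_pos hk
  have hk1 := one_le_eucl hk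
  have hb1 := one_le_big l
  have hb0 := big_pos l
  set τ : Fin (q - 1) → ℝ := fun i => normIncr l k i / eucl k ^ 2 with hτ
  set S : (Σ i : Fin (q - 1), Fin (p i)) → ℝ := fun x => Real.sqrt (1 + τ x.1) with hS
  set T : (Σ i : Fin (q - 1), Fin (p i)) → ℝ := fun x =>
    ∑ a ∈ Finset.range R, Ring.choose (1 / 2 : ℝ) a * τ x.1 ^ a with hT
  have hτ1 : ∀ i, |τ i| ^ R ≤ 3 ^ R * big l ^ (2 * R) * (eucl k ^ R)⁻¹ := fun i => by
    refine (pow_le_pow_left₀ (abs_nonneg _) (abs_normIncr_div_le l hk i) R).trans (le_of_eq ?_)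
    rw [mul_pow, mul_pow, inv_pow, ← pow_mul]
  have hτ2 : ∀ i, |τ i| ^ R ≤ 3 ^ R * big l ^ (2 * R) := fun i => by
    refine (hτ1 i).trans (mul_le_of_le_one_right (by positivity) ?_)
    exact inv_le_one_of_one_le₀ (one_le_pow₀ hk1)
  have hdiff : ∀ x, |S x - T x| ≤ C * |τ x.1| ^ R := fun x =>
    h _ (neg_one_le_normIncr_div l hk x.1)
  have hb2 : big l ^ 2 ≤ big l ^ (2 * R) := pow_le_pow_right₀ hb1 (by omega)
  have hSb : ∀ x, |S x| ≤ 4 * big l ^ (2 * R) := fun x => by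
    have h1 : |τ x.1| ≤ 3 * big l ^ 2 := (abs_normIncr_div_le l hk x.1).trans
      (mul_le_of_le_one_right (by positivity) (inv_le_one_of_one_le₀ hk1))
    have h2 : S x ≤ 1 + |τ x.1| := by
      refine Real.sqrt_le_iff.mpr ⟨by positivity, ?_⟩
      nlinarith [le_abs_self (τ x.1), abs_nonneg (τ x.1)]
    rw [abs_of_nonneg (Real.sqrt_nonneg _)]
    have h3 : 1 ≤ big l ^ 2 := one_le_pow₀ hb1
    linarith
  have hpos : 0 ≤ big l ^ (2 * R) := by positivity
  have hSK : ∀ x, |S x| ≤ K * big l ^ (2 * R) := fun x =>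
    (hSb x).trans (mul_le_mul_of_nonneg_right hK hpos)
  have hTK : ∀ x, |T x| ≤ K * big l ^ (2 * R) := fun x => by
    have h1 : |T x| ≤ |S x| + |S x - T x| := by
      have := abs_sub (S x) (S x - T x)
      rwa [sub_sub_cancel] at this
    have h2 := (hdiff x).trans (mul_le_mul_of_nonneg_left (hτ2 x.1) hC)
    have h3 := hSb x
    calc |T x| ≤ 4 * big l ^ (2 * R) + C * (3 ^ R * big l ^ (2 * R)) := by linarith
      _ = K * big l ^ (2 * R) := by
        simp only [K]
        ring
  have hB : 1 ≤ K * big l ^ (2 * R) := by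
    have : 1 ≤ big l ^ (2 * R) := one_le_pow₀ hb1
    nlinarith
  have hprod := norm_prod_sub_prod_le J S T hB (fun x _ => hSK x) (fun x _ => hTK x)
  have e1 : ∏ i, eucl (k + tilde l i) ^ p i = eucl k ^ (∑ i, p i) * ∏ x ∈ J, S x := by
    have : ∏ x ∈ J, S x = ∏ i, ∏ _j : Fin (p i), Real.sqrt (1 + τ i) :=
      Finset.prod_sigma _ _ _
    rw [this, ← Finset.prod_pow_eq_pow_sum, ← Finset.prod_mul_distrib]
    refine Finset.prod_congr rfl fun i _ => ?_
    rw [eucl_add_tilde_eq l hk i, mul_pow]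
    simp [hτ]
  have e2 : mainPart p R l k = eucl k ^ (∑ i, p i) * ∏ x ∈ J, T x := by
    have : ∏ x ∈ J, T x = ∏ i, ∏ _j : Fin (p i),
        ∑ a ∈ Finset.range R, Ring.choose (1 / 2 : ℝ) a * τ i ^ a := Finset.prod_sigma _ _ _
    rw [this, mainPart_eq]
  rw [e1, e2, ← mul_sub, abs_mul, abs_of_pos (by positivity : 0 < eucl k ^ (∑ i, p i)),
    mul_left_comm]
  refine mul_le_mul_of_nonneg_left ?_ (by positivity)
  refine hprod.trans ?_
  have hsum : ∑ x ∈ J, ‖S x - T x‖ ≤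
      J.card * (C * (3 ^ R * big l ^ (2 * R) * (eucl k ^ R)⁻¹)) := by
    rw [← nsmul_eq_mul]
    refine Finset.sum_le_card_nsmul _ _ _ fun x _ => ?_
    exact (hdiff x).trans (mul_le_mul_of_nonneg_left (hτ1 x.1) hC)
  refine (mul_le_mul_of_nonneg_left hsum (by positivity)).trans (le_of_eq ?_)
  rw [mul_pow, ← pow_mul, pow_add]
  ring

variable {p}

/-! ### Degrees of the coefficient polynomials -/

/-- The exponents of `f` have weight at most `D`, for an additive weight `w`. -/
def WeightLE (w : (Vars n q →₀ ℕ) →+ ℕ) (D : ℕ) (f : MvPolynomial (Vars n q) ℝ) : Prop :=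
  ∀ β ∈ f.support, w β ≤ D

namespace WeightLE

variable {w : (Vars n q →₀ ℕ) →+ ℕ} {D E : ℕ} {f g : MvPolynomial (Vars n q) ℝ}

lemma mono (h : WeightLE w D f) (hDE : D ≤ E) : WeightLE w E f := fun β hβ => (h β hβ).trans hDE

lemma add (hf : WeightLE w D f) (hg : WeightLE w D g) : WeightLE w D (f + g) := fun β hβ => by
  classical
  rcases Finset.mem_union.mp (MvPolynomial.support_add hβ) with h | h
  exacts [hf β h, hg β h]

lemma mul (hf : WeightLE w D f) (hg : WeightLE w E g) : WeightLE w (D + E) (f * g) :=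
    fun β hβ => by
  classical
  obtain ⟨a, ha, b, hb, rfl⟩ := Finset.mem_add.mp (MvPolynomial.support_mul f g hβ)
  rw [map_add]
  exact add_le_add (hf a ha) (hg b hb)

lemma C (c : ℝ) : WeightLE w 0 (MvPolynomial.C c) := fun β hβ => by
  have := Finset.mem_of_subset MvPolynomial.support_monomial_subset hβ
  rw [Finset.mem_singleton] at this
  simp [this]

lemma X (v : Vars n q) : WeightLE w (w (Finsupp.single v 1)) (MvPolynomial.X v) := fun β hβ => by
  rw [MvPolynomial.support_X, Finset.mem_singleton] at hβ
  rw [hβ]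

lemma sum {ι : Type*} (s : Finset ι) {f : ι → MvPolynomial (Vars n q) ℝ}
    (h : ∀ i ∈ s, WeightLE w D (f i)) : WeightLE w D (∑ i ∈ s, f i) := by
  classical
  induction s using Finset.induction_on with
  | empty => intro β hβ; simp at hβ
  | insert a s ha ih =>
    rw [Finset.sum_insert ha]
    exact (h a (by simp)).add (ih fun i hi => h i (by simp [hi]))

lemma prod {ι : Type*} (s : Finset ι) {f : ι → MvPolynomial (Vars n q) ℝ} {d : ι → ℕ}
    (h : ∀ i ∈ s, WeightLE w (d i) (f i)) : WeightLE w (∑ i ∈ s, d i) (∏ i ∈ s, f i) := by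
  classical
  induction s using Finset.induction_on with
  | empty => simpa using WeightLE.C (w := w) 1
  | insert a s ha ih =>
    rw [Finset.sum_insert ha, Finset.prod_insert ha]
    exact (h a (by simp)).mul (ih fun i hi => h i (by simp [hi]))

lemma pow (hf : WeightLE w D f) (m : ℕ) : WeightLE w (D * m) (f ^ m) := by
  simpa [mul_comm] using WeightLE.prod (Finset.range m) (f := fun _ => f) (d := fun _ => D)
    fun _ _ => hf

end WeightLE

/-- The degree in `X` as an additive map. -/
def degXHom : (Vars n q →₀ ℕ) →+ ℕ where
  toFun := degX
  map_zero' := by simp [degX]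
  map_add' := by simp [degX, Finset.sum_add_distrib]

/-- The degree in `Y` as an additive map. -/
def degYHom : (Vars n q →₀ ℕ) →+ ℕ where
  toFun := degY
  map_zero' := by simp [degY]
  map_add' := by simp [degY, Finset.sum_add_distrib]

lemma weightLE_polyP {w : (Vars n q →₀ ℕ) →+ ℕ} {e x y : ℕ}
    (hx : ∀ t, w (Finsupp.single (Sum.inl t) 1) ≤ x)
    (hy : ∀ v, w (Finsupp.single (Sum.inr v) 1) ≤ y) (hxy : x + y ≤ e) (hyy : y * 2 ≤ e)
    (α : MultiIdx p) : WeightLE w (e * α.size) (polyP n α) := by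
  have ht : ∀ i t, WeightLE w y (tilde (varY n q) i t) := fun i t => by
    rw [tilde_apply]
    exact WeightLE.sum _ fun j _ => ((WeightLE.X _).mono (hy _)).add ((WeightLE.X _).mono (hy _))
  have hfac : ∀ i, WeightLE w e (2 * (∑ t, varX n q t * tilde (varY n q) i t)
      + ∑ t, tilde (varY n q) i t ^ 2) := fun i => by
    refine .add ?_ ?_
    · have h2 := (WeightLE.C (w := w) 2).mul (WeightLE.sum Finset.univ fun t _ =>
        (((WeightLE.X (w := w) (Sum.inl t)).mono (hx t)).mul (ht i t)).mono hxy)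
      rw [zero_add] at h2
      exact h2
    · exact WeightLE.sum _ fun t _ => ((ht i t).pow 2).mono hyy
  have := WeightLE.prod Finset.univ (d := fun i => ∑ j, e * α i j) fun i _ =>
    WeightLE.prod Finset.univ (d := fun j => e * α i j) fun j _ => (hfac i).pow (α i j)
  simp only [← Finset.mul_sum] at this
  exact this

lemma rename_weights (Q : MvPolynomial (Fin n) ℝ) {β : Vars n q →₀ ℕ}
    (hβ : β ∈ (MvPolynomial.rename (Sum.inl : Fin n → Vars n q) Q).support) :
    degX β ≤ Q.totalDegree ∧ degY β ≤ 0 := by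
  classical
  obtain ⟨γ, rfl, hγ⟩ := MvPolynomial.coeff_rename_ne_zero _ _ _
    (MvPolynomial.mem_support_iff.mp hβ)
  constructor
  · have h : degX (Finsupp.mapDomain (Sum.inl : Fin n → Vars n q) γ) = γ.sum fun _ e => e := by
      rw [degX, Finsupp.sum_fintype _ _ fun _ => rfl]
      exact Finset.sum_congr rfl fun t _ => Finsupp.mapDomain_apply Sum.inl_injective _ _
    rw [h]
    exact MvPolynomial.le_totalDegree (MvPolynomial.mem_support_iff.mpr hγ)
  · rw [degY, Finset.sum_eq_zero]
    intro v _
    exact Finsupp.mapDomain_of_notMem_range _ _ (by simp)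

variable (Q : MvPolynomial (Fin n) ℝ)

/-- The polynomial `(1/2 choose α) P_α(X, Y) Q(X)`. -/
def fullPoly (α : MultiIdx p) : MvPolynomial (Vars n q) ℝ :=
  MvPolynomial.C α.binom * polyP n α * MvPolynomial.rename Sum.inl Q

lemma mem_setL_of_mem_support {α : MultiIdx p} {β : Vars n q →₀ ℕ}
    (hβ : β ∈ (fullPoly (n := n) Q α).support) : β ∈ setL Q α := by
  have hX : ∀ t : Fin n, degX (Finsupp.single (Sum.inl t : Vars n q) 1) ≤ 1 := fun t => by
    classical
    simp [degX, Finsupp.single_apply]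
  have hX' : ∀ v, degX (Finsupp.single (Sum.inr v : Vars n q) 1) ≤ 0 := fun v => by
    simp [degX]
  have hY : ∀ t : Fin n, degY (Finsupp.single (Sum.inl t : Vars n q) 1) ≤ 0 := fun t => by
    simp [degY]
  have hY' : ∀ v, degY (Finsupp.single (Sum.inr v : Vars n q) 1) ≤ 1 := fun v => by
    classical
    simp [degY, Finsupp.single_apply]
  have h1 := ((WeightLE.C (w := degYHom) α.binom).mul
    (weightLE_polyP (e := 2) (x := 0) (y := 1) hY hY' (by norm_num) (by norm_num) α)).mul
    (g := MvPolynomial.rename Sum.inl Q) (fun γ hγ => (rename_weights Q hγ).2) β hβ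
  have h2 := ((WeightLE.C (w := degXHom) α.binom).mul
    (weightLE_polyP (e := 1) (x := 1) (y := 0) hX hX' (by norm_num) (by norm_num) α)).mul
    (g := MvPolynomial.rename Sum.inl Q) (fun γ hγ => (rename_weights Q hγ).1) β hβ
  rw [zero_add, add_zero] at h1
  rw [zero_add, one_mul] at h2
  exact ⟨h1, h2⟩

/-- The monomial `l ^ β` in the variables `Y`. -/
def monomY (β : Vars n q →₀ ℕ) (l : Idx n q) : ℝ :=
  ∏ t : (Fin q ⊕ Fin q) × Fin n, (l t.1 t.2 : ℝ) ^ β (Sum.inr t)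

lemma abs_monomY_le (β : Vars n q →₀ ℕ) (l : Idx n q) : |monomY β l| ≤ big l ^ degY β := by
  rw [monomY, Finset.abs_prod, degY, ← Finset.prod_pow_eq_pow_sum]
  refine Finset.prod_le_prod (fun _ _ => abs_nonneg _) fun t _ => ?_
  rw [abs_pow]
  exact pow_le_pow_left₀ (abs_nonneg _) (abs_coord_le_big l t) _

/-- The expansion of the values of `fullPoly` into monomials. -/
lemma eval_fullPoly (α : MultiIdx p) (l : Idx n q) (k : Fin n → ℤ) :
    ((α.binom * valP α l k * MvPolynomial.eval (fun i => (k i : ℝ)) Q : ℝ) : ℂ) =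
      ∑ β ∈ (fullPoly (n := n) Q α).support,
        ((coeffC Q α β * monomY β l : ℝ) : ℂ) * monom (fun t => β (Sum.inl t)) k := by
  set x : Vars n q → ℝ := Sum.elim (fun t => (k t : ℝ)) fun v => (l v.1 v.2 : ℝ) with hx
  have htilde : ∀ i t, MvPolynomial.eval x (tilde (varY n q) i t) = (tilde l i t : ℝ) := by
    intro i t
    rw [tilde_apply, tilde_apply, map_tilde,
      show ((tilde (fun j => l j t) i : ℤ) : ℝ) =
        Int.castAddHom ℝ (tilde (fun j => l j t) i) from rfl,
      map_tilde]
    simp [varY, hx]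
  have h1 : MvPolynomial.eval x (polyP n α) = valP α l k := by
    simp only [polyP, valP, normIncr, map_prod, map_pow, map_add, map_mul, map_sum, htilde]
    simp [varX, hx]
  have h2 : MvPolynomial.eval x (MvPolynomial.rename Sum.inl Q) =
      MvPolynomial.eval (fun i => (k i : ℝ)) Q := by
    rw [MvPolynomial.eval_rename]
    rfl
  have h3 := MvPolynomial.eval_eq' x (fullPoly (n := n) Q α)
  rw [fullPoly, map_mul, map_mul, MvPolynomial.eval_C, h1, h2] at h3
  rw [h3, Complex.ofReal_sum]
  refine Finset.sum_congr rfl fun β _ => ?_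
  rw [Fintype.prod_sum_type, mul_comm (∏ t : Fin n, _), ← mul_assoc, Complex.ofReal_mul]
  congr 1
  simp [monom, hx]

lemma setI_finite (m : ℕ) : (setI (n := n) p Q m).Finite := by
  classical
  set K := 2 * m + Q.totalDegree
  refine ((boxIdx p (m + 1)).finite_toSet.prod
    (Set.finite_Icc 0 (Finsupp.equivFunOnFinite.symm fun _ : Vars n q => K))).subset ?_
  rintro ⟨α, β⟩ ⟨⟨hY, hX⟩, hm⟩
  simp only at hY hX hm
  have hα : α.size ≤ m := by omega
  refine ⟨mem_boxIdx.mpr fun i j => Nat.lt_succ_of_le ((le_size α i j).trans hα),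
    ⟨fun _ => Nat.zero_le _, ?_⟩⟩
  rintro (t | v)
  · have := Finset.single_le_sum (f := fun t : Fin n => β (Sum.inl t)) (fun _ _ => Nat.zero_le _)
      (Finset.mem_univ t)
    simp only [Finsupp.equivFunOnFinite_symm_apply_apply]
    change β (Sum.inl t) ≤ degX β at this
    omega
  · have := Finset.single_le_sum (f := fun v => β (Sum.inr v)) (fun _ _ => Nat.zero_le _)
      (Finset.mem_univ v)
    simp only [Finsupp.equivFunOnFinite_symm_apply_apply]
    change β (Sum.inr v) ≤ degY β at this
    omega

end Expansion

section Assembly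

variable {n q : ℕ}

/-! ### Sums over indices and lattice vectors -/

/-- The sum of `a_l g_l(k) |k| ^ (-s) exp (i k · Θ (l_1 + ⋯ + l_q))` over all `l` and all
`k ≠ 0`. -/
def weightedSum (a : Idx n q → ℂ) (Θ : Matrix (Fin n) (Fin n) ℝ)
    (g : Idx n q → (Fin n → ℤ) → ℂ) (s : ℂ) : ℂ :=
  ∑' x : Idx n q × (Fin n → ℤ), a x.1 * (homTerm (g x.1) s x.2 * phase (angle Θ x.1) x.2)

variable {a : Idx n q → ℂ} {Θ : Matrix (Fin n) (Fin n) ℝ} {g : Idx n q → (Fin n → ℤ) → ℂ}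
  {C E : ℝ} {M : ℕ}

lemma norm_weightedTerm_le (hC : 0 ≤ C)
    (hg : ∀ l k, k ≠ 0 → ‖g l k‖ ≤ C * big l ^ M * jap k ^ E)
    {σ : ℝ} {s : ℂ} (hs : σ ≤ s.re) (x : Idx n q × (Fin n → ℤ)) :
    ‖a x.1 * (homTerm (g x.1) s x.2 * phase (angle Θ x.1) x.2)‖ ≤
      (‖a x.1‖ * big x.1 ^ M) * (C * jap x.2 ^ (-(σ - E))) := by
  obtain ⟨l, k⟩ := x
  have hj := jap_pos k
  have hb := big_pos l
  have key : ‖homTerm (g l) s k‖ ≤ big l ^ M * (C * jap k ^ (-(σ - E))) := by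
    by_cases hk : k = 0
    · subst hk
      rw [homTerm_zero, norm_zero]
      positivity
    · refine (norm_homTerm_le _ _ _).trans ?_
      calc ‖g l k‖ * jap k ^ (-s.re) ≤ (C * big l ^ M * jap k ^ E) * jap k ^ (-σ) := by
            gcongr
            · exact hg l k hk
            · exact one_le_jap k
        _ = big l ^ M * (C * (jap k ^ E * jap k ^ (-σ))) := by ring
        _ = _ := by
            rw [← Real.rpow_add hj]
            congr 4
            ring
  rw [norm_mul, norm_mul, norm_phase, mul_one, mul_assoc]
  exact mul_le_mul_of_nonneg_left key (norm_nonneg _)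

lemma summable_weightedBound (ha : RapidDecay a) (hC : 0 ≤ C) {σ : ℝ} (hσ : (n : ℝ) + E < σ) :
    Summable fun x : Idx n q × (Fin n → ℤ) =>
      (‖a x.1‖ * big x.1 ^ M) * (C * jap x.2 ^ (-(σ - E))) :=
  (ha M).mul_of_nonneg ((summable_jap_rpow (by linarith)).mul_left C)
    (fun l => by have := big_pos l; positivity) (fun k => by have := jap_pos k; positivity)

lemma summable_weightedTerm (ha : RapidDecay a) (hC : 0 ≤ C)
    (hg : ∀ l k, k ≠ 0 → ‖g l k‖ ≤ C * big l ^ M * jap k ^ E) {s : ℂ} (hs : (n : ℝ) + E < s.re) :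
    Summable fun x : Idx n q × (Fin n → ℤ) =>
      a x.1 * (homTerm (g x.1) s x.2 * phase (angle Θ x.1) x.2) :=
  .of_norm_bounded (summable_weightedBound ha hC hs) (norm_weightedTerm_le hC hg le_rfl)

lemma differentiableOn_weightedSum (ha : RapidDecay a) (hC : 0 ≤ C)
    (hg : ∀ l k, k ≠ 0 → ‖g l k‖ ≤ C * big l ^ M * jap k ^ E) :
    DifferentiableOn ℂ (weightedSum a Θ g) {s | (n : ℝ) + E < s.re} := by
  intro s hs
  obtain ⟨σ, hσ₁, hσ₂⟩ := exists_between (show (n : ℝ) + E < s.re from hs)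
  have h := Complex.differentiableOn_tsum_of_summable_norm
    (F := fun (x : Idx n q × (Fin n → ℤ)) s =>
      a x.1 * (homTerm (g x.1) s x.2 * phase (angle Θ x.1) x.2))
    (summable_weightedBound (M := M) ha hC hσ₁)
    (fun x => (((differentiable_homTerm (g x.1) x.2).mul_const _).const_mul _).differentiableOn)
    (isOpen_re_gt σ) (fun x z hz => norm_weightedTerm_le hC hg (le_of_lt hz) x)
  exact (h.differentiableAt ((isOpen_re_gt σ).mem_nhds hσ₂)).differentiableWithinAt

lemma isPolyFun_eval (Q : MvPolynomial (Fin n) ℝ) :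
    IsPolyFun Q.totalDegree
      fun k : Fin n → ℤ => ((MvPolynomial.eval (fun i => (k i : ℝ)) Q : ℝ) : ℂ) := by
  have h := IsPolyFun.sum Q.support (D := Q.totalDegree)
    (f := fun γ k => ((MvPolynomial.coeff γ Q : ℝ) : ℂ) * monom (fun t => γ t) k) fun γ hγ => by
      refine ((isPolyFun_monom fun t => γ t).mono ?_).const_mul _
      have := MvPolynomial.le_totalDegree hγ
      rwa [Finsupp.sum_fintype _ _ fun _ => rfl] at this
  convert h using 2 with k
  rw [MvPolynomial.eval_eq', Complex.ofReal_sum]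
  refine Finset.sum_congr rfl fun γ _ => ?_
  simp [monom]

variable (p : Fin (q - 1) → ℕ) (Q : MvPolynomial (Fin n) ℝ)

/-- The function `∏ i, |k + l̃_i| ^ p_i * Q(k)`. -/
def fullFun (l : Idx n q) (k : Fin n → ℤ) : ℂ :=
  ((∏ i, eucl (k + tilde l i) ^ p i : ℝ) : ℂ) *
    ((MvPolynomial.eval (fun i => (k i : ℝ)) Q : ℝ) : ℂ)

/-- The difference of `∏ i, |k + l̃_i| ^ p_i * Q(k)` and its expansion. -/
def remFun (R : ℕ) (l : Idx n q) (k : Fin n → ℤ) : ℂ :=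
  ((∏ i, eucl (k + tilde l i) ^ p i - mainPart p R l k : ℝ) : ℂ) *
    ((MvPolynomial.eval (fun i => (k i : ℝ)) Q : ℝ) : ℂ)

lemma exists_fullFun_bound : ∃ (C : ℝ) (M : ℕ), 0 ≤ C ∧ ∀ (l : Idx n q) k, k ≠ 0 →
    ‖fullFun p Q l k‖ ≤ C * big l ^ M * jap k ^ ((Q.totalDegree : ℝ) + (∑ i, p i : ℕ)) := by
  obtain ⟨C, hC, h⟩ := (isPolyFun_eval Q).exists_bound
  refine ⟨2 ^ (∑ i, p i) * C, ∑ i, p i, by positivity, fun l k _ => ?_⟩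
  have hj := jap_pos k
  have hb := big_pos l
  have h1 : ∏ i, eucl (k + tilde l i) ^ p i ≤ (2 * big l * jap k) ^ (∑ i, p i) := by
    rw [← Finset.prod_pow_eq_pow_sum]
    refine Finset.prod_le_prod (fun i _ => pow_nonneg (eucl_nonneg _) _) fun i _ => ?_
    refine pow_le_pow_left₀ (eucl_nonneg _) ?_ _
    refine (eucl_le_jap _).trans ((jap_add_le _ _).trans ?_)
    have : jap (tilde l i) ≤ big l := max_le (one_le_big l) (eucl_tilde_le l i)
    gcongr
  rw [fullFun, norm_mul, Complex.norm_real, Real.norm_of_nonneg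
    (Finset.prod_nonneg fun i _ => pow_nonneg (eucl_nonneg _) _), ← Nat.cast_add,
    Real.rpow_natCast]
  calc _ ≤ (2 * big l * jap k) ^ (∑ i, p i) * (C * jap k ^ Q.totalDegree) :=
        mul_le_mul h1 (h k) (norm_nonneg _) (by positivity)
    _ = _ := by
        rw [mul_pow, mul_pow, pow_add]
        ring

lemma exists_remFun_bound {R : ℕ} (hR : 1 ≤ R) : ∃ (C : ℝ) (M : ℕ), 0 ≤ C ∧
    ∀ (l : Idx n q) k, k ≠ 0 → ‖remFun p Q R l k‖ ≤
      C * big l ^ M * jap k ^ ((Q.totalDegree : ℝ) + (∑ i, p i : ℕ) - R) := by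
  obtain ⟨C, hC, h⟩ := (isPolyFun_eval Q).exists_bound
  obtain ⟨C', M, hC', h'⟩ := exists_mainPart_bound (n := n) p hR
  refine ⟨C' * C, M, by positivity, fun l k hk => ?_⟩
  have hj := jap_pos k
  have hb := big_pos l
  have h1 := h' l k hk
  rw [← jap_eq hk] at h1
  rw [remFun, norm_mul, Complex.norm_real, Real.norm_eq_abs, ← Nat.cast_add,
    Real.rpow_sub_natCast hj.ne', Real.rpow_natCast, pow_add]
  calc _ ≤ (C' * big l ^ M * (jap k ^ (∑ i, p i) * (jap k ^ R)⁻¹)) *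
        (C * jap k ^ Q.totalDegree) := mul_le_mul h1 (h k) (norm_nonneg _) (by positivity)
    _ = _ := by
        rw [div_eq_mul_inv]
        ring

variable (Θ)

lemma zetaTerm_eq (l : Idx n q) {k : Fin n → ℤ} (hk : k ≠ 0) (s : ℂ) :
    zetaTerm p Q Θ l k s = homTerm (fullFun p Q l) s k * phase (angle Θ l) k := by
  rw [homTerm_of_ne _ _ hk, zetaTerm, phase, fullFun]
  simp only [angle]
  ring

variable {Θ}

lemma summable_zetaTerm (ha : RapidDecay a) {s : ℂ}
    (hs : ((n + Q.totalDegree + ∑ i, p i : ℕ) : ℝ) < s.re) :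
    Summable fun x : Idx n q × {k : Fin n → ℤ // k ≠ 0} =>
      a x.1 * zetaTerm p Q Θ x.1 x.2.1 s := by
  obtain ⟨C, M, hC, h⟩ := exists_fullFun_bound p Q
  have h1 := summable_weightedTerm (Θ := Θ) ha hC h (s := s)
    (by push_cast at hs ⊢; linarith)
  have hinj : Function.Injective fun x : Idx n q × {k : Fin n → ℤ // k ≠ 0} =>
      ((x.1, x.2.1) : Idx n q × (Fin n → ℤ)) := by
    rintro ⟨l, k⟩ ⟨l', k'⟩ h
    simpa [Subtype.ext_iff] using h
  refine (h1.comp_injective hinj).congr fun x => ?_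
  rw [zetaTerm_eq Θ p Q x.1 x.2.2]
  rfl

lemma zetaSeries_eq (ha : RapidDecay a) {s : ℂ}
    (hs : ((n + Q.totalDegree + ∑ i, p i : ℕ) : ℝ) < s.re) :
    zetaSeries a p Q Θ s = weightedSum a Θ (fullFun p Q) s := by
  obtain ⟨C, M, hC, h⟩ := exists_fullFun_bound p Q
  have h1 := summable_weightedTerm (Θ := Θ) ha hC h (s := s)
    (by push_cast at hs ⊢; linarith)
  rw [weightedSum, h1.tsum_prod, zetaSeries]
  refine tsum_congr fun l => ?_
  simp only [tsum_mul_left]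
  congr 1
  have hsupp : Function.support (fun k => homTerm (fullFun p Q l) s k * phase (angle Θ l) k) ⊆
      {k | k ≠ 0} := by
    intro k hk hk0
    apply hk
    simp only [hk0, homTerm_zero, zero_mul]
  rw [← tsum_subtype_eq_of_support_subset hsupp]
  exact tsum_congr fun k => zetaTerm_eq Θ p Q l k.2 s

/-! ### The terms of the expansion -/

/-- The pairs `(α, β)` of indices of the expansion with `α` in the box of size `R`. -/
def pairs (R : ℕ) : Finset (Σ _ : MultiIdx p, Vars n q →₀ ℕ) :=
  (boxIdx p R).sigma fun α => (fullPoly (n := n) Q α).support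

/-- The number `2 |α|₁ - d_β + d`; the term with index `(α, β)` contributes to the pole with this
number. -/
def poleIdx (x : Σ _ : MultiIdx p, Vars n q →₀ ℕ) : ℕ := 2 * x.1.size + Q.totalDegree - degX x.2

variable {p}

lemma expansion_eq (R : ℕ) (l : Idx n q) (k : Fin n → ℤ) (s : ℂ) :
    homTerm (fullFun p Q l) s k =
      ∑ x ∈ pairs p Q R, ((coeffM Q x.1 x.2 l : ℝ) : ℂ) *
        homTerm (monom fun t => x.2 (Sum.inl t)) (s + 2 * x.1.size - (∑ i, p i : ℕ)) k +
      homTerm (remFun p Q R l) s k := by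
  by_cases hk : k = 0
  · simp [hk, homTerm_zero]
  have hk0 : (eucl k : ℂ) ≠ 0 := by exact_mod_cast (eucl_pos hk).ne'
  have hcpow : ∀ α : MultiIdx p, (eucl k : ℂ) ^ (-(s + 2 * α.size - (∑ i, p i : ℕ))) =
      ((eucl k ^ (∑ i, p i) / eucl k ^ (2 * α.size) : ℝ) : ℂ) * (eucl k : ℂ) ^ (-s) := fun α => by
    have e : -(s + 2 * α.size - (∑ i, p i : ℕ)) =
        ((∑ i, p i : ℕ) : ℂ) - ((2 * α.size : ℕ) : ℂ) + -s := by
      push_cast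
      ring
    rw [e, Complex.cpow_add _ _ hk0, Complex.cpow_sub _ _ hk0, Complex.cpow_natCast,
      Complex.cpow_natCast]
    push_cast
    rfl
  have hmain : ∑ x ∈ pairs p Q R, ((coeffM Q x.1 x.2 l : ℝ) : ℂ) *
        homTerm (monom fun t => x.2 (Sum.inl t)) (s + 2 * x.1.size - (∑ i, p i : ℕ)) k =
      ((mainPart p R l k : ℝ) : ℂ) * ((MvPolynomial.eval (fun i => (k i : ℝ)) Q : ℝ) : ℂ) *
        (eucl k : ℂ) ^ (-s) := by
    rw [pairs, Finset.sum_sigma, mainPart, Complex.ofReal_sum, Finset.sum_mul, Finset.sum_mul]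
    refine Finset.sum_congr rfl fun α _ => ?_
    have h := eval_fullPoly Q α l k
    calc _ = (∑ β ∈ (fullPoly (n := n) Q α).support, ((coeffC Q α β * monomY β l : ℝ) : ℂ) *
          monom (fun t => β (Sum.inl t)) k) *
          (((eucl k ^ (∑ i, p i) / eucl k ^ (2 * α.size) : ℝ) : ℂ) * (eucl k : ℂ) ^ (-s)) := by
          rw [Finset.sum_mul]
          refine Finset.sum_congr rfl fun β _ => ?_
          rw [homTerm_of_ne _ _ hk, hcpow, coeffM, ← monomY]
          ring
      _ = _ := by
          rw [← h]
          push_cast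
          ring
  rw [hmain, homTerm_of_ne _ _ hk, homTerm_of_ne _ _ hk, fullFun, remFun]
  push_cast
  ring

lemma degX_le_of_mem_pairs {R : ℕ} {x : Σ _ : MultiIdx p, Vars n q →₀ ℕ}
    (hx : x ∈ pairs p Q R) : degX x.2 ≤ x.1.size + Q.totalDegree :=
  (mem_setL_of_mem_support Q (Finset.mem_sigma.mp hx).2).2

lemma rapidDecay_coeffM (ha : RapidDecay a) (x : Σ _ : MultiIdx p, Vars n q →₀ ℕ) :
    RapidDecay fun l => a l * ((coeffM Q x.1 x.2 l : ℝ) : ℂ) := by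
  refine ha.mul_of_le (C := |coeffC Q x.1 x.2|) (M := degY x.2) fun l => ?_
  rw [Complex.norm_real, Real.norm_eq_abs, coeffM, ← monomY, abs_mul]
  exact mul_le_mul_of_nonneg_left (abs_monomY_le _ _) (abs_nonneg _)

lemma weightedSum_fullFun_eq (ha : RapidDecay a) {R : ℕ} (hR : 1 ≤ R) {s : ℂ}
    (hs : ((n + Q.totalDegree + ∑ i, p i : ℕ) : ℝ) < s.re) :
    weightedSum a Θ (fullFun p Q) s =
      ∑ x ∈ pairs p Q R, phaseSum (fun l => a l * ((coeffM Q x.1 x.2 l : ℝ) : ℂ)) (angle Θ)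
        (homTerm (monom fun t => x.2 (Sum.inl t)) (s + 2 * x.1.size - (∑ i, p i : ℕ))) +
      weightedSum a Θ (remFun p Q R) s := by
  obtain ⟨C, M, hC, h⟩ := exists_remFun_bound (n := n) p Q hR
  have hrem := summable_weightedTerm (Θ := Θ) ha hC h (s := s) (by
    have : (0 : ℝ) ≤ R := Nat.cast_nonneg R
    push_cast at hs ⊢
    linarith)
  have hterm : ∀ x ∈ pairs p Q R, HasSum (fun y : Idx n q × (Fin n → ℤ) =>
      (a y.1 * ((coeffM Q x.1 x.2 y.1 : ℝ) : ℂ)) *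
        (homTerm (monom fun t => x.2 (Sum.inl t)) (s + 2 * x.1.size - (∑ i, p i : ℕ)) y.2 *
          phase (angle Θ y.1) y.2))
      (phaseSum (fun l => a l * ((coeffM Q x.1 x.2 l : ℝ) : ℂ)) (angle Θ)
        (homTerm (monom fun t => x.2 (Sum.inl t)) (s + 2 * x.1.size - (∑ i, p i : ℕ)))) := by
    intro x hx
    refine (summable_phaseSum (rapidDecay_coeffM Q ha x).summable_norm
      (summable_norm_homTerm (isPolyFun_monom _) ?_) fun _ => le_rfl).hasSum
    have h1 := degX_le_of_mem_pairs Q hx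
    have h2 : ((∑ t : Fin n, x.2 (Sum.inl t) : ℕ) : ℝ) ≤ x.1.size + Q.totalDegree := by
      exact_mod_cast h1
    have h3 : (0 : ℝ) ≤ x.1.size := Nat.cast_nonneg _
    have h4 : (s + 2 * (x.1.size : ℂ) - ((∑ i, p i : ℕ) : ℂ)).re =
        s.re + 2 * x.1.size - (∑ i, p i : ℕ) := by simp
    rw [h4]
    push_cast at hs h2 ⊢
    linarith
  have := (hasSum_sum hterm).add hrem.hasSum
  refine Eq.trans (tsum_congr fun y => ?_) this.tsum_eq
  rw [expansion_eq Q R, add_mul, mul_add, Finset.sum_mul, Finset.mul_sum]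
  congr 1
  exact Finset.sum_congr rfl fun x _ => by ring

/-! ### The residues -/

lemma finsum_setI_eq {R m : ℕ} (hm : m < R) (l : Idx n q) :
    ∑ᶠ x ∈ setI (n := n) p Q m, coeffM Q x.1 x.2 l * sphereIntegral x.2 =
      ∑ x ∈ pairs p Q R with poleIdx p Q x = m,
        coeffM Q x.1 x.2 l * sphereIntegral x.2 := by
  classical
  let e := (Equiv.sigmaEquivProd (MultiIdx p) (Vars n q →₀ ℕ)).toEmbedding
  have h := finsum_mem_eq_sum_of_inter_support_eq
    (fun x : MultiIdx p × (Vars n q →₀ ℕ) => coeffM Q x.1 x.2 l * sphereIntegral x.2)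
    (s := setI (n := n) p Q m)
    (t := ({x ∈ pairs p Q R | poleIdx p Q x = m} : Finset _).map e) (by
      ext ⟨α, β⟩
      simp only [Set.mem_inter_iff, Function.mem_support, Finset.coe_map, Set.mem_image,
        Finset.mem_coe, Finset.mem_filter]
      refine and_congr_left fun hne => ?_
      have hc : β ∈ (fullPoly (n := n) Q α).support := by
        rw [MvPolynomial.mem_support_iff]
        intro h0
        apply hne
        have : coeffC Q α β = 0 := h0
        simp [coeffM, this]
      have hL := mem_setL_of_mem_support Q hc
      have hX : degX β ≤ α.size + Q.totalDegree := hL.2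
      constructor
      · rintro ⟨-, hm'⟩
        simp only at hm'
        refine ⟨⟨α, β⟩, ⟨Finset.mem_sigma.mpr ⟨mem_boxIdx.mpr fun i j => ?_, hc⟩, ?_⟩, rfl⟩
        · have := le_size α i j
          change α i j < R
          omega
        · simp only [poleIdx]
          omega
      · rintro ⟨⟨α', β'⟩, ⟨-, hm'⟩, heq⟩
        obtain ⟨rfl, rfl⟩ : α' = α ∧ β' = β := by simpa [e] using heq
        refine ⟨hL, ?_⟩
        simp only [poleIdx] at hm' ⊢
        omega)
  rw [h, Finset.sum_map]
  rfl

/-- The contribution of the pair `(α, β)` to a residue. -/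
def pairResidue (a : Idx n q → ℂ) (x : Σ _ : MultiIdx p, Vars n q →₀ ℕ) : ℂ :=
  (∑' l : {l : Idx n q // firstSum l = 0}, a l.1 * ((coeffM Q x.1 x.2 l.1 : ℝ) : ℂ)) *
    ((sphereIntegral x.2 : ℝ) : ℂ)

lemma constTerm_eq {R m : ℕ} (hm : m < R) (l : Idx n q) :
    constTerm a p Q m l = ∑ x ∈ pairs p Q R with poleIdx p Q x = m,
      a l * ((coeffM Q x.1 x.2 l : ℝ) : ℂ) * ((sphereIntegral x.2 : ℝ) : ℂ) := by
  rw [constTerm, finsum_setI_eq Q hm, Complex.ofReal_sum, Finset.mul_sum]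
  refine Finset.sum_congr rfl fun x _ => ?_
  push_cast
  ring

lemma summable_pairResidue (ha : RapidDecay a) (x : Σ _ : MultiIdx p, Vars n q →₀ ℕ) :
    Summable fun l : {l : Idx n q // firstSum l = 0} =>
      a l.1 * ((coeffM Q x.1 x.2 l.1 : ℝ) : ℂ) * ((sphereIntegral x.2 : ℝ) : ℂ) :=
  ((Summable.of_norm (rapidDecay_coeffM Q ha x).summable_norm).subtype
    {l | firstSum l = 0}).mul_right _

lemma summable_constTerm (ha : RapidDecay a) (m : ℕ) :
    Summable fun l : {l : Idx n q // firstSum l = 0} => constTerm a p Q m l.1 := by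
  simp only [constTerm_eq Q (Nat.lt_succ_self m)]
  exact summable_sum fun x _ => summable_pairResidue Q ha x

lemma constC_eq (ha : RapidDecay a) {R m : ℕ} (hm : m < R) :
    constC a p Q m = ∑ x ∈ pairs p Q R with poleIdx p Q x = m, pairResidue Q a x := by
  simp only [constC, constTerm_eq Q hm]
  rw [Summable.tsum_finsetSum fun x _ => summable_pairResidue Q ha x]
  exact Finset.sum_congr rfl fun x _ => tsum_mul_right

/-! ### Continuation -/

/-- The continuation to the half-plane `re s > n + d + |p|₁ - N`. -/
lemma exists_continuation_half_plane (hn : 1 ≤ n)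
    (hΘ : IsDiophantineMatrix ((1 / (2 * Real.pi)) • Θ)) (ha : RapidDecay a) (N : ℕ) :
    ∃ G : ℂ → ℂ,
      DifferentiableOn ℂ G {s | ((n + Q.totalDegree + ∑ i, p i : ℕ) : ℝ) - N < s.re} ∧
      ∀ s : ℂ, ((n + Q.totalDegree + ∑ i, p i : ℕ) : ℝ) < s.re → zetaSeries a p Q Θ s =
        ∑ m ∈ Finset.range N, constC a p Q m /
          (s - ((((n + Q.totalDegree + ∑ i, p i : ℕ) : ℝ) : ℂ) - m)) + G s := by
  classical
  set A : ℝ := ((n + Q.totalDegree + ∑ i, p i : ℕ) : ℝ) with hA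
  have hA' : A = n + Q.totalDegree + (∑ i, p i : ℕ) := by
    rw [hA, Nat.cast_add, Nat.cast_add]
  set S := pairs (n := n) p Q (N + 1)
  obtain ⟨C, M, hC, hrem⟩ := exists_remFun_bound (n := n) p Q (Nat.succ_pos N)
  have hG := fun x : Σ _ : MultiIdx p, Vars n q →₀ ℕ =>
    exists_continuation_weighted hn hΘ (rapidDecay_coeffM Q ha x) fun t => x.2 (Sum.inl t)
  choose G hGd hG using hG
  set shift : (Σ _ : MultiIdx p, Vars n q →₀ ℕ) → ℂ → ℂ :=
    fun x s => s + 2 * x.1.size - (∑ i, p i : ℕ) with hshift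
  -- The terms with `N ≤ poleIdx` have their poles outside of the half-plane.
  refine ⟨fun s => ∑ x ∈ S with N ≤ poleIdx p Q x, pairResidue Q a x / (s - (A - poleIdx p Q x)) +
    (∑ x ∈ S, G x (shift x s) + weightedSum a Θ (remFun p Q (N + 1)) s), ?_, fun s hs => ?_⟩
  · refine .add (DifferentiableOn.fun_sum fun x hx => ?_)
      (.add (DifferentiableOn.fun_sum fun x _ => ?_) ?_)
    · intro s hs
      have hs' : A - N < s.re := hs
      have hN : (N : ℝ) ≤ poleIdx p Q x := by exact_mod_cast (Finset.mem_filter.mp hx).2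
      refine ((differentiableAt_const _).div (by fun_prop) fun h0 => ?_).differentiableWithinAt
      have := congrArg Complex.re h0
      simp only [Complex.sub_re, Complex.ofReal_re, Complex.natCast_re, Complex.zero_re] at this
      linarith
    · exact ((hGd x).comp (by simp only [hshift]; fun_prop)).differentiableOn
    · refine (differentiableOn_weightedSum ha hC hrem).mono fun s hs => ?_
      have hs' : A - N < s.re := hs
      simp only [Set.mem_ofPred_eq]
      push_cast at hA' ⊢
      linarith
  · have hterm : ∀ x ∈ S,
        phaseSum (fun l => a l * ((coeffM Q x.1 x.2 l : ℝ) : ℂ)) (angle Θ)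
          (homTerm (monom fun t => x.2 (Sum.inl t)) (shift x s)) =
        pairResidue Q a x / (s - (A - poleIdx p Q x)) + G x (shift x s) := by
      intro x hx
      have hX := degX_le_of_mem_pairs Q hx
      have hre : (shift x s).re = s.re + 2 * x.1.size - (∑ i, p i : ℕ) := by simp [hshift]
      rw [hG x (shift x s)]
      · have hcast : ((poleIdx p Q x : ℕ) : ℂ) = 2 * x.1.size + Q.totalDegree - degX x.2 := by
          rw [poleIdx, Nat.cast_sub (by omega)]
          push_cast
          ring
        have hpole : shift x s - (n + (∑ t : Fin n, x.2 (Sum.inl t) : ℕ)) =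
            s - (A - poleIdx p Q x) := by
          rw [hcast, hA', hshift]
          change _ - (_ + ((degX x.2 : ℕ) : ℂ)) = _
          simp only [Complex.ofReal_add, Complex.ofReal_natCast]
          ring
        rw [hpole]
        rfl
      · rw [hre]
        have h2 : ((∑ t : Fin n, x.2 (Sum.inl t) : ℕ) : ℝ) ≤ x.1.size + Q.totalDegree := by
          exact_mod_cast hX
        have h3 : (0 : ℝ) ≤ x.1.size := Nat.cast_nonneg _
        linarith
    have hgroup : ∑ x ∈ S, pairResidue Q a x / (s - (A - poleIdx p Q x)) =
        ∑ m ∈ Finset.range N, constC a p Q m / (s - (A - m)) +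
          ∑ x ∈ S with N ≤ poleIdx p Q x, pairResidue Q a x / (s - (A - poleIdx p Q x)) := by
      rw [← Finset.sum_filter_add_sum_filter_not S (fun x => poleIdx p Q x < N)]
      simp only [not_lt]
      congr 1
      rw [← Finset.sum_fiberwise_of_maps_to (s := {x ∈ S | poleIdx p Q x < N})
        (t := Finset.range N) (g := fun x => poleIdx p Q x)
        (fun x hx => Finset.mem_range.mpr (Finset.mem_filter.mp hx).2)]
      refine Finset.sum_congr rfl fun m hm => ?_
      have hmN := Finset.mem_range.mp hm
      rw [constC_eq Q ha (Nat.lt_succ_of_lt hmN), Finset.sum_div, Finset.filter_filter]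
      refine Finset.sum_congr ?_ fun x hx => ?_
      · ext x
        simp only [Finset.mem_filter]
        constructor
        · rintro ⟨h1, -, h3⟩
          exact ⟨h1, h3⟩
        · rintro ⟨h1, h3⟩
          exact ⟨h1, h3 ▸ hmN, h3⟩
      · rw [(Finset.mem_filter.mp hx).2]
    rw [zetaSeries_eq p Q ha hs, weightedSum_fullFun_eq Q ha (Nat.succ_pos N) hs,
      Finset.sum_congr rfl hterm, Finset.sum_add_distrib, hgroup]
    ring

end Assembly

/-- The local behaviour of a function with an at most simple pole. -/
lemma simple_pole {F h : ℂ → ℂ} {z₀ c : ℂ} (hh : AnalyticAt ℂ h z₀)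
    (hF : ∀ᶠ z in 𝓝 z₀, F z = c / (z - z₀) + h z) :
    MeromorphicAt F z₀ ∧ -1 ≤ meromorphicOrderAt F z₀ ∧
      (meromorphicOrderAt F z₀ < 0 ↔ c ≠ 0) ∧
      (c ≠ 0 → meromorphicOrderAt F z₀ = -1 ∧ HasResidueAt F z₀ c) := by
  by_cases hc : c = 0
  · have hFa : AnalyticAt ℂ F z₀ := hh.congr (by
      filter_upwards [hF] with z hz
      simp [hz, hc])
    have h0 := hFa.meromorphicOrderAt_nonneg
    exact ⟨hFa.meromorphicAt, le_trans (by decide) h0, ⟨fun h => absurd h (not_lt.mpr h0),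
      fun h => absurd hc h⟩, fun h => absurd hc h⟩
  · have hm : MeromorphicAt F z₀ := by
      refine MeromorphicAt.congr (f := fun z => c / (z - z₀) + h z) ?_ ?_
      · exact .add (.div (MeromorphicAt.const c z₀)
          ((MeromorphicAt.id z₀).sub (MeromorphicAt.const z₀ z₀))) hh.meromorphicAt
      · filter_upwards [hF.filter_mono nhdsWithin_le_nhds] with z hz using hz.symm
    have hord : meromorphicOrderAt F z₀ = ((-1 : ℤ) : WithTop ℤ) := by
      rw [meromorphicOrderAt_eq_int_iff hm]
      refine ⟨fun z => c + (z - z₀) * h z,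
        analyticAt_const.add ((analyticAt_id.sub analyticAt_const).mul hh), by simpa using hc, ?_⟩
      filter_upwards [hF.filter_mono nhdsWithin_le_nhds, self_mem_nhdsWithin] with z hz hne
      have hz0 : z - z₀ ≠ 0 := sub_ne_zero.mpr hne
      rw [hz, zpow_neg_one, smul_eq_mul]
      field_simp
    refine ⟨hm, by rw [hord]; rfl, ⟨fun _ => hc, fun _ => by rw [hord]; decide⟩,
      fun _ => ⟨by rw [hord]; rfl, 0, fun _ => c, h, rfl, hh, ?_⟩⟩
    filter_upwards [hF.filter_mono nhdsWithin_le_nhds] with z hz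
    simpa using hz

end TorusZeta

end

open TorusZeta in
theorem mainTheorem5 (n q : ℕ) (hn : 1 ≤ n) (hq : 2 ≤ q)
    (p : Fin (q - 1) → ℕ) (hp : ∃ i, p i ≠ 0)
    (Q : MvPolynomial (Fin n) ℝ) (Θ : Matrix (Fin n) (Fin n) ℝ)
    (hΘ : IsDiophantineMatrix ((1 / (2 * Real.pi)) • Θ))
    (a : Idx n q → ℂ) (ha : IsSchwartz a) :
    -- the double series defining `f` converges absolutely for `Re s > n + d + |p|₁`
    (∀ s : ℂ, ((n + Q.totalDegree + ∑ i, p i : ℕ) : ℝ) < s.re →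
      Summable fun x : Idx n q × {k : Fin n → ℤ // k ≠ 0} =>
        a x.1 * zetaTerm p Q Θ x.1 x.2.1 s) ∧
    -- the sets `I(m)` are finite and the series defining `C(f, m)` converge
    (∀ m : ℕ, (setI (n := n) p Q m).Finite) ∧
    (∀ m : ℕ, Summable fun l : {l : Idx n q // firstSum l = 0} => constTerm a p Q m l.1) ∧
    -- `F` is the meromorphic continuation of `f`
    ∃ F : ℂ → ℂ, Meromorphic F ∧
      (∀ s : ℂ, ((n + Q.totalDegree + ∑ i, p i : ℕ) : ℝ) < s.re → F s = zetaSeries a p Q Θ s) ∧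
      (∀ s : ℂ, (∀ m : ℕ, s ≠ polePoint p Q m) → AnalyticAt ℂ F s) ∧
      (∀ m : ℕ, -1 ≤ meromorphicOrderAt F (polePoint p Q m)) ∧
      ∀ m : ℕ,
        (meromorphicOrderAt F (polePoint p Q m) < 0 ↔ constC a p Q m ≠ 0) ∧
        (constC a p Q m ≠ 0 →
          meromorphicOrderAt F (polePoint p Q m) = -1 ∧
          HasResidueAt F (polePoint p Q m) (constC a p Q m)) := by
  have ha' := ha.rapidDecay
  refine ⟨fun s hs => summable_zetaTerm p Q ha' hs, setI_finite Q, summable_constTerm Q ha', ?_⟩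
  obtain ⟨F, hF, hFG⟩ := exists_glued ((n + Q.totalDegree + ∑ i, p i : ℕ) : ℝ)
    (constC a p Q) (zetaSeries a p Q Θ) (exists_continuation_half_plane Q hn hΘ ha')
  set A : ℝ := ((n + Q.totalDegree + ∑ i, p i : ℕ) : ℝ) with hA
  have hpt : ∀ m : ℕ, ((A : ℂ) - m) = polePoint p Q m := fun m => by
    rw [hA, polePoint]
    push_cast
    ring
  have hne : ∀ m j : ℕ, polePoint p Q m = polePoint p Q j → m = j := fun m j h => by
    rw [← hpt, ← hpt] at h
    exact_mod_cast sub_right_injective h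
  have hfrac : ∀ (s z : ℂ), s ≠ z → ∀ c : ℂ, AnalyticAt ℂ (fun w => c / (w - z)) s :=
    fun s z h c => analyticAt_const.div (analyticAt_id.sub analyticAt_const) (sub_ne_zero.mpr h)
  have hlocal : ∀ (s : ℂ) (N : ℕ), A - N < s.re → ∃ G : ℂ → ℂ, AnalyticAt ℂ G s ∧
      ∀ᶠ z in 𝓝 s, F z = ∑ m ∈ Finset.range N, constC a p Q m / (z - polePoint p Q m) + G z := by
    intro s N hN
    obtain ⟨G, hG, hG'⟩ := hFG N
    have hmem : {z : ℂ | A - N < z.re} ∈ 𝓝 s := (isOpen_re_gt _).mem_nhds hN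
    refine ⟨G, hG.analyticAt hmem, ?_⟩
    filter_upwards [hmem] with z hz
    rw [hG' z hz]
    simp only [hpt]
  have hana : ∀ s : ℂ, (∀ m : ℕ, s ≠ polePoint p Q m) → AnalyticAt ℂ F s := by
    intro s hs
    obtain ⟨N, hN⟩ := exists_nat_gt (A - s.re)
    obtain ⟨G, hG, hG'⟩ := hlocal s N (by linarith)
    refine AnalyticAt.congr (.add ?_ hG) (hG'.mono fun z hz => hz.symm)
    exact Finset.analyticAt_fun_sum _ fun m _ => hfrac s _ (hs m) _
  have hpole : ∀ m : ℕ, MeromorphicAt F (polePoint p Q m) ∧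
      -1 ≤ meromorphicOrderAt F (polePoint p Q m) ∧
      (meromorphicOrderAt F (polePoint p Q m) < 0 ↔ constC a p Q m ≠ 0) ∧
      (constC a p Q m ≠ 0 → meromorphicOrderAt F (polePoint p Q m) = -1 ∧
        HasResidueAt F (polePoint p Q m) (constC a p Q m)) := fun m => by
    obtain ⟨G, hG, hG'⟩ := hlocal (polePoint p Q m) (m + 1) (by
      rw [← hpt]
      simp)
    refine simple_pole (F := F) (c := constC a p Q m) (z₀ := polePoint p Q m)
      (h := fun z => ∑ j ∈ Finset.range m, constC a p Q j / (z - polePoint p Q j) + G z) ?_ ?_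
    · refine .add (Finset.analyticAt_fun_sum _ fun j hj => hfrac _ _ (fun h => ?_) _) hG
      exact (Finset.mem_range.mp hj).ne' (hne _ _ h)
    · filter_upwards [hG'] with z hz
      rw [hz, Finset.sum_range_succ]
      ring
  refine ⟨F, fun s => ?_, hF, hana, fun m => (hpole m).2.1, fun m => (hpole m).2.2⟩
  by_cases hs : ∃ m : ℕ, s = polePoint p Q m
  · obtain ⟨m, rfl⟩ := hs
    exact (hpole m).1
  · push Not at hs
    exact (hana s hs).meromorphicAt
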